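/- Let $n\ge 2$, $c\in\mathbb R$, let $\Sigma$ be a smooth $n$-dimensional manifold (Hausdorff, $\sigma$-compact, possibly with boundary $\partial\Sigma$), and let $X:\Sigma\to\mathbb R^{n+1}$ be an immersion of class $C^4$ with a continuous unit normal field $\nu$. Equip $\Sigma$ with the induced metric $g_{ij}=\langle\partial_iX,\partial_jX\rangle$, with volume measure $\mathrm d\Sigma$ on $\Sigma$, volume measure $\mathrm ds$ on $\partial\Sigma$, Laplace–Beltrami operator $\Delta_\Sigma$ and outward unit conormal $\mathfrak n$ along $\partial\Sigma$; let $h_{ij}=-\langle\partial_i\partial_jX,\nu\rangle$ be the second fundamental form $A$, $H=\frac1n g^{ij}h_{ij}$ the mean curvature, and $|A|^2=g^{ij}h_{jk}g^{kl}h_{li}$. For $S\subset\Sigma$ put $\mathcal H_c[X;S]=\int_S (H+c)^2\,\mathrm d\Sigma$. Let $X_t:\Sigma\to\mathbb R^{n+1}$, $|t|<\varepsilon$, be a variation of $X$: immersions with $X_0=X$, of class $C^3$ jointly in $(t,p)$, with unit normal fields $\nu_t$ (used to define the mean curvature of $X_t$) depending continuously on $(t,p)$, $\nu_0=\nu$.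 Suppose that the variational field is $\frac{\partial}{\partial t}\big|_{t=0}X_t=V+\Phi\nu$, where $V$ is tangent to $X$, and that it has compact support. Put $$ \begin{aligned} \delta=&-\frac{2}{n}\int_{\Sigma}\Big\{\Delta_{\Sigma}H+(H+c)\Big[|A|^2-\frac{n^2}{2}(H+c) H\Big]\Big\}\Phi\, \mathrm{d}\Sigma\\ &+\int_{\partial\Sigma}\Big\{(H+c)^2\langle V,\mathfrak{n}\rangle+\frac{2}{n}\big[\Phi\,\partial_{\mathfrak n} H-(H+c)\,\partial_{\mathfrak n} \Phi\big]\Big\}\, \mathrm{d}s . \end{aligned} $$ Then both integrals converge absolutely, and $\frac{\mathrm d}{\mathrm dt}\big|_{t=0}\mathcal H_c[X_t;K]=\delta$ for every compact $K\subset\Sigma$ containing the support of $V+\Phi\nu$, where $\mathcal H_c[X_t;K]$ is finite for all $|t|<\varepsilon$. Moreover, if $\mathcal H_c[X;\Sigma]<\infty$ and there is a compact set off which $X_t=X$ for all $t$ near $0$ (both hold automatically when $\Sigma$ is compact), then $\frac{\mathrm d}{\mathrm dt}\big|_{t=0}\mathcal H_c[X_t;\Sigma]=\delta$. -/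

import Mathlib

open Set Filter Topology MeasureTheory
open scoped Manifold ContDiff

noncomputable section

namespace Helfrich

section Local

variable {n : ℕ} [NeZero n] {M : Type*} [TopologicalSpace M] [ChartedSpace (EuclideanHalfSpace n) M]

/-- The `i`-th partial derivative at `x` of a function of `n` real variables on the closed
half-space `{x | 0 ≤ x 0}` (one-sided in the direction of `x 0` at points with `x 0 = 0`). -/
def pd {F : Type*} [NormedAddCommGroup F] [NormedSpace ℝ F] (i : Fin n)
    (f : EuclideanSpace ℝ (Fin n) → F) (x : EuclideanSpace ℝ (Fin n)) : F :=
  fderivWithin ℝ f (range (𝓡∂ n)) x (EuclideanSpace.single i 1)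

/-- The function `f` on `M` read in the preferred chart around `q`. -/
def rep {F : Type*} (q : M) (f : M → F) (x : EuclideanSpace ℝ (Fin n)) : F :=
  f ((extChartAt (𝓡∂ n) q).symm x)

/-- The matrix `g_ij = ⟨∂_i X, ∂_j X⟩` of the metric induced by `X`, at the point with coordinates
`x` in the chart around `q`. -/
def gram (X : M → EuclideanSpace ℝ (Fin (n + 1))) (q : M) (x : EuclideanSpace ℝ (Fin n)) :
    Matrix (Fin n) (Fin n) ℝ :=
  Matrix.of fun i j => inner ℝ (pd i (rep q X) x) (pd j (rep q X) x)

/-- The matrix `h_ij = -⟨∂_j ∂_i X, ν⟩` of the second fundamental form of `X` with respect to the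
unit normal `ν`, at the point with coordinates `x` in the chart around `q`. -/
def secondForm (X ν : M → EuclideanSpace ℝ (Fin (n + 1))) (q : M) (x : EuclideanSpace ℝ (Fin n)) :
    Matrix (Fin n) (Fin n) ℝ :=
  Matrix.of fun i j => -inner ℝ (pd j (pd i (rep q X)) x) (rep q ν x)

/-- The mean curvature `H = (1/n) g^{ij} h_ij`. -/
def meanCurvature (X ν : M → EuclideanSpace ℝ (Fin (n + 1))) (p : M) : ℝ :=
  (1 / (n : ℝ)) * ((gram X p (extChartAt (𝓡∂ n) p p))⁻¹ *
    secondForm X ν p (extChartAt (𝓡∂ n) p p)).trace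

/-- The squared norm `|A|² = g^{ij} h_jk g^{kl} h_li` of the second fundamental form. -/
def normSqA (X ν : M → EuclideanSpace ℝ (Fin (n + 1))) (p : M) : ℝ :=
  ((gram X p (extChartAt (𝓡∂ n) p p))⁻¹ * secondForm X ν p (extChartAt (𝓡∂ n) p p) *
    ((gram X p (extChartAt (𝓡∂ n) p p))⁻¹ * secondForm X ν p (extChartAt (𝓡∂ n) p p))).trace

/-- The Laplace–Beltrami operator of the induced metric,
`Δf = (det g)^{-1/2} ∂_i ((det g)^{1/2} g^{ij} ∂_j f)`. -/
def laplacian (X : M → EuclideanSpace ℝ (Fin (n + 1))) (f : M → ℝ) (p : M) : ℝ :=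
  (√(gram X p (extChartAt (𝓡∂ n) p p)).det)⁻¹ *
    ∑ i, pd i (fun x => √(gram X p x).det * ∑ j, (gram X p x)⁻¹ i j * pd j (rep p f) x)
      (extChartAt (𝓡∂ n) p p)

/-- The outward unit conormal of the boundary at a boundary point `p`, as a tangent vector of `M`:
in the chart around `p`, where `M` is `{x 0 ≥ 0}`, it has components `-g^{0j} / √g^{00}`. -/
def conormal (X : M → EuclideanSpace ℝ (Fin (n + 1))) (p : M) : TangentSpace (𝓡∂ n) p :=
  (WithLp.toLp 2 fun j => -(gram X p (extChartAt (𝓡∂ n) p p))⁻¹ 0 j /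
    √((gram X p (extChartAt (𝓡∂ n) p p))⁻¹ 0 0) : EuclideanSpace ℝ (Fin n))

/-- The outward unit conormal `𝔫` as a vector of the ambient Euclidean space. -/
def conormalVec (X : M → EuclideanSpace ℝ (Fin (n + 1))) (p : M) : EuclideanSpace ℝ (Fin (n + 1)) :=
  mfderiv (𝓡∂ n) 𝓘(ℝ, EuclideanSpace ℝ (Fin (n + 1))) X p (conormal X p)

/-- The derivative `∂_𝔫 f` in the direction of the outward unit conormal. -/
def conormalDeriv (X : M → EuclideanSpace ℝ (Fin (n + 1))) (f : M → ℝ) (p : M) : ℝ :=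
  mfderiv (𝓡∂ n) 𝓘(ℝ, ℝ) f p (conormal X p)

end Local

section Measures

/-- A smooth partition of unity subordinate to the preferred charts. -/
def chartPartition (n : ℕ) [NeZero n] (M : Type*) [TopologicalSpace M]
    [ChartedSpace (EuclideanHalfSpace n) M] [IsManifold (𝓡∂ n) ∞ M] [T2Space M]
    [SigmaCompactSpace M] : SmoothPartitionOfUnity M (𝓡∂ n) M univ :=
  (SmoothPartitionOfUnity.exists_isSubordinate_chartAt_source (𝓡∂ n) M).choose

theorem chartPartition_isSubordinate (n : ℕ) [NeZero n] (M : Type*) [TopologicalSpace M]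
    [ChartedSpace (EuclideanHalfSpace n) M] [IsManifold (𝓡∂ n) ∞ M] [T2Space M]
    [SigmaCompactSpace M] :
    (chartPartition n M).IsSubordinate fun q => (chartAt (EuclideanHalfSpace n) q).source :=
  (SmoothPartitionOfUnity.exists_isSubordinate_chartAt_source (𝓡∂ n) M).choose_spec

/-- The volume measure `dΣ` of the metric induced by `X`: the sum over the charts of the measures
`ρ_q √(det g) dx`, where `ρ` is a partition of unity subordinate to the charts. -/
def volMeasure {n : ℕ} [NeZero n] {M : Type*} [TopologicalSpace M]
    [ChartedSpace (EuclideanHalfSpace n) M] [IsManifold (𝓡∂ n) ∞ M] [T2Space M]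
    [SigmaCompactSpace M] [MeasurableSpace M]
    (X : M → EuclideanSpace ℝ (Fin (n + 1))) : Measure M :=
  Measure.sum fun q : M =>
    ((volume.restrict (extChartAt (𝓡∂ n) q).target).withDensity fun x =>
      ENNReal.ofReal (rep q (chartPartition n M q) x * √(gram X q x).det)).map
    (extChartAt (𝓡∂ n) q).symm

/-- The inclusion `y ↦ (0, y)` of `ℝ^m` as the boundary of the half-space of `ℝ^(m+1)`. -/
def face {m : ℕ} (y : EuclideanSpace ℝ (Fin m)) : EuclideanSpace ℝ (Fin (m + 1)) :=
  WithLp.toLp 2 (Fin.cons (0 : ℝ) fun i => y i)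

/-- The volume measure `ds` of the boundary `∂M` (of dimension `m`) for the metric induced by `X`,
as a measure on `M`: the sum over the charts of the measures `ρ_q √(det g^∂) dy` on the part
`{x 0 = 0}` of the chart, where `g^∂` is the restriction of the metric to the directions
tangent to it. -/
def boundaryMeasure {m : ℕ} {M : Type*} [TopologicalSpace M]
    [ChartedSpace (EuclideanHalfSpace (m + 1)) M] [IsManifold (𝓡∂ (m + 1)) ∞ M] [T2Space M]
    [SigmaCompactSpace M] [MeasurableSpace M]
    (X : M → EuclideanSpace ℝ (Fin (m + 1 + 1))) : Measure M :=
  Measure.sum fun q : M =>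
    ((volume.restrict {y : EuclideanSpace ℝ (Fin m) |
        face y ∈ (extChartAt (𝓡∂ (m + 1)) q).target}).withDensity fun y =>
      ENNReal.ofReal (rep q (chartPartition (m + 1) M q) (face y) *
        √((gram X q (face y)).submatrix Fin.succ Fin.succ).det)).map
    fun y => (extChartAt (𝓡∂ (m + 1)) q).symm (face y)

/-- The Helfrich energy `∫ (H + c)² dΣ` of the part `S` of the immersed hypersurface `X` with unit
normal `ν`. -/
def energyOn {n : ℕ} [NeZero n] {M : Type*} [TopologicalSpace M]
    [ChartedSpace (EuclideanHalfSpace n) M] [IsManifold (𝓡∂ n) ∞ M] [T2Space M]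
    [SigmaCompactSpace M] [MeasurableSpace M] (c : ℝ)
    (X ν : M → EuclideanSpace ℝ (Fin (n + 1))) (S : Set M) : ℝ :=
  ∫ p in S, (meanCurvature X ν p + c) ^ 2 ∂(volMeasure X)

/-- The Helfrich energy of the whole hypersurface. -/
def energy {n : ℕ} [NeZero n] {M : Type*} [TopologicalSpace M]
    [ChartedSpace (EuclideanHalfSpace n) M] [IsManifold (𝓡∂ n) ∞ M] [T2Space M]
    [SigmaCompactSpace M] [MeasurableSpace M] (c : ℝ)
    (X ν : M → EuclideanSpace ℝ (Fin (n + 1))) : ℝ :=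
  ∫ p, (meanCurvature X ν p + c) ^ 2 ∂(volMeasure X)

end Measures

section Immersion

variable {n : ℕ} [NeZero n] {M : Type*} [TopologicalSpace M] [ChartedSpace (EuclideanHalfSpace n) M]

/-- The differential of `X` is injective at every point. -/
def HasInjectiveDifferential (X : M → EuclideanSpace ℝ (Fin (n + 1))) : Prop :=
  ∀ p, Function.Injective (mfderiv (𝓡∂ n) 𝓘(ℝ, EuclideanSpace ℝ (Fin (n + 1))) X p)

/-- `ν` is a field of unit vectors orthogonal to the image of the differential of `X`. -/
def IsUnitNormal (X ν : M → EuclideanSpace ℝ (Fin (n + 1))) : Prop :=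
  ∀ p, ‖ν p‖ = 1 ∧ ∀ v : TangentSpace (𝓡∂ n) p,
    inner ℝ (ν p) (mfderiv (𝓡∂ n) 𝓘(ℝ, EuclideanSpace ℝ (Fin (n + 1))) X p v) = 0

/-- `V` is tangent to the hypersurface `X`. -/
def IsTangent (X V : M → EuclideanSpace ℝ (Fin (n + 1))) : Prop :=
  ∀ p, ∃ v : TangentSpace (𝓡∂ n) p,
    mfderiv (𝓡∂ n) 𝓘(ℝ, EuclideanSpace ℝ (Fin (n + 1))) X p v = V p

/-- A variation of the immersed hypersurface `X` with unit normal field `ν`: a family `F t`,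
`|t| < ε`, of immersions, jointly of class `C³` in the time and the point, with `F 0 = X`, and
unit normal fields `N t` of `F t` that are jointly continuous, with `N 0 = ν`. -/
structure IsVariation (X ν : M → EuclideanSpace ℝ (Fin (n + 1))) (ε : ℝ)
    (F N : ℝ → M → EuclideanSpace ℝ (Fin (n + 1))) : Prop where
  pos : 0 < ε
  contMDiffOn : ContMDiffOn (𝓘(ℝ, ℝ).prod (𝓡∂ n)) 𝓘(ℝ, EuclideanSpace ℝ (Fin (n + 1))) 3
    (Function.uncurry F) (Ioo (-ε) ε ×ˢ univ)
  immersion : ∀ t ∈ Ioo (-ε) ε, HasInjectiveDifferential (F t)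
  continuousOn_normal : ContinuousOn (Function.uncurry N) (Ioo (-ε) ε ×ˢ univ)
  unitNormal : ∀ t ∈ Ioo (-ε) ε, IsUnitNormal (F t) (N t)
  zero : F 0 = X
  normal_zero : N 0 = ν

/-- The integrand of the interior term,
`{ΔH + (H + c) [|A|² - (n²/2) (H + c) H]} Φ`. -/
def interiorIntegrand (c : ℝ) (X ν : M → EuclideanSpace ℝ (Fin (n + 1))) (Φ : M → ℝ) (p : M) : ℝ :=
  (laplacian X (meanCurvature X ν) p + (meanCurvature X ν p + c) *
    (normSqA X ν p - (n : ℝ) ^ 2 / 2 * (meanCurvature X ν p + c) * meanCurvature X ν p)) * Φ p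

/-- The integrand of the boundary term,
`(H + c)² ⟨V, 𝔫⟩ + (2/n) [Φ ∂_𝔫 H - (H + c) ∂_𝔫 Φ]`. -/
def boundaryIntegrand (c : ℝ) (X ν V : M → EuclideanSpace ℝ (Fin (n + 1))) (Φ : M → ℝ) (p : M) :
    ℝ :=
  (meanCurvature X ν p + c) ^ 2 * inner ℝ (V p) (conormalVec X p) +
    2 / (n : ℝ) * (Φ p * conormalDeriv X (meanCurvature X ν) p -
      (meanCurvature X ν p + c) * conormalDeriv X Φ p)

end Immersion

/-- The right-hand side of the first variation formula, on a hypersurface of dimension `m + 1`. -/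
def firstVariation {m : ℕ} {M : Type*} [TopologicalSpace M]
    [ChartedSpace (EuclideanHalfSpace (m + 1)) M] [IsManifold (𝓡∂ (m + 1)) ∞ M] [T2Space M]
    [SigmaCompactSpace M] [MeasurableSpace M] (c : ℝ)
    (X ν V : M → EuclideanSpace ℝ (Fin (m + 1 + 1))) (Φ : M → ℝ) : ℝ :=
  -(2 / ((m + 1 : ℕ) : ℝ)) * ∫ p, interiorIntegrand c X ν Φ p ∂(volMeasure X) +
    ∫ p, boundaryIntegrand c X ν V Φ p ∂(boundaryMeasure X)

end Helfrich

end

open Set Filter Topology MeasureTheory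
open scoped Manifold ContDiff

noncomputable section

/-! In a fixed chart the energy density is `(H + c)² √(det g)`, and the theorem rests on its
derivative at `t = 0` along the field `V + Φν`. Two classical formulas give it: `δ√(det g) = √(det
g) (div V + nHΦ)` (`hasDerivAt_sqrt_det`) and `δH = ⟨∇H, V⟩ - (1/n)(|A|²Φ + ΔΦ)`
(`hasDerivAt_meanCurvature`). The terms carrying derivatives of `V` and `Φ` are completed to a
divergence: with the tangent field `Y = (H + c)² V + (2/n)(Φ∇H - (H + c)∇Φ)` (`flux`), the density
changes at the rate `√(det g)` times `-(2/n)` the interior integrand plus `div Y`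
(`hasDerivAt_energyDensity`). Since `⟨Y, 𝔫⟩` is exactly the boundary integrand
(`boundaryIntegrand_eq`), the divergence theorem (`IsHypersurface.integral_surfDiv`) finishes the
local computation.

The formula for `δH` comes from matrix calculus. By the Weingarten equation `h_ij = ⟨∂_i X, ∂_j ν⟩`,
so with `G` the metric and `B` this matrix, `nH = tr(G⁻¹B)` involves one derivative of `X` and one
of `ν`. Differentiating `⟨ν, ∂_i X⟩ = 0` and `|ν|² = 1` in time yields `δν = V^j ∂_j ν - ∇Φ`
(`rep_normalDeriv`). The tangential part of the field changes `G` and `B` by their Lie derivatives.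
In the trace the terms with `P = (∂_i V^k)` cancel, the transport terms `V^l ∂_l` add up to `⟨∇H,
V⟩`, and the normal part leaves `|A|²Φ + ΔΦ` (`trace_variation`).

Regularity is just sufficient. Since `X` is `C⁴`, `ν` is `C³`, `H` is `C²` and `ΔH` is continuous;
the field is the time derivative of a `C³` family, so `V` and `Φ` are `C²` and `Y` is `C¹`. The
family of densities is `C¹` jointly in time and space, which permits differentiation under the
integral over compact sets.

The geometric quantities at `p` are defined in the preferred chart of `p`, so each must be shown to
have the same formula in every chart: matrices of the type of `G` and `B` transform as `Jᵀ · J`, and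
traces of `G⁻¹B` and of its square are invariant. The divergence theorem is reduced by a partition
of unity to a box in the half-space; along the boundary, row `0` of the Jacobian of a coordinate
change is a positive multiple of `dx⁰`, which makes the conormal well defined.

For the whole energy, a variation fixed off a compact set also has a fixed normal there, by
continuity in time, so the energy of the complement is a constant. -/

namespace Helfrich

/-! ### Directional derivatives within a set -/

section DirectionalDerivative

variable {Z : Type*} [NormedAddCommGroup Z] [NormedSpace ℝ Z]
  {F : Type*} [NormedAddCommGroup F] [NormedSpace ℝ F] {s : Set Z} {x w : Z}

/-- The derivative at `x` within `s` in the direction `w`. -/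
def dirDeriv (s : Set Z) (w : Z) (f : Z → F) (x : Z) : F := fderivWithin ℝ f s x w

theorem dirDeriv_add {f g : Z → F} (hs : UniqueDiffWithinAt ℝ s x)
    (hf : DifferentiableWithinAt ℝ f s x) (hg : DifferentiableWithinAt ℝ g s x) :
    dirDeriv s w (fun y => f y + g y) x = dirDeriv s w f x + dirDeriv s w g x := by
  simp [dirDeriv, fderivWithin_fun_add hs hf hg]

theorem dirDeriv_sub {f g : Z → F} (hs : UniqueDiffWithinAt ℝ s x)
    (hf : DifferentiableWithinAt ℝ f s x) (hg : DifferentiableWithinAt ℝ g s x) :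
    dirDeriv s w (fun y => f y - g y) x = dirDeriv s w f x - dirDeriv s w g x := by
  simp [dirDeriv, fderivWithin_fun_sub hs hf hg]

theorem dirDeriv_mul {f g : Z → ℝ} (hs : UniqueDiffWithinAt ℝ s x)
    (hf : DifferentiableWithinAt ℝ f s x) (hg : DifferentiableWithinAt ℝ g s x) :
    dirDeriv s w (fun y => f y * g y) x = dirDeriv s w f x * g x + f x * dirDeriv s w g x := by
  simp [dirDeriv, fderivWithin_fun_mul hs hf hg]; ring

theorem dirDeriv_smul {f : Z → ℝ} {g : Z → F} (hs : UniqueDiffWithinAt ℝ s x)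
    (hf : DifferentiableWithinAt ℝ f s x) (hg : DifferentiableWithinAt ℝ g s x) :
    dirDeriv s w (fun y => f y • g y) x = dirDeriv s w f x • g x + f x • dirDeriv s w g x := by
  simp [dirDeriv, fderivWithin_fun_smul hs hf hg, add_comm]

theorem dirDeriv_inner {F : Type*} [NormedAddCommGroup F] [InnerProductSpace ℝ F] {f g : Z → F}
    (hs : UniqueDiffWithinAt ℝ s x)
    (hf : DifferentiableWithinAt ℝ f s x) (hg : DifferentiableWithinAt ℝ g s x) :
    dirDeriv s w (fun y => inner ℝ (f y) (g y)) x =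
      inner ℝ (dirDeriv s w f x) (g x) + inner ℝ (f x) (dirDeriv s w g x) := by
  have h := (hf.hasFDerivWithinAt.inner ℝ hg.hasFDerivWithinAt).fderivWithin hs
  simp [dirDeriv, h, add_comm]

theorem dirDeriv_sum {ι : Type*} {u : Finset ι} {f : ι → Z → F} (hs : UniqueDiffWithinAt ℝ s x)
    (hf : ∀ i ∈ u, DifferentiableWithinAt ℝ (f i) s x) :
    dirDeriv s w (fun y => ∑ i ∈ u, f i y) x = ∑ i ∈ u, dirDeriv s w (f i) x := by
  simp [dirDeriv, fderivWithin_fun_sum hs hf]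

theorem dirDeriv_congr {f g : Z → F} (h : f =ᶠ[𝓝[s] x] g) (hx : f x = g x) :
    dirDeriv s w f x = dirDeriv s w g x := by
  simp only [dirDeriv, h.fderivWithin_eq hx]

theorem dirDeriv_const (a : F) : dirDeriv s w (fun _ => a) x = 0 := by
  simp [dirDeriv]

theorem deriv_eq_dirDeriv (f : ℝ → F) (t : ℝ) : deriv f t = dirDeriv univ 1 f t := by
  simp [dirDeriv, fderivWithin_univ]

end DirectionalDerivative

/-! ### Calculus of matrix-valued functions -/

section MatrixCalculus

variable {Z : Type*} [NormedAddCommGroup Z] [NormedSpace ℝ Z] {n l r : ℕ} {s : Set Z} {x w : Z}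

/-- The entrywise derivative of a matrix-valued function in the direction `w`. -/
def matrixDeriv (s : Set Z) (w : Z) (A : Z → Matrix (Fin n) (Fin l) ℝ) (x : Z) :
    Matrix (Fin n) (Fin l) ℝ :=
  Matrix.of fun i j => dirDeriv s w (fun y => A y i j) x

/-- The entries of a matrix-valued function are differentiable. -/
def MatrixDiff (s : Set Z) (x : Z) (A : Z → Matrix (Fin n) (Fin l) ℝ) : Prop :=
  ∀ i j, DifferentiableWithinAt ℝ (fun y => A y i j) s x

/-- The entries of a matrix-valued function are of class `C^k` on `s`. -/
def MatrixContDiffOn (k : ℕ∞ω) (s : Set Z) (A : Z → Matrix (Fin n) (Fin l) ℝ) : Prop :=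
  ∀ i j, ContDiffOn ℝ k (fun y => A y i j) s

theorem MatrixDiff.mul {A : Z → Matrix (Fin n) (Fin l) ℝ} {B : Z → Matrix (Fin l) (Fin r) ℝ}
    (hA : MatrixDiff s x A) (hB : MatrixDiff s x B) : MatrixDiff s x fun y => A y * B y := by
  intro i j
  simp only [Matrix.mul_apply]
  exact DifferentiableWithinAt.fun_sum fun k _ => (hA i k).mul (hB k j)

theorem MatrixContDiffOn.mul {k : ℕ∞ω} {A : Z → Matrix (Fin n) (Fin l) ℝ}
    {B : Z → Matrix (Fin l) (Fin r) ℝ}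
    (hA : MatrixContDiffOn k s A) (hB : MatrixContDiffOn k s B) :
    MatrixContDiffOn k s fun y => A y * B y := by
  intro i j
  simp only [Matrix.mul_apply]
  exact ContDiffOn.sum fun k _ => (hA i k).mul (hB k j)

theorem MatrixContDiffOn.trace {k : ℕ∞ω} {A : Z → Matrix (Fin n) (Fin n) ℝ}
    (hA : MatrixContDiffOn k s A) : ContDiffOn ℝ k (fun y => (A y).trace) s := by
  simp only [Matrix.trace, Matrix.diag_apply]
  exact ContDiffOn.sum fun k _ => hA k k

theorem MatrixContDiffOn.det {k : ℕ∞ω} {A : Z → Matrix (Fin n) (Fin n) ℝ}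
    (hA : MatrixContDiffOn k s A) : ContDiffOn ℝ k (fun y => (A y).det) s := by
  simp only [Matrix.det_apply']
  exact ContDiffOn.sum fun σ _ => contDiffOn_const.mul (contDiffOn_prod fun i _ => hA _ _)

theorem contDiff_det : ContDiff ℝ ω fun B : Fin n → Fin n → ℝ => (Matrix.of B).det := by
  rw [← contDiffOn_univ]
  refine MatrixContDiffOn.det (A := fun B => Matrix.of B) fun i j => ?_
  simp only [Matrix.of_apply]
  fun_prop

theorem MatrixDiff.pi {A : Z → Matrix (Fin n) (Fin l) ℝ} (hA : MatrixDiff s x A) :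
    DifferentiableWithinAt ℝ (fun y i j => A y i j) s x :=
  differentiableWithinAt_pi.2 fun i => differentiableWithinAt_pi.2 fun j => hA i j

theorem MatrixDiff.det {A : Z → Matrix (Fin n) (Fin n) ℝ}
    (hA : MatrixDiff s x A) : DifferentiableWithinAt ℝ (fun y => (A y).det) s x :=
  DifferentiableAt.comp_differentiableWithinAt (f := fun y i j => A y i j) x
    (contDiff_det.differentiable (by simp) fun i j => A x i j) hA.pi

/-- Cramer's rule: the entries of the inverse are determinants, each of `A` with one row replaced by
a constant unit vector, divided by `det A`. -/
theorem MatrixContDiffOn.inv {k : ℕ∞ω} {A : Z → Matrix (Fin n) (Fin n) ℝ}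
    (hA : MatrixContDiffOn k s A) (h0 : ∀ y ∈ s, (A y).det ≠ 0) :
    MatrixContDiffOn k s fun y => (A y)⁻¹ := by
  intro i j
  simp only [Matrix.inv_def, Matrix.smul_apply, smul_eq_mul, Ring.inverse_eq_inv',
    Matrix.adjugate_apply]
  refine (hA.det.inv h0).mul (MatrixContDiffOn.det (A := fun y => (A y).updateRow j (Pi.single i 1))
    fun a b => ?_)
  by_cases hj : a = j
  · subst hj; simpa using contDiffOn_const
  · simpa [Matrix.updateRow_ne hj] using hA a b

theorem MatrixDiff.inv {A : Z → Matrix (Fin n) (Fin n) ℝ}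
    (hA : MatrixDiff s x A) (h0 : (A x).det ≠ 0) : MatrixDiff s x fun y => (A y)⁻¹ := by
  intro i j
  simp only [Matrix.inv_def, Matrix.smul_apply, smul_eq_mul, Ring.inverse_eq_inv',
    Matrix.adjugate_apply]
  refine (hA.det.inv h0).mul (MatrixDiff.det (A := fun y => (A y).updateRow j (Pi.single i 1))
    fun a b => ?_)
  by_cases hj : a = j
  · subst hj; simpa using differentiableWithinAt_const _
  · simpa [Matrix.updateRow_ne hj] using hA a b

theorem MatrixDiff.trace {A : Z → Matrix (Fin n) (Fin n) ℝ} (hA : MatrixDiff s x A) :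
    DifferentiableWithinAt ℝ (fun y => (A y).trace) s x := by
  simp only [Matrix.trace, Matrix.diag_apply]
  exact DifferentiableWithinAt.fun_sum fun k _ => hA k k

theorem matrixDeriv_mul {A : Z → Matrix (Fin n) (Fin l) ℝ} {B : Z → Matrix (Fin l) (Fin r) ℝ}
    (hs : UniqueDiffWithinAt ℝ s x) (hA : MatrixDiff s x A) (hB : MatrixDiff s x B) :
    matrixDeriv s w (fun y => A y * B y) x =
      matrixDeriv s w A x * B x + A x * matrixDeriv s w B x := by
  ext i j
  simp only [matrixDeriv, Matrix.of_apply, Matrix.add_apply, Matrix.mul_apply]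
  rw [dirDeriv_sum hs fun k _ => (hA i k).fun_mul (hB k j), ← Finset.sum_add_distrib]
  exact Finset.sum_congr rfl fun k _ => dirDeriv_mul hs (hA i k) (hB k j)

theorem dirDeriv_trace {A : Z → Matrix (Fin n) (Fin n) ℝ}
    (hs : UniqueDiffWithinAt ℝ s x) (hA : MatrixDiff s x A) :
    dirDeriv s w (fun y => (A y).trace) x = (matrixDeriv s w A x).trace := by
  simp only [matrixDeriv, Matrix.trace, Matrix.diag_apply, Matrix.of_apply]
  exact dirDeriv_sum hs fun k _ => hA k k

/-- Differentiate `A A⁻¹ = 1`, which holds near `x` within `s` because `det A` stays nonzero by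
continuity. -/
theorem matrixDeriv_inv {A : Z → Matrix (Fin n) (Fin n) ℝ}
    (hs : UniqueDiffWithinAt ℝ s x) (hA : MatrixDiff s x A) (h0 : (A x).det ≠ 0) :
    matrixDeriv s w (fun y => (A y)⁻¹) x = -((A x)⁻¹ * matrixDeriv s w A x * (A x)⁻¹) := by
  have hu : IsUnit (A x).det := h0.isUnit
  have h1 : matrixDeriv s w (fun y => A y * (A y)⁻¹) x = 0 := by
    ext i j
    simp only [matrixDeriv, Matrix.of_apply, Matrix.zero_apply]
    rw [dirDeriv_congr (g := fun _ => (1 : Matrix (Fin n) (Fin n) ℝ) i j), dirDeriv_const]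
    · filter_upwards [hA.det.continuousWithinAt.eventually_ne h0] with y hy
      rw [Matrix.mul_nonsing_inv _ (Ne.isUnit hy)]
    · rw [Matrix.mul_nonsing_inv _ hu]
  rw [matrixDeriv_mul hs hA (hA.inv h0)] at h1
  have h2 := congrArg (fun B => (A x)⁻¹ * B) h1
  simp only [Matrix.mul_add, Matrix.mul_zero, ← Matrix.mul_assoc, Matrix.nonsing_inv_mul _ hu,
    Matrix.one_mul] at h2
  exact eq_neg_of_add_eq_zero_right h2

/-- Jacobi's formula. By the chain rule only the derivative of `det` along the line `r ↦ A + rB` is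
needed, and `det (A + rB) = det A · det (1 + r A⁻¹B)`. -/
theorem dirDeriv_det {A : Z → Matrix (Fin n) (Fin n) ℝ}
    (hs : UniqueDiffWithinAt ℝ s x) (hA : MatrixDiff s x A) (h0 : (A x).det ≠ 0) :
    dirDeriv s w (fun y => (A y).det) x = (A x).det * ((A x)⁻¹ * matrixDeriv s w A x).trace := by
  set d : (Fin n → Fin n → ℝ) → ℝ := fun B => (Matrix.of B).det with hd
  have hdd : Differentiable ℝ d := contDiff_det.differentiable (by simp)
  have hA' : DifferentiableWithinAt ℝ (fun y i j => A y i j) s x := hA.pi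
  have key : dirDeriv s w (fun y => (A y).det) x =
      fderiv ℝ d (fun i j => A x i j) (matrixDeriv s w A x) := by
    have h := fderiv_comp_fderivWithin x (hdd (fun i j => A x i j)) hA' hs
    have h1 : dirDeriv s w (fun y => (A y).det) x =
      fderivWithin ℝ (d ∘ fun y i j => A y i j) s x w := rfl
    rw [h1, h]
    simp only [ContinuousLinearMap.comp_apply]
    congr 1
    ext i j
    rw [fderivWithin_pi (fun i => differentiableWithinAt_pi.2 fun j => hA i j) hs]
    simp only [ContinuousLinearMap.pi_apply]
    rw [fderivWithin_pi (fun j => hA i j) hs]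
    rfl
  rw [key]
  set B := matrixDeriv s w A x
  have hline : HasDerivAt (fun r : ℝ => d ((fun i j => A x i j) + r • fun i j => B i j))
      (fderiv ℝ d (fun i j => A x i j) (fun i j => B i j)) 0 := by
    have h1 : HasDerivAt (fun r : ℝ => (fun i j => A x i j) + r • fun i j => B i j)
        (fun i j => B i j) 0 := by
      simpa using ((hasDerivAt_id (0 : ℝ)).smul_const (fun i j => B i j)).const_add
        (fun i j => A x i j)
    have h2 : HasFDerivAt d (fderiv ℝ d (fun i j => A x i j))
        ((fun i j => A x i j) + (0 : ℝ) • fun i j => B i j) := by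
      simpa using (hdd (fun i j => A x i j)).hasFDerivAt
    exact h2.comp_hasDerivAt (0 : ℝ) h1
  have hu : IsUnit (A x).det := h0.isUnit
  -- `P` is the remainder in `det (1 + r A⁻¹B) = 1 + r tr(A⁻¹B) + r² P(r)`; being a polynomial, it
  -- does not affect the derivative at `r = 0`.
  set P := (Matrix.det (1 + (Polynomial.X : Polynomial ℝ) •
    ((A x)⁻¹ * B).map Polynomial.C)).divX.divX with hP
  have heq : (fun r : ℝ => d ((fun i j => A x i j) + r • fun i j => B i j)) =
      fun r => (A x).det * (1 + ((A x)⁻¹ * B).trace * r + P.eval r * r ^ 2) := by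
    funext r
    rw [hP, ← Matrix.det_one_add_smul, ← Matrix.det_mul, Matrix.mul_add, Matrix.mul_smul,
      ← Matrix.mul_assoc, Matrix.mul_nonsing_inv _ hu, Matrix.one_mul, Matrix.mul_one]
    rfl
  rw [heq] at hline
  refine hline.unique ?_
  have h3 : HasDerivAt (fun r : ℝ => P.eval r * r ^ 2) 0 0 := by
    simpa using (P.hasDerivAt 0).fun_mul ((hasDerivAt_id (0 : ℝ)).fun_pow 2)
  have h4 : HasDerivAt (fun r : ℝ => 1 + ((A x)⁻¹ * B).trace * r) ((A x)⁻¹ * B).trace 0 := by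
    simpa using ((hasDerivAt_id (0 : ℝ)).const_mul ((A x)⁻¹ * B).trace).const_add 1
  simpa using (h4.add h3).const_mul (A x).det

theorem dirDeriv_sqrt_det {A : Z → Matrix (Fin n) (Fin n) ℝ}
    (hs : UniqueDiffWithinAt ℝ s x) (hA : MatrixDiff s x A) (h0 : 0 < (A x).det) :
    dirDeriv s w (fun y => √(A y).det) x =
      √(A x).det * (2⁻¹ * ((A x)⁻¹ * matrixDeriv s w A x).trace) := by
  have h1 : HasFDerivWithinAt (fun y => √(A y).det) _ s x :=
    hA.det.hasFDerivWithinAt.sqrt h0.ne'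
  have h2 := dirDeriv_det (w := w) hs hA h0.ne'
  simp only [dirDeriv] at h2 ⊢
  rw [h1.fderivWithin hs]
  simp only [smul_apply, h2, smul_eq_mul]
  have h3 := Real.mul_self_sqrt h0.le
  have h4 : √(A x).det ≠ 0 := (Real.sqrt_pos.2 h0).ne'
  field_simp
  rw [sq, h3]

end MatrixCalculus

/-! ### Linear algebra of a tangent frame and its unit normal -/

section Frame

variable {n : ℕ}

/-- The combination of the vectors `a i` whose inner products with them are `b i`. -/
def raise (a : Fin n → EuclideanSpace ℝ (Fin (n + 1))) (b : Fin n → ℝ) :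
    EuclideanSpace ℝ (Fin (n + 1)) :=
  ∑ i, (∑ j, (Matrix.gram ℝ a)⁻¹ i j * b j) • a i

variable {a : Fin n → EuclideanSpace ℝ (Fin (n + 1))} {ν : EuclideanSpace ℝ (Fin (n + 1))}

theorem det_gram_pos (ha : LinearIndependent ℝ a) : 0 < (Matrix.gram ℝ a).det :=
  (Matrix.posDef_gram_of_linearIndependent ha).det_pos

theorem inner_raise (ha : LinearIndependent ℝ a) (b : Fin n → ℝ) (k : Fin n) :
    inner ℝ (raise a b) (a k) = b k := by
  have h : (Matrix.gram ℝ a) * (Matrix.gram ℝ a)⁻¹ = 1 :=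
    Matrix.mul_nonsing_inv _ (det_gram_pos ha).ne'.isUnit
  have h1 : (Matrix.gram ℝ a).mulVec ((Matrix.gram ℝ a)⁻¹.mulVec b) k = b k := by
    rw [Matrix.mulVec_mulVec, h, Matrix.one_mulVec]
  rw [← h1, raise, sum_inner]
  simp only [Matrix.mulVec, dotProduct, inner_smul_left, Matrix.gram_apply]
  exact Finset.sum_congr rfl fun i _ => by rw [real_inner_comm (a k) (a i)]; simp [mul_comm]

theorem inner_raise_normal (hν : ∀ i, inner ℝ ν (a i) = 0) (b : Fin n → ℝ) :
    inner ℝ (raise a b) ν = 0 := by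
  rw [raise, sum_inner]
  exact Finset.sum_eq_zero fun i _ => by
    rw [inner_smul_left, real_inner_comm, hν, mul_zero]

/-- The normal is not in the span of the frame, so together they are `n + 1` independent vectors of
`ℝ^(n+1)` and span it; a vector orthogonal to all of them is orthogonal to itself. -/
theorem eq_zero_of_orthogonal_frame (ha : LinearIndependent ℝ a) (h1 : ‖ν‖ = 1)
    (hν : ∀ i, inner ℝ ν (a i) = 0) {z : EuclideanSpace ℝ (Fin (n + 1))}
    (hz : ∀ i, inner ℝ z (a i) = 0) (hzν : inner ℝ z ν = 0) : z = 0 := by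
  have hnot : ν ∉ Submodule.span ℝ (range a) := by
    intro hmem
    have : inner ℝ ν ν = 0 := by
      refine Submodule.span_induction (p := fun y _ => inner ℝ ν y = 0) ?_ ?_ ?_ ?_ hmem
      · rintro _ ⟨i, rfl⟩; exact hν i
      · simp
      · intro u v _ _ hu hv; rw [inner_add_right, hu, hv, add_zero]
      · intro r u _ hu; rw [inner_smul_right, hu, mul_zero]
    rw [real_inner_self_eq_norm_sq, h1] at this
    norm_num at this
  have hli : LinearIndependent ℝ (Fin.cons ν a : Fin (n + 1) → EuclideanSpace ℝ (Fin (n + 1))) :=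
    linearIndependent_finCons.2 ⟨ha, hnot⟩
  have htop := hli.span_eq_top_of_card_eq_finrank (by simp)
  have hmem : z ∈ Submodule.span ℝ
      (range (Fin.cons ν a : Fin (n + 1) → EuclideanSpace ℝ (Fin (n + 1)))) := by
    rw [htop]; trivial
  have : inner ℝ z z = 0 := by
    refine Submodule.span_induction (p := fun y _ => inner ℝ z y = 0) ?_ ?_ ?_ ?_ hmem
    · rintro _ ⟨i, rfl⟩
      refine Fin.cases ?_ (fun i => ?_) i
      · simpa using hzν
      · simpa using hz i
    · simp
    · intro u v _ _ hu hv; rw [inner_add_right, hu, hv, add_zero]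
    · intro r u _ hu; rw [inner_smul_right, hu, mul_zero]
  exact inner_self_eq_zero.1 this

theorem frame_expansion (ha : LinearIndependent ℝ a) (h1 : ‖ν‖ = 1)
    (hν : ∀ i, inner ℝ ν (a i) = 0) (v : EuclideanSpace ℝ (Fin (n + 1))) :
    v = raise a (fun i => inner ℝ v (a i)) + inner ℝ v ν • ν := by
  rw [← sub_eq_zero]
  refine eq_zero_of_orthogonal_frame ha h1 hν (fun i => ?_) ?_
  · rw [inner_sub_left, inner_add_left, inner_raise ha, inner_smul_left, hν]; simp
  · rw [inner_sub_left, inner_add_left, inner_raise_normal hν, inner_smul_left,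
      real_inner_self_eq_norm_sq, h1]
    simp

/-- The test by which the gradient, the inward gradient and the derivative of the normal are
identified below. -/
theorem eq_of_inner_frame (ha : LinearIndependent ℝ a) (h1 : ‖ν‖ = 1)
    (hν : ∀ i, inner ℝ ν (a i) = 0) {u v : EuclideanSpace ℝ (Fin (n + 1))}
    (h : ∀ i, inner ℝ u (a i) = inner ℝ v (a i)) (hn : inner ℝ u ν = inner ℝ v ν) : u = v := by
  rw [← sub_eq_zero]
  exact eq_zero_of_orthogonal_frame ha h1 hν (fun i => by rw [inner_sub_left, h, sub_self])
    (by rw [inner_sub_left, hn, sub_self])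

theorem inner_raise_left (b : Fin n → ℝ) (v : EuclideanSpace ℝ (Fin (n + 1))) :
    inner ℝ (raise a b) v = ∑ i, ∑ j, (Matrix.gram ℝ a)⁻¹ i j * b j * inner ℝ (a i) v := by
  simp [raise, sum_inner, inner_smul_left, Finset.sum_mul]

theorem raise_smul (a : Fin n → EuclideanSpace ℝ (Fin (n + 1))) (r : ℝ) (b : Fin n → ℝ) :
    raise a (fun i => r * b i) = r • raise a b := by
  simp only [raise, Finset.smul_sum, smul_smul, Finset.mul_sum]
  refine Finset.sum_congr rfl fun i _ => ?_
  congr 1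
  exact Finset.sum_congr rfl fun j _ => mul_left_comm _ _ _

end Frame

/-! ### Smooth dependence on the frame -/

section SmoothFrame

variable {Z : Type*} [NormedAddCommGroup Z] [NormedSpace ℝ Z] {n : ℕ} {s : Set Z} {k : ℕ∞ω}
  {a : Fin n → Z → EuclideanSpace ℝ (Fin (n + 1))}

theorem matrixContDiffOn_gram (ha : ∀ i, ContDiffOn ℝ k (a i) s) :
    MatrixContDiffOn k s fun z => Matrix.gram ℝ fun i => a i z :=
  fun i j => (ha i).inner ℝ (ha j)

theorem contDiffOn_raise (ha : ∀ i, ContDiffOn ℝ k (a i) s)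
    (hli : ∀ z ∈ s, LinearIndependent ℝ fun i => a i z) {b : Fin n → Z → ℝ}
    (hb : ∀ i, ContDiffOn ℝ k (b i) s) :
    ContDiffOn ℝ k (fun z => raise (fun i => a i z) fun i => b i z) s := by
  have h := (matrixContDiffOn_gram ha).inv fun z hz => (det_gram_pos (hli z hz)).ne'
  exact ContDiffOn.sum fun i _ => (ContDiffOn.sum fun j _ => (h i j).mul (hb j)).smul (ha i)

/-- A continuous unit normal field is as smooth as the frame it is normal to. -/
theorem contDiffOn_normal (ha : ∀ i, ContDiffOn ℝ k (a i) s)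
    (hli : ∀ z ∈ s, LinearIndependent ℝ fun i => a i z) {ν : Z → EuclideanSpace ℝ (Fin (n + 1))}
    (hc : ContinuousOn ν s) (h1 : ∀ z ∈ s, ‖ν z‖ = 1)
    (hν : ∀ z ∈ s, ∀ i, inner ℝ (ν z) (a i z) = 0) : ContDiffOn ℝ k ν s := by
  intro z₀ hz₀
  -- `w z` is the normal component at `z` of the fixed vector `ν z₀`. It is built from the frame
  -- alone, hence as smooth as the frame, and equals `⟨ν z₀, ν z⟩ ν z`. Continuity of `ν` makes the
  -- coefficient positive near `z₀`, so normalizing `w` recovers `ν` with the right sign.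
  set w : Z → EuclideanSpace ℝ (Fin (n + 1)) := fun z =>
    ν z₀ - raise (fun i => a i z) (fun i => inner ℝ (ν z₀) (a i z)) with hw
  have hwe : ∀ z ∈ s, w z = inner ℝ (ν z₀) (ν z) • ν z := fun z hz =>
    sub_eq_iff_eq_add'.2 (frame_expansion (hli z hz) (h1 z hz) (hν z hz) (ν z₀))
  have hws : ContDiffOn ℝ k w s :=
    contDiffOn_const.sub (contDiffOn_raise ha hli fun i => contDiffOn_const.inner ℝ (ha i))
  have hpos : ∀ᶠ z in 𝓝[s] z₀, 0 < inner ℝ (ν z₀) (ν z) := by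
    have : ContinuousWithinAt (fun z => inner ℝ (ν z₀) (ν z)) s z₀ :=
      continuousWithinAt_const.inner (hc z₀ hz₀)
    refine this.eventually (lt_mem_nhds ?_)
    simp only [real_inner_self_eq_norm_sq, h1 z₀ hz₀]; norm_num
  have hw0 : w z₀ ≠ 0 := by
    rw [hwe z₀ hz₀, real_inner_self_eq_norm_sq, h1 z₀ hz₀]
    intro h
    have := congrArg norm h
    simp [h1 z₀ hz₀] at this
  have hn : ContDiffWithinAt ℝ k (fun z => ‖w z‖⁻¹ • w z) s z₀ :=
    (((hws z₀ hz₀).norm ℝ hw0).inv (norm_ne_zero_iff.2 hw0)).smul (hws z₀ hz₀)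
  have hval : ∀ z ∈ s, 0 < inner ℝ (ν z₀) (ν z) → ν z = ‖w z‖⁻¹ • w z := by
    intro z hz hp
    rw [hwe z hz, norm_smul, h1 z hz, mul_one, Real.norm_of_nonneg hp.le, smul_smul,
      inv_mul_cancel₀ hp.ne', one_smul]
  refine hn.congr_of_eventuallyEq ?_ (hval z₀ hz₀ (hpos.self_of_nhdsWithin hz₀))
  filter_upwards [hpos, self_mem_nhdsWithin] with z hp hz using hval z hz hp

end SmoothFrame

/-! ### Partial derivatives on chart targets in the half-space -/

section HalfSpace

variable {n : ℕ} [NeZero n] {M : Type*} [TopologicalSpace M] [ChartedSpace (EuclideanHalfSpace n) M]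
  {F : Type*} [NormedAddCommGroup F] [NormedSpace ℝ F]

theorem pd_eq_dirDeriv (i : Fin n) (f : EuclideanSpace ℝ (Fin n) → F)
    (x : EuclideanSpace ℝ (Fin n)) :
    pd i f x = dirDeriv (range (𝓡∂ n)) (EuclideanSpace.single i 1) f x := rfl

theorem uniqueDiffWithinAt_of_mem_target {q : M} {x : EuclideanSpace ℝ (Fin n)}
    (hx : x ∈ (extChartAt (𝓡∂ n) q).target) : UniqueDiffWithinAt ℝ (range (𝓡∂ n)) x :=
  (𝓡∂ n).uniqueDiffOn x (extChartAt_target_subset_range q hx)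

/-- A chart target is relatively open in the half-space, so derivatives within either set agree. -/
theorem pd_eq_target {q : M} {x : EuclideanSpace ℝ (Fin n)}
    (hx : x ∈ (extChartAt (𝓡∂ n) q).target) (i : Fin n) (f : EuclideanSpace ℝ (Fin n) → F) :
    pd i f x = fderivWithin ℝ f (extChartAt (𝓡∂ n) q).target x (EuclideanSpace.single i 1) := by
  rw [pd, fderivWithin_congr_set
    (nhdsWithin_eq_iff_eventuallyEq.1 (nhdsWithin_extChartAt_target_eq_of_mem hx))]

theorem contDiffOn_pd {k l : ℕ∞ω} {q : M} {f : EuclideanSpace ℝ (Fin n) → F}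
    (hf : ContDiffOn ℝ l f (extChartAt (𝓡∂ n) q).target) (h : k + 1 ≤ l) (i : Fin n) :
    ContDiffOn ℝ k (pd i f) (extChartAt (𝓡∂ n) q).target :=
  ((hf.fderivWithin (uniqueDiffOn_extChartAt_target q) h).clm_apply contDiffOn_const).congr
    fun _ hx => pd_eq_target hx i f

theorem differentiableWithinAt_range {k : ℕ∞ω} {q : M} {f : EuclideanSpace ℝ (Fin n) → F}
    (hf : ContDiffOn ℝ k f (extChartAt (𝓡∂ n) q).target) (hk : k ≠ 0)
    {x : EuclideanSpace ℝ (Fin n)} (hx : x ∈ (extChartAt (𝓡∂ n) q).target) :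
    DifferentiableWithinAt ℝ f (range (𝓡∂ n)) x :=
  ((hf x hx).differentiableWithinAt hk).mono_of_mem_nhdsWithin
    (extChartAt_target_mem_nhdsWithin_of_mem hx)

theorem pd_congr {q : M} {f g : EuclideanSpace ℝ (Fin n) → F}
    (h : EqOn f g (extChartAt (𝓡∂ n) q).target)
    {x : EuclideanSpace ℝ (Fin n)} (hx : x ∈ (extChartAt (𝓡∂ n) q).target) (i : Fin n) :
    pd i f x = pd i g x := by
  rw [pd_eq_target hx, pd_eq_target hx, fderivWithin_congr h (h hx)]

/-- The symmetry of second derivatives persists at boundary points because the chart target lies in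
the closure of its interior. -/
theorem pd_comm {k : ℕ∞ω} {q : M} {f : EuclideanSpace ℝ (Fin n) → F}
    (hf : ContDiffOn ℝ k f (extChartAt (𝓡∂ n) q).target) (hk : 2 ≤ k)
    {x : EuclideanSpace ℝ (Fin n)} (hx : x ∈ (extChartAt (𝓡∂ n) q).target) (i j : Fin n) :
    pd i (pd j f) x = pd j (pd i f) x := by
  have hU := uniqueDiffOn_extChartAt_target (I := 𝓡∂ n) q
  have key : ∀ i j, pd i (pd j f) x = fderivWithin ℝ (fderivWithin ℝ f
      (extChartAt (𝓡∂ n) q).target) (extChartAt (𝓡∂ n) q).target x (EuclideanSpace.single i 1)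
        (EuclideanSpace.single j 1) := by
    intro i j
    rw [pd_congr (g := fun y => fderivWithin ℝ f (extChartAt (𝓡∂ n) q).target y
      (EuclideanSpace.single j 1)) (fun y hy => pd_eq_target hy j f) hx, pd_eq_target hx]
    have hd : DifferentiableWithinAt ℝ (fderivWithin ℝ f (extChartAt (𝓡∂ n) q).target)
        (extChartAt (𝓡∂ n) q).target x :=
      ((hf.fderivWithin hU (m := 1) (by simpa [one_add_one_eq_two] using hk)) x hx).differentiableWithinAt (by simp)
    rw [fderivWithin_clm_apply (hU x hx) hd (differentiableWithinAt_const _)]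
    simp
  rw [key, key]
  refine (ContDiffWithinAt.isSymmSndFDerivWithinAt (hf x hx) (by simpa using hk) hU ?_ hx) _ _
  exact extChartAt_target_subset_closure_interior hx

end HalfSpace

/-! ### Coordinate changes and their Jacobians -/

section ChartChange

variable {n : ℕ} [NeZero n] {M : Type*} [TopologicalSpace M] [ChartedSpace (EuclideanHalfSpace n) M]
  {F : Type*} [NormedAddCommGroup F] [NormedSpace ℝ F]

/-- The function `f` is of class `C^k` in every preferred chart. -/
def ChartSmooth (n : ℕ) [NeZero n] {M : Type*} [TopologicalSpace M]
    [ChartedSpace (EuclideanHalfSpace n) M] {F : Type*} [NormedAddCommGroup F] [NormedSpace ℝ F]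
    (k : ℕ∞ω) (f : M → F) : Prop :=
  ∀ q, ContDiffOn ℝ k (rep q f) (extChartAt (𝓡∂ n) q).target

/-- The coordinate change from the chart around `q` to the chart around `r`. -/
def coordChange (q r : M) (x : EuclideanSpace ℝ (Fin n)) : EuclideanSpace ℝ (Fin n) :=
  extChartAt (𝓡∂ n) r ((extChartAt (𝓡∂ n) q).symm x)

/-- The part of the chart around `q` which is covered by the chart around `r`. -/
def overlap (q r : M) : Set (EuclideanSpace ℝ (Fin n)) :=
  (extChartAt (𝓡∂ n) q).target ∩ (extChartAt (𝓡∂ n) q).symm ⁻¹' (extChartAt (𝓡∂ n) r).source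

/-- The Jacobian matrix of the coordinate change. -/
def jacobian (q r : M) (x : EuclideanSpace ℝ (Fin n)) : Matrix (Fin n) (Fin n) ℝ :=
  Matrix.of fun k i => pd i (coordChange q r) x k

theorem coordChange_mem_overlap {q r : M} {x : EuclideanSpace ℝ (Fin n)} (hx : x ∈ overlap q r) :
    coordChange q r x ∈ overlap r q := by
  refine ⟨(extChartAt (𝓡∂ n) r).map_source hx.2, ?_⟩
  simp only [coordChange, mem_preimage, (extChartAt (𝓡∂ n) r).left_inv hx.2]
  exact (extChartAt (𝓡∂ n) q).map_target hx.1

theorem rep_coordChange {q r : M} {x : EuclideanSpace ℝ (Fin n)} (hx : x ∈ overlap q r)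
    {G : Type*} (f : M → G) : rep r f (coordChange q r x) = rep q f x := by
  simp only [coordChange, rep, (extChartAt (𝓡∂ n) r).left_inv hx.2]

theorem coordChange_coordChange {q r : M} {x : EuclideanSpace ℝ (Fin n)} (hx : x ∈ overlap q r) :
    coordChange r q (coordChange q r x) = x := by
  simp only [coordChange, (extChartAt (𝓡∂ n) r).left_inv hx.2]
  exact (extChartAt (𝓡∂ n) q).right_inv hx.1

theorem overlap_mem_nhdsWithin {q r : M} {x : EuclideanSpace ℝ (Fin n)} (hx : x ∈ overlap q r) :
    overlap q r ∈ 𝓝[range (𝓡∂ n)] x := by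
  rw [← nhdsWithin_extChartAt_target_eq_of_mem hx.1]
  exact inter_mem self_mem_nhdsWithin ((continuousOn_extChartAt_symm q x hx.1).preimage_mem_nhdsWithin
    ((isOpen_extChartAt_source r).mem_nhds hx.2))

theorem coordChange_mem_range (q r : M) (x : EuclideanSpace ℝ (Fin n)) :
    coordChange q r x ∈ range (𝓡∂ n) := by
  simp only [coordChange, extChartAt, OpenPartialHomeomorph.extend, PartialEquiv.coe_trans]
  exact mem_range_self _

theorem fderivWithin_apply_eq_sum (f : EuclideanSpace ℝ (Fin n) → F)
    (x v : EuclideanSpace ℝ (Fin n)) :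
    fderivWithin ℝ f (range (𝓡∂ n)) x v = ∑ k, v k • pd k f x := by
  conv_lhs => rw [← (EuclideanSpace.basisFun (Fin n) ℝ).sum_repr v]
  simp [pd, map_sum]

theorem det_fderivWithin_coordChange (q r : M) (x : EuclideanSpace ℝ (Fin n)) :
    (fderivWithin ℝ (coordChange q r) (range (𝓡∂ n)) x).det = (jacobian q r x).det := by
  rw [ContinuousLinearMap.det, ← LinearMap.det_toMatrix (EuclideanSpace.basisFun (Fin n) ℝ).toBasis]
  congr 1

variable [IsManifold (𝓡∂ n) ∞ M]

theorem contDiffWithinAt_coordChange {q r : M} {x : EuclideanSpace ℝ (Fin n)}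
    (hx : x ∈ overlap q r) : ContDiffWithinAt ℝ ∞ (coordChange q r) (range (𝓡∂ n)) x := by
  refine contDiffWithinAt_ext_coord_change r q ?_
  rw [PartialEquiv.trans_source]
  exact hx

theorem differentiableWithinAt_coordChange {q r : M} {x : EuclideanSpace ℝ (Fin n)}
    (hx : x ∈ overlap q r) : DifferentiableWithinAt ℝ (coordChange q r) (range (𝓡∂ n)) x :=
  (contDiffWithinAt_coordChange hx).differentiableWithinAt (by simp)

theorem fderivWithin_rep_change {q r : M} {x : EuclideanSpace ℝ (Fin n)} (hx : x ∈ overlap q r)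
    {f : M → F} (hf : DifferentiableWithinAt ℝ (rep r f) (range (𝓡∂ n)) (coordChange q r x)) :
    fderivWithin ℝ (rep q f) (range (𝓡∂ n)) x =
      (fderivWithin ℝ (rep r f) (range (𝓡∂ n)) (coordChange q r x)).comp
        (fderivWithin ℝ (coordChange q r) (range (𝓡∂ n)) x) := by
  rw [← fderivWithin_comp x hf (differentiableWithinAt_coordChange hx)
    (fun y _ => coordChange_mem_range q r y) (uniqueDiffWithinAt_of_mem_target hx.1)]
  refine Filter.EventuallyEq.fderivWithin_eq ?_ (rep_coordChange hx f).symm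
  filter_upwards [overlap_mem_nhdsWithin hx] with y hy using (rep_coordChange hy f).symm

theorem pd_rep_change {q r : M} {x : EuclideanSpace ℝ (Fin n)} (hx : x ∈ overlap q r)
    {f : M → F} (hf : DifferentiableWithinAt ℝ (rep r f) (range (𝓡∂ n)) (coordChange q r x))
    (i : Fin n) :
    pd i (rep q f) x = ∑ k, jacobian q r x k i • pd k (rep r f) (coordChange q r x) := by
  rw [pd, fderivWithin_rep_change hx hf, ContinuousLinearMap.comp_apply, fderivWithin_apply_eq_sum]
  rfl

/-- Apply the transformation rule for partial derivatives to the chart map of `q` itself, regarded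
as a function on `M`: in its own chart it is the identity. -/
theorem jacobian_mul_jacobian {q r : M} {x : EuclideanSpace ℝ (Fin n)} (hx : x ∈ overlap q r) :
    jacobian r q (coordChange q r x) * jacobian q r x = 1 := by
  have hd : DifferentiableWithinAt ℝ (rep r (extChartAt (𝓡∂ n) q)) (range (𝓡∂ n))
      (coordChange q r x) := differentiableWithinAt_coordChange (coordChange_mem_overlap hx)
  ext j i
  have h := congrArg (fun v : EuclideanSpace ℝ (Fin n) => v j) (pd_rep_change hx hd i)
  have h1 : pd i (rep q (extChartAt (𝓡∂ n) q)) x = EuclideanSpace.single i 1 := by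
    have h2 : EqOn (rep q (extChartAt (𝓡∂ n) q)) id (extChartAt (𝓡∂ n) q).target :=
      fun y hy => (extChartAt (𝓡∂ n) q).right_inv hy
    rw [pd_congr h2 hx.1, pd, fderivWithin_id (uniqueDiffWithinAt_of_mem_target hx.1)]
    rfl
  rw [h1] at h
  simp only [WithLp.ofLp_sum, Finset.sum_apply, PiLp.smul_apply, smul_eq_mul] at h
  rw [Matrix.mul_apply, Matrix.one_apply]
  simp only [PiLp.single_apply] at h
  rw [h]
  exact Finset.sum_congr rfl fun k _ => mul_comm _ _

theorem isUnit_det_jacobian {q r : M} {x : EuclideanSpace ℝ (Fin n)} (hx : x ∈ overlap q r) :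
    IsUnit (jacobian q r x).det :=
  Matrix.isUnit_det_of_left_inverse (jacobian_mul_jacobian hx)

end ChartChange

/-! ### Transformation of the metric and of bilinear pairings -/

section Pairing

/-- The quotient of two bilinear forms is an endomorphism, so it changes by conjugation; hence its
trace and the trace of its square do not depend on the chart. -/
theorem inv_mul_change {n : ℕ} {J G B : Matrix (Fin n) (Fin n) ℝ} (hJ : IsUnit J.det) :
    (J.transpose * G * J)⁻¹ * (J.transpose * B * J) = J⁻¹ * (G⁻¹ * B) * J := by
  have hJt : IsUnit J.transpose.det := by rwa [Matrix.det_transpose]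
  rw [Matrix.mul_inv_rev, Matrix.mul_inv_rev]
  simp only [Matrix.mul_assoc]
  rw [← Matrix.mul_assoc (J.transpose)⁻¹, Matrix.nonsing_inv_mul _ hJt, Matrix.one_mul]

theorem trace_conj {n : ℕ} {J A : Matrix (Fin n) (Fin n) ℝ} (hJ : IsUnit J.det) :
    (J⁻¹ * A * J).trace = A.trace := by
  rw [Matrix.trace_mul_comm, ← Matrix.mul_assoc, Matrix.mul_nonsing_inv _ hJ, Matrix.one_mul]

variable {n : ℕ} [NeZero n] {M : Type*} [TopologicalSpace M] [ChartedSpace (EuclideanHalfSpace n) M]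

/-- The coordinate frame `∂_i X` in the chart around `q`. -/
def frame (X : M → EuclideanSpace ℝ (Fin (n + 1))) (q : M) (x : EuclideanSpace ℝ (Fin n))
    (i : Fin n) : EuclideanSpace ℝ (Fin (n + 1)) :=
  pd i (rep q X) x

/-- The matrix `⟨∂_i X, ∂_j Y⟩` in the chart around `q`. -/
def pairing (X Y : M → EuclideanSpace ℝ (Fin (n + 1))) (q : M) (x : EuclideanSpace ℝ (Fin n)) :
    Matrix (Fin n) (Fin n) ℝ :=
  Matrix.of fun i j => inner ℝ (frame X q x i) (frame Y q x j)

theorem gram_eq_pairing (X : M → EuclideanSpace ℝ (Fin (n + 1))) (q : M) : gram X q = pairing X X q := rfl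

theorem gram_eq_gram_frame (X : M → EuclideanSpace ℝ (Fin (n + 1))) (q : M)
    (x : EuclideanSpace ℝ (Fin n)) : gram X q x = Matrix.gram ℝ (frame X q x) := rfl

theorem pairing_transpose (X Y : M → EuclideanSpace ℝ (Fin (n + 1))) (q : M)
    (x : EuclideanSpace ℝ (Fin n)) : (pairing X Y q x).transpose = pairing Y X q x := by
  ext i j
  simp [pairing, real_inner_comm]

theorem matrixContDiffOn_pairing {X Y : M → EuclideanSpace ℝ (Fin (n + 1))} {k l : ℕ∞ω}
    (hX : ChartSmooth n l X) (hY : ChartSmooth n l Y) (h : k + 1 ≤ l) (q : M) :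
    MatrixContDiffOn k (extChartAt (𝓡∂ n) q).target (pairing X Y q) :=
  fun i j => (contDiffOn_pd (hX q) h i).inner ℝ (contDiffOn_pd (hY q) h j)

theorem ChartSmooth.differentiableWithinAt {F : Type*} [NormedAddCommGroup F] [NormedSpace ℝ F]
    {k : ℕ∞ω} {f : M → F} (hf : ChartSmooth n k f) (hk : k ≠ 0) {q : M}
    {x : EuclideanSpace ℝ (Fin n)} (hx : x ∈ (extChartAt (𝓡∂ n) q).target) :
    DifferentiableWithinAt ℝ (rep q f) (range (𝓡∂ n)) x :=
  differentiableWithinAt_range (hf q) hk hx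

variable [IsManifold (𝓡∂ n) ∞ M]

theorem pairing_change {X Y : M → EuclideanSpace ℝ (Fin (n + 1))} (hX : ChartSmooth n 1 X)
    (hY : ChartSmooth n 1 Y) {q r : M} {x : EuclideanSpace ℝ (Fin n)} (hx : x ∈ overlap q r) :
    pairing X Y q x =
      (jacobian q r x).transpose * pairing X Y r (coordChange q r x) * jacobian q r x := by
  have hm := (coordChange_mem_overlap hx).1
  ext i j
  simp only [pairing, frame, Matrix.of_apply, Matrix.mul_apply, Matrix.transpose_apply]
  rw [pd_rep_change hx (hX.differentiableWithinAt one_ne_zero hm),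
    pd_rep_change hx (hY.differentiableWithinAt one_ne_zero hm)]
  simp only [sum_inner, inner_sum, inner_smul_left, inner_smul_right, Finset.sum_mul,
    Finset.mul_sum]
  refine Finset.sum_congr rfl fun k _ => Finset.sum_congr rfl fun l _ => ?_
  simp only [RCLike.conj_to_real]
  ring

theorem inv_mul_pairing_change {X Y Z : M → EuclideanSpace ℝ (Fin (n + 1))}
    (hX : ChartSmooth n 1 X) (hY : ChartSmooth n 1 Y) (hZ : ChartSmooth n 1 Z) {q r : M}
    {x : EuclideanSpace ℝ (Fin n)} (hx : x ∈ overlap q r) :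
    (gram X q x)⁻¹ * pairing Y Z q x = (jacobian q r x)⁻¹ *
      ((gram X r (coordChange q r x))⁻¹ * pairing Y Z r (coordChange q r x)) * jacobian q r x := by
  rw [gram_eq_pairing, gram_eq_pairing, pairing_change hX hX hx, pairing_change hY hZ hx,
    inv_mul_change (isUnit_det_jacobian hx)]

theorem trace_pairing_change {X Y Z : M → EuclideanSpace ℝ (Fin (n + 1))}
    (hX : ChartSmooth n 1 X) (hY : ChartSmooth n 1 Y) (hZ : ChartSmooth n 1 Z) {q r : M}
    {x : EuclideanSpace ℝ (Fin n)} (hx : x ∈ overlap q r) :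
    ((gram X q x)⁻¹ * pairing Y Z q x).trace =
      ((gram X r (coordChange q r x))⁻¹ * pairing Y Z r (coordChange q r x)).trace := by
  rw [inv_mul_pairing_change hX hY hZ hx, trace_conj (isUnit_det_jacobian hx)]

theorem trace_sq_pairing_change {X Y Z : M → EuclideanSpace ℝ (Fin (n + 1))}
    (hX : ChartSmooth n 1 X) (hY : ChartSmooth n 1 Y) (hZ : ChartSmooth n 1 Z) {q r : M}
    {x : EuclideanSpace ℝ (Fin n)} (hx : x ∈ overlap q r) :
    ((gram X q x)⁻¹ * pairing Y Z q x * ((gram X q x)⁻¹ * pairing Y Z q x)).trace =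
      ((gram X r (coordChange q r x))⁻¹ * pairing Y Z r (coordChange q r x) *
        ((gram X r (coordChange q r x))⁻¹ * pairing Y Z r (coordChange q r x))).trace := by
  have hu := isUnit_det_jacobian hx
  rw [inv_mul_pairing_change hX hY hZ hx]
  refine Eq.trans ?_ (trace_conj hu)
  congr 1
  simp only [Matrix.mul_assoc]
  rw [← Matrix.mul_assoc (jacobian q r x) (jacobian q r x)⁻¹, Matrix.mul_nonsing_inv _ hu,
    Matrix.one_mul]

theorem sqrt_det_gram_change {X : M → EuclideanSpace ℝ (Fin (n + 1))}
    (hX : ChartSmooth n 1 X) {q r : M} {x : EuclideanSpace ℝ (Fin n)} (hx : x ∈ overlap q r) :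
    √(gram X q x).det = |(jacobian q r x).det| * √(gram X r (coordChange q r x)).det := by
  rw [gram_eq_pairing, gram_eq_pairing, pairing_change hX hX hx, Matrix.det_mul, Matrix.det_mul,
    Matrix.det_transpose, mul_right_comm, ← sq, Real.sqrt_mul (sq_nonneg _), Real.sqrt_sq_eq_abs]

end Pairing

/-! ### Curvature, gradient and divergence read in an arbitrary chart -/

section Hypersurface

variable {n : ℕ} [NeZero n] {M : Type*} [TopologicalSpace M] [ChartedSpace (EuclideanHalfSpace n) M]

/-- `X` is an immersed hypersurface of class `C^(k+1)` with a unit normal field `ν` of class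
`C^k`, expressed in the preferred charts. -/
structure IsHypersurface (k : ℕ∞ω) (X ν : M → EuclideanSpace ℝ (Fin (n + 1))) : Prop where
  smooth : ChartSmooth n (k + 1) X
  smooth_normal : ChartSmooth n k ν
  linearIndependent : ∀ q, ∀ x ∈ (extChartAt (𝓡∂ n) q).target, LinearIndependent ℝ (frame X q x)
  norm_normal : ∀ p, ‖ν p‖ = 1
  normal : ∀ q, ∀ x ∈ (extChartAt (𝓡∂ n) q).target, ∀ i, inner ℝ (rep q ν x) (frame X q x i) = 0

theorem ChartSmooth.of_le {F : Type*} [NormedAddCommGroup F] [NormedSpace ℝ F] {k l : ℕ∞ω}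
    {f : M → F} (hf : ChartSmooth n l f) (h : k ≤ l) : ChartSmooth n k f :=
  fun q => (hf q).of_le h

/-- Quantities at a point are defined in the preferred chart of that point. Each `x` in the chart
around `q` lies in the overlap with the preferred chart of the point it represents, so
transformation rules turn those definitions into formulas in the chart around `q`. -/
theorem mem_overlap_symm {q : M} {x : EuclideanSpace ℝ (Fin n)}
    (hx : x ∈ (extChartAt (𝓡∂ n) q).target) :
    x ∈ overlap q ((extChartAt (𝓡∂ n) q).symm x) :=
  ⟨hx, mem_extChartAt_source _⟩

/-- The components of the tangential part of `Y` in the coordinate frame. -/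
def comps (X Y : M → EuclideanSpace ℝ (Fin (n + 1))) (q : M) (k : Fin n)
    (x : EuclideanSpace ℝ (Fin n)) : ℝ :=
  ∑ j, (gram X q x)⁻¹ k j * inner ℝ (rep q Y x) (frame X q x j)

/-- The gradient of `f` for the metric induced by `X`, as a vector of the ambient space. -/
def sgrad (X : M → EuclideanSpace ℝ (Fin (n + 1))) (f : M → ℝ) (p : M) :
    EuclideanSpace ℝ (Fin (n + 1)) :=
  raise (frame X p (extChartAt (𝓡∂ n) p p)) fun i => pd i (rep p f) (extChartAt (𝓡∂ n) p p)

/-- The divergence along the hypersurface `X` of a field of vectors of the ambient space. -/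
def surfDiv (X Y : M → EuclideanSpace ℝ (Fin (n + 1))) (p : M) : ℝ :=
  ((gram X p (extChartAt (𝓡∂ n) p p))⁻¹ * pairing Y X p (extChartAt (𝓡∂ n) p p)).trace

variable {X ν : M → EuclideanSpace ℝ (Fin (n + 1))} {k : ℕ∞ω}

namespace IsHypersurface

theorem smooth_self (h : IsHypersurface k X ν) : ChartSmooth n k X := h.smooth.of_le le_self_add

theorem det_pos (h : IsHypersurface k X ν) {q : M} {x : EuclideanSpace ℝ (Fin n)}
    (hx : x ∈ (extChartAt (𝓡∂ n) q).target) : 0 < (gram X q x).det :=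
  det_gram_pos (h.linearIndependent q x hx)

theorem isUnit_det (h : IsHypersurface k X ν) {q : M} {x : EuclideanSpace ℝ (Fin n)}
    (hx : x ∈ (extChartAt (𝓡∂ n) q).target) : IsUnit (gram X q x).det :=
  (h.det_pos hx).ne'.isUnit

theorem norm_rep (h : IsHypersurface k X ν) (q : M) (x : EuclideanSpace ℝ (Fin n)) :
    ‖rep q ν x‖ = 1 := h.norm_normal _

theorem contDiffOn_frame (h : IsHypersurface k X ν) (q : M) (i : Fin n) :
    ContDiffOn ℝ k (fun x => frame X q x i) (extChartAt (𝓡∂ n) q).target :=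
  contDiffOn_pd (h.smooth q) le_rfl i

theorem matrixContDiffOn_gram (h : IsHypersurface k X ν) (q : M) :
    MatrixContDiffOn k (extChartAt (𝓡∂ n) q).target (gram X q) :=
  Helfrich.matrixContDiffOn_gram (h.contDiffOn_frame q)

theorem matrixContDiffOn_inv_gram (h : IsHypersurface k X ν) (q : M) :
    MatrixContDiffOn k (extChartAt (𝓡∂ n) q).target fun x => (gram X q x)⁻¹ :=
  (h.matrixContDiffOn_gram q).inv fun _ hx => (h.det_pos hx).ne'

theorem matrixContDiffOn_pairing (h : IsHypersurface k X ν) {l : ℕ∞ω} (hl : l + 1 ≤ k) (q : M) :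
    MatrixContDiffOn l (extChartAt (𝓡∂ n) q).target (pairing X ν q) :=
  Helfrich.matrixContDiffOn_pairing h.smooth_self h.smooth_normal hl q

theorem contDiffOn_sqrt_det (h : IsHypersurface k X ν) (q : M) :
    ContDiffOn ℝ k (fun x => √(gram X q x).det) (extChartAt (𝓡∂ n) q).target :=
  (h.matrixContDiffOn_gram q).det.sqrt fun _ hx => (h.det_pos hx).ne'

theorem contDiffOn_comps (h : IsHypersurface k X ν) {Y : M → EuclideanSpace ℝ (Fin (n + 1))}
    {l : ℕ∞ω} (hl : l ≤ k) (hY : ChartSmooth n l Y) (q : M) (i : Fin n) :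
    ContDiffOn ℝ l (comps X Y q i) (extChartAt (𝓡∂ n) q).target :=
  ContDiffOn.sum fun j _ => ((h.matrixContDiffOn_inv_gram q i j).of_le hl).mul
    ((hY q).inner ℝ ((h.contDiffOn_frame q j).of_le hl))

theorem rep_eq_sum_comps (h : IsHypersurface k X ν) {Y : M → EuclideanSpace ℝ (Fin (n + 1))}
    (hY : ∀ p, inner ℝ (Y p) (ν p) = 0) {q : M} {x : EuclideanSpace ℝ (Fin n)}
    (hx : x ∈ (extChartAt (𝓡∂ n) q).target) :
    rep q Y x = ∑ i, comps X Y q i x • frame X q x i := by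
  have h1 := frame_expansion (h.linearIndependent q x hx) (h.norm_rep q x) (h.normal q x hx)
    (rep q Y x)
  rw [show inner ℝ (rep q Y x) (rep q ν x) = 0 from hY _, zero_smul, add_zero] at h1
  exact h1

/-- The Weingarten equation. -/
theorem secondForm_eq (h : IsHypersurface k X ν) (hk : 1 ≤ k) {q : M}
    {x : EuclideanSpace ℝ (Fin n)} (hx : x ∈ (extChartAt (𝓡∂ n) q).target) :
    secondForm X ν q x = pairing X ν q x := by
  have hk0 : k ≠ 0 := (zero_lt_one.trans_le hk).ne'
  ext i j
  simp only [secondForm, pairing, Matrix.of_apply]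
  -- Differentiating `⟨ν, ∂_i X⟩ = 0` in the direction `j` exchanges a second derivative of `X` for
  -- a first derivative of `ν`.
  have h1 : pd j (fun y => inner ℝ (rep q ν y) (frame X q y i)) x = 0 := by
    rw [pd_congr (g := fun _ => (0 : ℝ)) (fun y hy => h.normal q y hy i) hx]
    exact dirDeriv_const _
  rw [pd_eq_dirDeriv, dirDeriv_inner (uniqueDiffWithinAt_of_mem_target hx)
    (h.smooth_normal.differentiableWithinAt hk0 hx)
    (differentiableWithinAt_range (h.contDiffOn_frame q i) hk0 hx)] at h1
  rw [real_inner_comm, eq_comm, real_inner_comm]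
  exact eq_neg_of_add_eq_zero_left h1

theorem pairing_symm (h : IsHypersurface k X ν) (hk : 1 ≤ k) {q : M}
    {x : EuclideanSpace ℝ (Fin n)} (hx : x ∈ (extChartAt (𝓡∂ n) q).target) :
    (pairing X ν q x).transpose = pairing X ν q x := by
  rw [← h.secondForm_eq hk hx]
  ext i j
  simp only [secondForm, Matrix.transpose_apply, Matrix.of_apply]
  rw [pd_comm (h.smooth q) (by rw [← one_add_one_eq_two]; gcongr) hx]

theorem inner_sgrad_normal (h : IsHypersurface k X ν) (f : M → ℝ) (p : M) :
    inner ℝ (sgrad X f p) (ν p) = 0 := by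
  refine inner_raise_normal (fun i => ?_) _
  have := h.normal p _ (mem_extChartAt_target p) i
  rwa [rep, extChartAt_to_inv] at this

variable [IsManifold (𝓡∂ n) ∞ M]

theorem rep_meanCurvature (h : IsHypersurface k X ν) (hk : 1 ≤ k) {q : M}
    {x : EuclideanSpace ℝ (Fin n)} (hx : x ∈ (extChartAt (𝓡∂ n) q).target) :
    rep q (meanCurvature X ν) x = (1 / (n : ℝ)) * ((gram X q x)⁻¹ * pairing X ν q x).trace := by
  have h1 := h.smooth_self.of_le hk
  have h2 := h.smooth_normal.of_le hk
  rw [trace_pairing_change h1 h1 h2 (mem_overlap_symm hx), rep, meanCurvature,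
    h.secondForm_eq hk (mem_extChartAt_target _)]
  rfl

theorem rep_normSqA (h : IsHypersurface k X ν) (hk : 1 ≤ k) {q : M}
    {x : EuclideanSpace ℝ (Fin n)} (hx : x ∈ (extChartAt (𝓡∂ n) q).target) :
    rep q (normSqA X ν) x = ((gram X q x)⁻¹ * pairing X ν q x *
      ((gram X q x)⁻¹ * pairing X ν q x)).trace := by
  have h1 := h.smooth_self.of_le hk
  have h2 := h.smooth_normal.of_le hk
  rw [trace_sq_pairing_change h1 h1 h2 (mem_overlap_symm hx), rep, normSqA,
    h.secondForm_eq hk (mem_extChartAt_target _)]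
  rfl

theorem chartSmooth_meanCurvature (h : IsHypersurface k X ν) {l : ℕ∞ω} (hl : l + 1 ≤ k) :
    ChartSmooth n l (meanCurvature X ν) := fun q =>
  (contDiffOn_const.mul ((MatrixContDiffOn.mul (fun i j => (h.matrixContDiffOn_inv_gram q i j).of_le
    (le_self_add.trans hl)) (h.matrixContDiffOn_pairing hl q)).trace)).congr
    fun _ hx => h.rep_meanCurvature (le_add_self.trans hl) hx

theorem chartSmooth_normSqA (h : IsHypersurface k X ν) {l : ℕ∞ω} (hl : l + 1 ≤ k) :
    ChartSmooth n l (normSqA X ν) := fun q => by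
  have h1 : MatrixContDiffOn l (extChartAt (𝓡∂ n) q).target
      fun x => (gram X q x)⁻¹ * pairing X ν q x :=
    MatrixContDiffOn.mul (fun i j => (h.matrixContDiffOn_inv_gram q i j).of_le
      (le_self_add.trans hl)) (h.matrixContDiffOn_pairing hl q)
  exact (h1.mul h1).trace.congr fun _ hx => h.rep_normSqA (le_add_self.trans hl) hx

/-- Both sides are orthogonal to `ν` and have the same inner products with the frame of the chart
around `q`, by the chain rule for `f` and for `X`. -/
theorem rep_sgrad (h : IsHypersurface k X ν) {f : M → ℝ} (hf : ChartSmooth n 1 f) {q : M}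
    {x : EuclideanSpace ℝ (Fin n)} (hx : x ∈ (extChartAt (𝓡∂ n) q).target) :
    rep q (sgrad X f) x = raise (frame X q x) fun i => pd i (rep q f) x := by
  set p := (extChartAt (𝓡∂ n) q).symm x with hp
  have ho : x ∈ overlap q p := mem_overlap_symm hx
  have hpt : extChartAt (𝓡∂ n) p p ∈ (extChartAt (𝓡∂ n) p).target := mem_extChartAt_target p
  have hfr : ∀ i, frame X q x i = ∑ j, jacobian q p x j i • frame X p (extChartAt (𝓡∂ n) p p) j :=
    pd_rep_change ho (h.smooth.differentiableWithinAt (by simp) hpt)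
  refine eq_of_inner_frame (h.linearIndependent q x hx) (h.norm_rep q x) (h.normal q x hx)
    (fun i => ?_) ?_
  · rw [inner_raise (h.linearIndependent q x hx), hfr,
      pd_rep_change ho (hf.differentiableWithinAt one_ne_zero hpt), inner_sum]
    refine Finset.sum_congr rfl fun j _ => ?_
    rw [inner_smul_right, rep, sgrad, ← hp, inner_raise (h.linearIndependent p _ hpt)]
    rfl
  · rw [inner_raise_normal (h.normal q x hx), rep, sgrad, ← hp]
    refine inner_raise_normal (fun i => ?_) _
    have := h.normal p _ hpt i
    rwa [rep, extChartAt_to_inv] at this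

theorem chartSmooth_sgrad (h : IsHypersurface k X ν) {f : M → ℝ} {l m : ℕ∞ω}
    (hf : ChartSmooth n m f) (hm : l + 1 ≤ m) (hl : l ≤ k) : ChartSmooth n l (sgrad X f) := fun q =>
  (contDiffOn_raise (fun i => (h.contDiffOn_frame q i).of_le hl) (h.linearIndependent q)
    fun i => contDiffOn_pd (hf q) hm i).congr
    fun _ hx => h.rep_sgrad (hf.of_le (le_add_self.trans hm)) hx

theorem rep_surfDiv (h : IsHypersurface k X ν)
    {Y : M → EuclideanSpace ℝ (Fin (n + 1))} (hY : ChartSmooth n 1 Y) {q : M}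
    {x : EuclideanSpace ℝ (Fin n)} (hx : x ∈ (extChartAt (𝓡∂ n) q).target) :
    rep q (surfDiv X Y) x = ((gram X q x)⁻¹ * pairing Y X q x).trace := by
  have h1 := h.smooth.of_le le_add_self
  rw [trace_pairing_change h1 hY h1 (mem_overlap_symm hx)]
  rfl

theorem chartSmooth_surfDiv (h : IsHypersurface k X ν) {l : ℕ∞ω} (hl : l + 1 ≤ k)
    {Y : M → EuclideanSpace ℝ (Fin (n + 1))} (hY : ChartSmooth n (l + 1) Y) :
    ChartSmooth n l (surfDiv X Y) := fun q =>
  (MatrixContDiffOn.mul (fun i j => (h.matrixContDiffOn_inv_gram q i j).of_le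
    (le_self_add.trans hl)) (Helfrich.matrixContDiffOn_pairing hY (h.smooth_self.of_le hl)
      le_rfl q)).trace.congr
    fun _ hx => h.rep_surfDiv (hY.of_le le_add_self) hx

end IsHypersurface

end Hypersurface

/-! ### Divergence of tangent fields and the Laplace–Beltrami operator -/

theorem trace_inv_mul_transpose {n : ℕ} {G A : Matrix (Fin n) (Fin n) ℝ}
    (hG : G.transpose = G) : (G⁻¹ * A.transpose).trace = (G⁻¹ * A).trace := by
  rw [← Matrix.trace_transpose, Matrix.transpose_mul, Matrix.transpose_transpose,
    Matrix.transpose_nonsing_inv, hG, Matrix.trace_mul_comm]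

theorem trace_inv_mul_conj {n : ℕ} {G P : Matrix (Fin n) (Fin n) ℝ} (hG : IsUnit G.det) :
    (G⁻¹ * (P * G)).trace = P.trace := by
  rw [Matrix.trace_mul_comm, Matrix.mul_assoc, Matrix.mul_nonsing_inv _ hG, Matrix.mul_one]

section Divergence

variable {n : ℕ} [NeZero n] {M : Type*} [TopologicalSpace M] [ChartedSpace (EuclideanHalfSpace n) M]
  {X ν : M → EuclideanSpace ℝ (Fin (n + 1))} {k : ℕ∞ω}

/-- The matrix `⟨∂_k ∂_i X, ∂_j X⟩`. -/
def christoffel (X : M → EuclideanSpace ℝ (Fin (n + 1))) (q : M) (x : EuclideanSpace ℝ (Fin n))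
    (k : Fin n) : Matrix (Fin n) (Fin n) ℝ :=
  Matrix.of fun i j => inner ℝ (pd k (fun y => frame X q y i) x) (frame X q x j)

/-- The matrix `∂_i Y^k` of the derivatives of the components of `Y`. -/
def compsDeriv (X Y : M → EuclideanSpace ℝ (Fin (n + 1))) (q : M) (x : EuclideanSpace ℝ (Fin n)) :
    Matrix (Fin n) (Fin n) ℝ :=
  Matrix.of fun k i => pd i (comps X Y q k) x

theorem gram_transpose (X : M → EuclideanSpace ℝ (Fin (n + 1))) (q : M)
    (x : EuclideanSpace ℝ (Fin n)) : (gram X q x).transpose = gram X q x :=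
  pairing_transpose X X q x

namespace IsHypersurface

theorem differentiableWithinAt_frame (h : IsHypersurface k X ν) (hk : 1 ≤ k) {q : M}
    {x : EuclideanSpace ℝ (Fin n)} (hx : x ∈ (extChartAt (𝓡∂ n) q).target) (i : Fin n) :
    DifferentiableWithinAt ℝ (fun y => frame X q y i) (range (𝓡∂ n)) x :=
  differentiableWithinAt_range (h.contDiffOn_frame q i) (zero_lt_one.trans_le hk).ne' hx

theorem matrixDiff_gram (h : IsHypersurface k X ν) (hk : 1 ≤ k) {q : M}
    {x : EuclideanSpace ℝ (Fin n)} (hx : x ∈ (extChartAt (𝓡∂ n) q).target) :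
    MatrixDiff (range (𝓡∂ n)) x (gram X q) :=
  fun i j => (h.differentiableWithinAt_frame hk hx i).inner ℝ
    (h.differentiableWithinAt_frame hk hx j)

theorem pd_frame_comm (h : IsHypersurface k X ν) (hk : 1 ≤ k) {q : M}
    {x : EuclideanSpace ℝ (Fin n)} (hx : x ∈ (extChartAt (𝓡∂ n) q).target) (i j : Fin n) :
    pd i (fun y => frame X q y j) x = pd j (fun y => frame X q y i) x :=
  pd_comm (h.smooth q) (by rw [← one_add_one_eq_two]; gcongr) hx i j

theorem matrixDeriv_gram (h : IsHypersurface k X ν) (hk : 1 ≤ k) {q : M}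
    {x : EuclideanSpace ℝ (Fin n)} (hx : x ∈ (extChartAt (𝓡∂ n) q).target) (l : Fin n) :
    matrixDeriv (range (𝓡∂ n)) (EuclideanSpace.single l 1) (gram X q) x =
      christoffel X q x l + (christoffel X q x l).transpose := by
  ext i j
  simp only [matrixDeriv, christoffel, Matrix.of_apply, Matrix.add_apply, Matrix.transpose_apply]
  exact (dirDeriv_inner (uniqueDiffWithinAt_of_mem_target hx)
    (h.differentiableWithinAt_frame hk hx i) (h.differentiableWithinAt_frame hk hx j)).trans
    (congrArg₂ (· + ·) rfl (real_inner_comm _ _))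

theorem differentiableWithinAt_comps (h : IsHypersurface k X ν) (hk : 1 ≤ k)
    {Y : M → EuclideanSpace ℝ (Fin (n + 1))} (hY : ChartSmooth n 1 Y) {q : M}
    {x : EuclideanSpace ℝ (Fin n)} (hx : x ∈ (extChartAt (𝓡∂ n) q).target) (i : Fin n) :
    DifferentiableWithinAt ℝ (comps X Y q i) (range (𝓡∂ n)) x :=
  differentiableWithinAt_range (h.contDiffOn_comps hk hY q i) one_ne_zero hx

/-- The product rule for `Y = Y^j ∂_j X`, with `∂_i ∂_j X` written as `∂_j ∂_i X` so that the second
sum is the transport of `∂_i X` along `Y`. -/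
theorem frame_tangent (h : IsHypersurface k X ν) (hk : 1 ≤ k)
    {Y : M → EuclideanSpace ℝ (Fin (n + 1))} (hY : ChartSmooth n 1 Y)
    (hYν : ∀ p, inner ℝ (Y p) (ν p) = 0) {q : M}
    {x : EuclideanSpace ℝ (Fin n)} (hx : x ∈ (extChartAt (𝓡∂ n) q).target) (i : Fin n) :
    frame Y q x i = ∑ j, compsDeriv X Y q x j i • frame X q x j +
      ∑ j, comps X Y q j x • pd j (fun y => frame X q y i) x := by
  have hu := uniqueDiffWithinAt_of_mem_target hx
  rw [frame, pd_congr (fun y hy => h.rep_eq_sum_comps hYν hy) hx, pd_eq_dirDeriv,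
    dirDeriv_sum hu fun j _ => (h.differentiableWithinAt_comps hk hY hx j).fun_smul
      (h.differentiableWithinAt_frame hk hx j), ← Finset.sum_add_distrib]
  refine Finset.sum_congr rfl fun j _ => ?_
  rw [dirDeriv_smul hu (h.differentiableWithinAt_comps hk hY hx j)
    (h.differentiableWithinAt_frame hk hx j), h.pd_frame_comm hk hx j i]
  rfl

theorem pairing_tangent (h : IsHypersurface k X ν) (hk : 1 ≤ k)
    {Y : M → EuclideanSpace ℝ (Fin (n + 1))} (hY : ChartSmooth n 1 Y)
    (hYν : ∀ p, inner ℝ (Y p) (ν p) = 0) {q : M}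
    {x : EuclideanSpace ℝ (Fin n)} (hx : x ∈ (extChartAt (𝓡∂ n) q).target) :
    pairing Y X q x = (compsDeriv X Y q x).transpose * gram X q x +
      ∑ l, comps X Y q l x • christoffel X q x l := by
  ext i j
  simp only [pairing, Matrix.of_apply, Matrix.add_apply, Matrix.mul_apply, Matrix.transpose_apply,
    Matrix.sum_apply, Matrix.smul_apply, christoffel, smul_eq_mul]
  rw [h.frame_tangent hk hY hYν hx, inner_add_left, sum_inner, sum_inner]
  simp only [real_inner_smul_left]
  rfl

/-- The divergence of a tangent field in coordinates. -/
theorem sum_pd_comps (h : IsHypersurface k X ν) (hk : 1 ≤ k)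
    {Y : M → EuclideanSpace ℝ (Fin (n + 1))} (hY : ChartSmooth n 1 Y)
    (hYν : ∀ p, inner ℝ (Y p) (ν p) = 0) {q : M}
    {x : EuclideanSpace ℝ (Fin n)} (hx : x ∈ (extChartAt (𝓡∂ n) q).target) :
    ∑ i, pd i (fun y => √(gram X q y).det * comps X Y q i y) x =
      √(gram X q x).det * ((gram X q x)⁻¹ * pairing Y X q x).trace := by
  have hu := uniqueDiffWithinAt_of_mem_target hx
  have hs : DifferentiableWithinAt ℝ (fun y => √(gram X q y).det) (range (𝓡∂ n)) x :=
    differentiableWithinAt_range (h.contDiffOn_sqrt_det q) (zero_lt_one.trans_le hk).ne' hx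
  rw [h.pairing_tangent hk hY hYν hx, Matrix.mul_add, Matrix.trace_add,
    trace_inv_mul_conj (h.isUnit_det hx), Matrix.trace_transpose, Matrix.mul_sum, Matrix.trace_sum,
    mul_add, Finset.mul_sum, Matrix.trace, Finset.mul_sum, ← Finset.sum_add_distrib]
  refine Finset.sum_congr rfl fun i _ => ?_
  -- `∂_i √(det g) = √(det g) · ½ tr(G⁻¹(Γ_i + Γ_iᵀ))`, where `Γ_i` is `christoffel` at index `i`.
  -- As `G` is symmetric, the two traces agree, and the half disappears.
  rw [pd_eq_dirDeriv, dirDeriv_mul hu hs (h.differentiableWithinAt_comps hk hY hx i),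
    dirDeriv_sqrt_det hu (h.matrixDiff_gram hk hx) (h.det_pos hx), h.matrixDeriv_gram hk hx,
    Matrix.mul_add, Matrix.trace_add, trace_inv_mul_transpose (gram_transpose X q x),
    Matrix.mul_smul, Matrix.trace_smul]
  simp only [compsDeriv, Matrix.diag_apply, Matrix.of_apply, pd_eq_dirDeriv, smul_eq_mul]
  ring

variable [IsManifold (𝓡∂ n) ∞ M]

/-- The components of `∇f` are `g^{ij} ∂_j f`, so the coordinate formula for `Δf` is the coordinate
formula for the divergence of `∇f`. -/
theorem laplacian_eq_surfDiv (h : IsHypersurface k X ν) (hk : 1 ≤ k) {f : M → ℝ}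
    (hf : ChartSmooth n 2 f) (p : M) : laplacian X f p = surfDiv X (sgrad X f) p := by
  have hx := mem_extChartAt_target (I := 𝓡∂ n) p
  have hg : ChartSmooth n 1 (sgrad X f) := h.chartSmooth_sgrad hf one_add_one_eq_two.le hk
  have h1 := h.sum_pd_comps hk hg (h.inner_sgrad_normal f) hx
  rw [laplacian, surfDiv, eq_comm, ← mul_right_inj' (Real.sqrt_pos.2 (h.det_pos hx)).ne', ← h1,
    mul_inv_cancel_left₀ (Real.sqrt_pos.2 (h.det_pos hx)).ne']
  refine Finset.sum_congr rfl fun i _ => pd_congr (fun y hy => ?_) hx i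
  simp only [comps]
  rw [h.rep_sgrad (hf.of_le one_le_two) hy]
  simp only [inner_raise (h.linearIndependent p y hy)]

theorem chartSmooth_laplacian (h : IsHypersurface k X ν) {l : ℕ∞ω} (hl : l + 1 ≤ k) {f : M → ℝ}
    (hf : ChartSmooth n (l + 1 + 1) f) : ChartSmooth n l (laplacian X f) := by
  have h2 : laplacian X f = surfDiv X (sgrad X f) := funext
    (h.laplacian_eq_surfDiv (le_add_self.trans hl) (hf.of_le (by
      rw [← one_add_one_eq_two]; gcongr; exact le_add_self)))
  rw [h2]
  exact h.chartSmooth_surfDiv hl (h.chartSmooth_sgrad hf le_rfl hl)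

end IsHypersurface

theorem frame_add {Y Z : M → EuclideanSpace ℝ (Fin (n + 1))} (hY : ChartSmooth n 1 Y)
    (hZ : ChartSmooth n 1 Z) {q : M} {x : EuclideanSpace ℝ (Fin n)}
    (hx : x ∈ (extChartAt (𝓡∂ n) q).target) (i : Fin n) :
    frame (fun p => Y p + Z p) q x i = frame Y q x i + frame Z q x i :=
  dirDeriv_add (uniqueDiffWithinAt_of_mem_target hx) (hY.differentiableWithinAt one_ne_zero hx)
    (hZ.differentiableWithinAt one_ne_zero hx)

theorem frame_smul {f : M → ℝ} {Y : M → EuclideanSpace ℝ (Fin (n + 1))} (hf : ChartSmooth n 1 f)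
    (hY : ChartSmooth n 1 Y) {q : M} {x : EuclideanSpace ℝ (Fin n)}
    (hx : x ∈ (extChartAt (𝓡∂ n) q).target) (i : Fin n) :
    frame (fun p => f p • Y p) q x i = pd i (rep q f) x • rep q Y x + rep q f x • frame Y q x i :=
  dirDeriv_smul (uniqueDiffWithinAt_of_mem_target hx) (hf.differentiableWithinAt one_ne_zero hx)
    (hY.differentiableWithinAt one_ne_zero hx)

theorem surfDiv_add {Y Z : M → EuclideanSpace ℝ (Fin (n + 1))} (hY : ChartSmooth n 1 Y)
    (hZ : ChartSmooth n 1 Z) (p : M) :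
    surfDiv X (fun p => Y p + Z p) p = surfDiv X Y p + surfDiv X Z p := by
  simp only [surfDiv]
  rw [← Matrix.trace_add, ← Matrix.mul_add]
  congr 2
  ext i j
  simp only [pairing, Matrix.of_apply, Matrix.add_apply,
    frame_add hY hZ (mem_extChartAt_target p), inner_add_left]

/-- The product rule holds for every ambient field `Y`, tangent or not. With `Y = ν` the gradient
term vanishes and the divergence of `Φν` has no derivative of `Φ`. -/
theorem surfDiv_smul {f : M → ℝ} {Y : M → EuclideanSpace ℝ (Fin (n + 1))}
    (hf : ChartSmooth n 1 f) (hY : ChartSmooth n 1 Y) (p : M) :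
    surfDiv X (fun p => f p • Y p) p = f p * surfDiv X Y p + inner ℝ (sgrad X f p) (Y p) := by
  have hx := mem_extChartAt_target (I := 𝓡∂ n) p
  have hp : ∀ {G : Type _} (g : M → G), rep p g (extChartAt (𝓡∂ n) p p) = g p := fun g => by
    rw [rep, extChartAt_to_inv]
  rw [sgrad, inner_raise_left, ← gram_eq_gram_frame]
  simp only [surfDiv, Matrix.trace, Matrix.diag_apply, Matrix.mul_apply, Finset.mul_sum]
  rw [← Finset.sum_add_distrib]
  refine Finset.sum_congr rfl fun i _ => ?_
  rw [← Finset.sum_add_distrib]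
  refine Finset.sum_congr rfl fun j _ => ?_
  simp only [pairing, Matrix.of_apply]
  rw [frame_smul hf hY hx, hp Y, inner_add_left, real_inner_smul_left, real_inner_smul_left,
    real_inner_comm (Y p), show rep p f (extChartAt (𝓡∂ n) p p) = f p by rw [rep, extChartAt_to_inv]]
  ring

end Divergence

/-! ### Families of functions jointly smooth in time and space -/

section Family

variable {n : ℕ} [NeZero n] {M : Type*} [TopologicalSpace M] [ChartedSpace (EuclideanHalfSpace n) M]
  {F : Type*} [NormedAddCommGroup F] [NormedSpace ℝ F] {ε : ℝ} {q : M}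
  {f : ℝ → EuclideanSpace ℝ (Fin n) → F} {k l : ℕ∞ω}

/-- The domain of a family of functions in the chart around `q`, with parameter `|t| < ε`. -/
def cylinder (n : ℕ) [NeZero n] {M : Type*} [TopologicalSpace M]
    [ChartedSpace (EuclideanHalfSpace n) M] (ε : ℝ) (q : M) : Set (ℝ × EuclideanSpace ℝ (Fin n)) :=
  Ioo (-ε) ε ×ˢ (extChartAt (𝓡∂ n) q).target

theorem uniqueDiffOn_cylinder (ε : ℝ) (q : M) : UniqueDiffOn ℝ (cylinder n ε q) :=
  isOpen_Ioo.uniqueDiffOn.prod (uniqueDiffOn_extChartAt_target q)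

theorem cylinder_subset_closure_interior (ε : ℝ) (q : M) :
    cylinder n ε q ⊆ closure (interior (cylinder n ε q)) := by
  rw [cylinder, interior_prod_eq, closure_prod_eq, isOpen_Ioo.interior_eq]
  exact prod_mono subset_closure fun x hx => extChartAt_target_subset_closure_interior hx

theorem hasFDerivWithinAt_slice (hf : ContDiffOn ℝ l (fun z => f z.1 z.2) (cylinder n ε q))
    (hl : l ≠ 0) {t : ℝ} (ht : t ∈ Ioo (-ε) ε) {x : EuclideanSpace ℝ (Fin n)}
    (hx : x ∈ (extChartAt (𝓡∂ n) q).target) :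
    HasFDerivWithinAt (f t) ((fderivWithin ℝ (fun z => f z.1 z.2) (cylinder n ε q) (t, x)).comp
      (ContinuousLinearMap.inr ℝ ℝ (EuclideanSpace ℝ (Fin n)))) (extChartAt (𝓡∂ n) q).target x := by
  have h1 := ((hf (t, x) ⟨ht, hx⟩).differentiableWithinAt hl).hasFDerivWithinAt
  have h2 : HasFDerivWithinAt (fun y : EuclideanSpace ℝ (Fin n) => (t, y))
      (ContinuousLinearMap.inr ℝ ℝ (EuclideanSpace ℝ (Fin n))) (extChartAt (𝓡∂ n) q).target x :=
    hasFDerivAt_prodMk_right t x |>.hasFDerivWithinAt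
  exact h1.comp x h2 fun y hy => ⟨ht, hy⟩

theorem hasDerivAt_slice (hf : ContDiffOn ℝ l (fun z => f z.1 z.2) (cylinder n ε q))
    (hl : l ≠ 0) {t : ℝ} (ht : t ∈ Ioo (-ε) ε) {x : EuclideanSpace ℝ (Fin n)}
    (hx : x ∈ (extChartAt (𝓡∂ n) q).target) :
    HasDerivAt (fun s => f s x)
      (fderivWithin ℝ (fun z => f z.1 z.2) (cylinder n ε q) (t, x) (1, 0)) t := by
  have h1 := ((hf (t, x) ⟨ht, hx⟩).differentiableWithinAt hl).hasFDerivWithinAt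
  have h2 : HasDerivWithinAt (fun s : ℝ => (s, x)) (1, 0) (Ioo (-ε) ε) t :=
    ((hasDerivAt_id t).prodMk (hasDerivAt_const t x)).hasDerivWithinAt
  exact (HasFDerivWithinAt.comp_hasDerivWithinAt (f := fun s : ℝ => (s, x)) t h1 h2
    (fun s hs => ⟨hs, hx⟩)).hasDerivAt (isOpen_Ioo.mem_nhds ht)

theorem contDiffOn_slice (hf : ContDiffOn ℝ l (fun z => f z.1 z.2) (cylinder n ε q))
    {t : ℝ} (ht : t ∈ Ioo (-ε) ε) : ContDiffOn ℝ l (f t) (extChartAt (𝓡∂ n) q).target :=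
  hf.comp (f := fun y : EuclideanSpace ℝ (Fin n) => (t, y)) (by fun_prop) fun _ hy => ⟨ht, hy⟩

theorem pd_slice (hf : ContDiffOn ℝ l (fun z => f z.1 z.2) (cylinder n ε q))
    (hl : l ≠ 0) {z : ℝ × EuclideanSpace ℝ (Fin n)} (hz : z ∈ cylinder n ε q) (i : Fin n) :
    pd i (f z.1) z.2 = fderivWithin ℝ (fun z => f z.1 z.2) (cylinder n ε q) z
      (0, EuclideanSpace.single i 1) := by
  rw [pd_eq_target hz.2, (hasFDerivWithinAt_slice hf hl hz.1 hz.2).fderivWithin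
    (uniqueDiffOn_extChartAt_target q _ hz.2)]
  simp

theorem contDiffOn_pd_slice (hf : ContDiffOn ℝ l (fun z => f z.1 z.2) (cylinder n ε q))
    (h : k + 1 ≤ l) (i : Fin n) :
    ContDiffOn ℝ k (fun z : ℝ × EuclideanSpace ℝ (Fin n) => pd i (f z.1) z.2) (cylinder n ε q) :=
  ((hf.fderivWithin (uniqueDiffOn_cylinder ε q) h).clm_apply contDiffOn_const).congr
    fun _ hz => pd_slice hf (zero_lt_one.trans_le (le_add_self.trans h)).ne' hz i

theorem contDiffOn_deriv_slice (hf : ContDiffOn ℝ l (fun z => f z.1 z.2) (cylinder n ε q))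
    (h : k + 1 ≤ l) :
    ContDiffOn ℝ k (fun z : ℝ × EuclideanSpace ℝ (Fin n) => deriv (fun s => f s z.2) z.1)
      (cylinder n ε q) :=
  ((hf.fderivWithin (uniqueDiffOn_cylinder ε q) h).clm_apply
    (contDiffOn_const (c := ((1 : ℝ), (0 : EuclideanSpace ℝ (Fin n)))))).congr
    fun _ hz => (hasDerivAt_slice hf (zero_lt_one.trans_le (le_add_self.trans h)).ne'
      hz.1 hz.2).deriv

/-- Time and space derivatives commute: both iterated derivatives are values of the second
derivative on the cylinder, which is symmetric because the cylinder lies in the closure of its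
interior. -/
theorem hasDerivAt_pd (hf : ContDiffOn ℝ l (fun z => f z.1 z.2) (cylinder n ε q))
    (hl : 2 ≤ l) {t : ℝ} (ht : t ∈ Ioo (-ε) ε) {x : EuclideanSpace ℝ (Fin n)}
    (hx : x ∈ (extChartAt (𝓡∂ n) q).target) (i : Fin n) :
    HasDerivAt (fun s => pd i (f s) x) (pd i (fun y => deriv (fun s => f s y) t) x) t := by
  have hl' : (1 : ℕ∞ω) + 1 ≤ l := by rwa [one_add_one_eq_two]
  have hl0 : l ≠ 0 := (zero_lt_one.trans_le (le_add_self.trans hl')).ne'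
  have hU := uniqueDiffOn_cylinder (n := n) ε q
  have hz : (t, x) ∈ cylinder n ε q := ⟨ht, hx⟩
  have hd : DifferentiableWithinAt ℝ (fderivWithin ℝ (fun z => f z.1 z.2) (cylinder n ε q))
      (cylinder n ε q) (t, x) :=
    ((hf.fderivWithin hU hl') _ hz).differentiableWithinAt one_ne_zero
  have key : ∀ v w, fderivWithin ℝ (fun z => fderivWithin ℝ (fun z => f z.1 z.2) (cylinder n ε q) z w)
      (cylinder n ε q) (t, x) v = fderivWithin ℝ (fderivWithin ℝ (fun z => f z.1 z.2)
        (cylinder n ε q)) (cylinder n ε q) (t, x) v w := by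
    intro v w
    rw [fderivWithin_clm_apply (hU _ hz) hd (differentiableWithinAt_const _)]
    simp
  have hsymm := ContDiffWithinAt.isSymmSndFDerivWithinAt (hf _ hz) (by simpa using hl) hU
    (cylinder_subset_closure_interior ε q hz) hz
  have h1 := hasDerivAt_slice (f := fun s y => pd i (f s) y) (contDiffOn_pd_slice hf hl' i)
    one_ne_zero ht hx
  convert h1 using 1
  have h2 := pd_slice (f := fun s y => deriv (fun s => f s y) s) (contDiffOn_deriv_slice hf hl')
    one_ne_zero hz i
  simp only at h2
  have h3 : EqOn (fun z : ℝ × EuclideanSpace ℝ (Fin n) => deriv (fun s => f s z.2) z.1)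
      (fun z => fderivWithin ℝ (fun z => f z.1 z.2) (cylinder n ε q) z (1, 0)) (cylinder n ε q) :=
    fun z hz => (hasDerivAt_slice hf hl0 hz.1 hz.2).deriv
  have h4 : EqOn (fun z : ℝ × EuclideanSpace ℝ (Fin n) => pd i (f z.1) z.2)
      (fun z => fderivWithin ℝ (fun z => f z.1 z.2) (cylinder n ε q) z
        (0, EuclideanSpace.single i 1)) (cylinder n ε q) := fun z hz => pd_slice hf hl0 hz i
  rw [h2, fderivWithin_congr h3 (h3 hz), fderivWithin_congr h4 (h4 hz), key, key]
  exact hsymm _ _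

end Family

/-! ### From immersions of the manifold to charts -/

section Immersion

variable {n : ℕ} [NeZero n] {M : Type*} [TopologicalSpace M] [ChartedSpace (EuclideanHalfSpace n) M]
  {F : Type*} [NormedAddCommGroup F] [NormedSpace ℝ F] {k : ℕ∞ω}

theorem mfderiv_eq_sum {f : M → F} {p : M} (hf : MDifferentiableAt (𝓡∂ n) 𝓘(ℝ, F) f p)
    (v : EuclideanSpace ℝ (Fin n)) :
    mfderiv (𝓡∂ n) 𝓘(ℝ, F) f p v = ∑ i, v i • pd i (rep p f) (extChartAt (𝓡∂ n) p p) := by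
  rw [← fderivWithin_apply_eq_sum]
  exact DFunLike.congr_fun hf.mfderiv v

theorem linearIndependent_frame_self {X : M → EuclideanSpace ℝ (Fin (n + 1))} {p : M}
    (hX : MDifferentiableAt (𝓡∂ n) 𝓘(ℝ, EuclideanSpace ℝ (Fin (n + 1))) X p)
    (hi : Function.Injective (mfderiv (𝓡∂ n) 𝓘(ℝ, EuclideanSpace ℝ (Fin (n + 1))) X p)) :
    LinearIndependent ℝ (frame X p (extChartAt (𝓡∂ n) p p)) := by
  rw [Fintype.linearIndependent_iff]
  intro g hg i
  have h1 : mfderiv (𝓡∂ n) 𝓘(ℝ, EuclideanSpace ℝ (Fin (n + 1))) X p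
      (WithLp.toLp 2 g : EuclideanSpace ℝ (Fin n)) = 0 := by
    rw [mfderiv_eq_sum hX]; exact hg
  have h2 : (WithLp.toLp 2 g : EuclideanSpace ℝ (Fin n)) = 0 := hi (h1.trans (map_zero _).symm)
  exact congrArg (fun v : EuclideanSpace ℝ (Fin n) => v i) h2

variable [IsManifold (𝓡∂ n) ∞ M]

theorem chartSmooth_of_contMDiff {f : M → F} (hk : k ≤ ∞) (hf : ContMDiff (𝓡∂ n) 𝓘(ℝ, F) k f) :
    ChartSmooth n k f := fun q =>
  (hf.comp_contMDiffOn ((contMDiffOn_extChartAt_symm (n := ∞) q).of_le hk)).contDiffOn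

/-- Injectivity of the differential at a point gives independence in the preferred chart of that
point. The Gram determinant changes by the square of a nonzero Jacobian determinant, so independence
passes to every chart. -/
theorem linearIndependent_frame {X : M → EuclideanSpace ℝ (Fin (n + 1))}
    (hX : ChartSmooth n 1 X)
    (hd : MDifferentiable (𝓡∂ n) 𝓘(ℝ, EuclideanSpace ℝ (Fin (n + 1))) X)
    (hi : HasInjectiveDifferential X) {q : M} {x : EuclideanSpace ℝ (Fin n)}
    (hx : x ∈ (extChartAt (𝓡∂ n) q).target) : LinearIndependent ℝ (frame X q x) := by
  have ho := mem_overlap_symm hx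
  rw [← Matrix.det_gram_ne_zero_iff_linearIndependent, ← gram_eq_gram_frame, gram_eq_pairing,
    pairing_change hX hX ho, Matrix.det_mul, Matrix.det_mul, Matrix.det_transpose]
  have h1 := (isUnit_det_jacobian ho).ne_zero
  refine mul_ne_zero (mul_ne_zero h1 ?_) h1
  exact Matrix.det_gram_ne_zero_iff_linearIndependent.2
    (linearIndependent_frame_self (hd _) (hi _))

theorem inner_normal_frame {X ν : M → EuclideanSpace ℝ (Fin (n + 1))}
    (hX : ChartSmooth n 1 X)
    (hd : MDifferentiable (𝓡∂ n) 𝓘(ℝ, EuclideanSpace ℝ (Fin (n + 1))) X)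
    (hν : IsUnitNormal X ν) {q : M} {x : EuclideanSpace ℝ (Fin n)}
    (hx : x ∈ (extChartAt (𝓡∂ n) q).target) (i : Fin n) :
    inner ℝ (rep q ν x) (frame X q x i) = 0 := by
  have ho := mem_overlap_symm hx
  have h1 := (hν ((extChartAt (𝓡∂ n) q).symm x)).2
    (WithLp.toLp 2 fun k => jacobian q ((extChartAt (𝓡∂ n) q).symm x) x k i :
      EuclideanSpace ℝ (Fin n))
  rw [mfderiv_eq_sum (hd _)] at h1
  rw [frame, pd_rep_change ho (hX.differentiableWithinAt one_ne_zero
    (coordChange_mem_overlap ho).1)]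
  exact h1

theorem isHypersurface_of_contMDiff {X ν : M → EuclideanSpace ℝ (Fin (n + 1))} (hk : k + 1 ≤ ∞)
    (hX : ContMDiff (𝓡∂ n) 𝓘(ℝ, EuclideanSpace ℝ (Fin (n + 1))) (k + 1) X)
    (hi : HasInjectiveDifferential X) (hν : IsUnitNormal X ν) (hc : Continuous ν) :
    IsHypersurface k X ν := by
  have h1 := chartSmooth_of_contMDiff hk hX
  have hd := hX.mdifferentiable (by simp)
  have hli := fun q x hx => linearIndependent_frame (q := q) (x := x) (h1.of_le le_add_self) hd hi hx
  have hn := fun q x hx => inner_normal_frame (q := q) (x := x) (h1.of_le le_add_self) hd hν hx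
  refine ⟨h1, fun q => ?_, hli, fun p => (hν p).1, hn⟩
  exact contDiffOn_normal (fun i => contDiffOn_pd (h1 q) le_rfl i) (hli q)
    (hc.comp_continuousOn (continuousOn_extChartAt_symm q)) (fun _ _ => (hν _).1) (hn q)

end Immersion

/-! ### Joint regularity of a variation and of its normal -/

section Variation

variable {n : ℕ} [NeZero n] {M : Type*} [TopologicalSpace M] [ChartedSpace (EuclideanHalfSpace n) M]
  {X ν : M → EuclideanSpace ℝ (Fin (n + 1))} {ε : ℝ}
  {F N : ℝ → M → EuclideanSpace ℝ (Fin (n + 1))}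

namespace IsVariation

theorem zero_mem (h : IsVariation X ν ε F N) : (0 : ℝ) ∈ Ioo (-ε) ε := by
  simp [h.pos]

theorem contMDiff (h : IsVariation X ν ε F N) {t : ℝ} (ht : t ∈ Ioo (-ε) ε) :
    ContMDiff (𝓡∂ n) 𝓘(ℝ, EuclideanSpace ℝ (Fin (n + 1))) 3 (F t) := by
  have h1 : ContMDiff (𝓡∂ n) (𝓘(ℝ, ℝ).prod (𝓡∂ n)) 3 (fun p : M => (t, p)) :=
    contMDiff_const.prodMk contMDiff_id
  exact h.contMDiffOn.comp_contMDiff h1 fun p => ⟨ht, trivial⟩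

variable [IsManifold (𝓡∂ n) ∞ M]

theorem isHypersurface (h : IsVariation X ν ε F N) {t : ℝ} (ht : t ∈ Ioo (-ε) ε) :
    IsHypersurface 2 (F t) (N t) := by
  have hc : Continuous (N t) := by
    have := h.continuousOn_normal.comp (f := fun p : M => (t, p)) (s := univ)
      (by fun_prop) (fun p _ => ⟨ht, trivial⟩)
    rwa [continuousOn_univ] at this
  exact isHypersurface_of_contMDiff (k := 2) (by norm_cast) (h.contMDiff ht)
    (h.immersion t ht) (h.unitNormal t ht) hc

theorem contDiffOn_rep (h : IsVariation X ν ε F N) (q : M) :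
    ContDiffOn ℝ 3 (fun z : ℝ × EuclideanSpace ℝ (Fin n) => rep q (F z.1) z.2)
      (cylinder n ε q) := by
  have h1 : ContMDiffOn 𝓘(ℝ, ℝ × EuclideanSpace ℝ (Fin n)) (𝓘(ℝ, ℝ).prod (𝓡∂ n)) 3
      (fun z : ℝ × EuclideanSpace ℝ (Fin n) => (z.1, (extChartAt (𝓡∂ n) q).symm z.2))
      (cylinder n ε q) := by
    refine ContMDiffOn.prodMk ?_ ?_
    · exact contDiff_fst.contMDiff.contMDiffOn
    · exact ((contMDiffOn_extChartAt_symm (n := ∞) q).of_le (by norm_cast)).comp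
        contDiff_snd.contMDiff.contMDiffOn fun z hz => hz.2
  exact (h.contMDiffOn.comp h1 fun z hz => ⟨hz.1, trivial⟩).contDiffOn

/-- The regularity of normals is applied on the cylinder, with time as one of the variables: joint
continuity of the normal is enough to make it jointly `C²`. -/
theorem contDiffOn_rep_normal (h : IsVariation X ν ε F N) (q : M) :
    ContDiffOn ℝ 2 (fun z : ℝ × EuclideanSpace ℝ (Fin n) => rep q (N z.1) z.2)
      (cylinder n ε q) := by
  have h1 : ContinuousOn (fun z : ℝ × EuclideanSpace ℝ (Fin n) => rep q (N z.1) z.2)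
      (cylinder n ε q) := by
    have h2 : ContinuousOn (fun z : ℝ × EuclideanSpace ℝ (Fin n) =>
        (z.1, (extChartAt (𝓡∂ n) q).symm z.2)) (cylinder n ε q) :=
      continuousOn_fst.prodMk ((continuousOn_extChartAt_symm q).comp continuousOn_snd
        fun z hz => hz.2)
    exact h.continuousOn_normal.comp h2 (fun z hz => ⟨hz.1, trivial⟩)
  have h3 : ∀ i, ContDiffOn ℝ 2 (fun z : ℝ × EuclideanSpace ℝ (Fin n) => frame (F z.1) q z.2 i)
      (cylinder n ε q) := fun i =>
    contDiffOn_pd_slice (f := fun s => rep q (F s)) (h.contDiffOn_rep q) two_add_one_eq_three.le i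
  have h4 : ∀ z ∈ cylinder n ε q, IsHypersurface 2 (F z.1) (N z.1) :=
    fun z hz => h.isHypersurface hz.1
  exact contDiffOn_normal h3 (fun z hz => (h4 z hz).linearIndependent q z.2 hz.2) h1
    (fun z hz => (h4 z hz).norm_rep q z.2) (fun z hz => (h4 z hz).normal q z.2 hz.2)

end IsVariation

end Variation

/-- The cancellation behind the variation of `H`. The brackets are the time derivatives of `G` and
`B`, and the left side is that of `tr(G⁻¹B)`. The terms in `P`, an infinitesimal change of frame,
drop out of the trace. The normal part contributes `-2a` through `G⁻¹` and `+a` through `B`, hence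
`-a` times `|A|²`. What remains is the transport part and `E`, whose trace against `G⁻¹` is the
Laplacian of `Φ`. -/
theorem trace_variation {n : ℕ} {G B P DG DB E : Matrix (Fin n) (Fin n) ℝ} (hG : IsUnit G.det)
    (a : ℝ) :
    (-(G⁻¹ * (P.transpose * G + G * P + DG + (2 * a) • B) * G⁻¹) * B +
      G⁻¹ * (P.transpose * B + B * P + DB + a • (B * G⁻¹ * B) - E)).trace =
    (-(G⁻¹ * DG * G⁻¹) * B + G⁻¹ * DB).trace - a * (G⁻¹ * B * (G⁻¹ * B)).trace -
      (G⁻¹ * E).trace := by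
  have h1 : (G⁻¹ * (P.transpose * G) * G⁻¹ * B).trace = (G⁻¹ * (P.transpose * B)).trace := by
    simp only [Matrix.mul_assoc]
    rw [← Matrix.mul_assoc G, Matrix.mul_nonsing_inv _ hG, Matrix.one_mul]
  have h2 : (G⁻¹ * (G * P) * G⁻¹ * B).trace = (G⁻¹ * (B * P)).trace := by
    rw [← Matrix.mul_assoc G⁻¹ G, Matrix.nonsing_inv_mul _ hG, Matrix.one_mul, Matrix.mul_assoc,
      Matrix.trace_mul_comm, Matrix.mul_assoc]
  simp only [Matrix.mul_add, Matrix.add_mul, Matrix.neg_mul, Matrix.mul_sub, Matrix.trace_add,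
    Matrix.trace_sub, Matrix.trace_neg, Matrix.mul_smul, Matrix.smul_mul, Matrix.trace_smul, h1, h2,
    smul_eq_mul]
  simp only [Matrix.mul_assoc]
  ring

/-! ### Algebra of functions smooth in charts -/

section ChartSmooth

variable {n : ℕ} [NeZero n] {M : Type*} [TopologicalSpace M] [ChartedSpace (EuclideanHalfSpace n) M]
  {F : Type*} [NormedAddCommGroup F] [NormedSpace ℝ F] {k : ℕ∞ω}

theorem ChartSmooth.add {f g : M → F} (hf : ChartSmooth n k f) (hg : ChartSmooth n k g) :
    ChartSmooth n k fun p => f p + g p := fun q => (hf q).add (hg q)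

theorem ChartSmooth.sub {f g : M → F} (hf : ChartSmooth n k f) (hg : ChartSmooth n k g) :
    ChartSmooth n k fun p => f p - g p := fun q => (hf q).sub (hg q)

theorem ChartSmooth.mul {f g : M → ℝ} (hf : ChartSmooth n k f) (hg : ChartSmooth n k g) :
    ChartSmooth n k fun p => f p * g p := fun q => (hf q).mul (hg q)

theorem ChartSmooth.smul {f : M → ℝ} {g : M → F} (hf : ChartSmooth n k f)
    (hg : ChartSmooth n k g) : ChartSmooth n k fun p => f p • g p := fun q => (hf q).smul (hg q)

theorem chartSmooth_const (a : F) : ChartSmooth n k fun _ : M => a := fun _ => contDiffOn_const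

end ChartSmooth

/-! ### Derivatives of the unit normal -/

section FrameCurvature

variable {n : ℕ} [NeZero n] {M : Type*} [TopologicalSpace M] [ChartedSpace (EuclideanHalfSpace n) M]
  {X ν : M → EuclideanSpace ℝ (Fin (n + 1))} {k : ℕ∞ω}

namespace IsHypersurface

theorem inner_frame_normal_normal (h : IsHypersurface k X ν) (hk : 1 ≤ k) {q : M}
    {x : EuclideanSpace ℝ (Fin n)} (hx : x ∈ (extChartAt (𝓡∂ n) q).target) (i : Fin n) :
    inner ℝ (frame ν q x i) (rep q ν x) = 0 := by
  have hd := h.smooth_normal.differentiableWithinAt (zero_lt_one.trans_le hk).ne' hx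
  have h1 : pd i (fun y => inner ℝ (rep q ν y) (rep q ν y)) x = 0 := by
    rw [pd_congr (g := fun _ => (1 : ℝ)) (q := q) (fun y _ => ?_) hx]
    · exact dirDeriv_const _
    · simp only [real_inner_self_eq_norm_sq, h.norm_rep]; norm_num
  rw [pd_eq_dirDeriv, dirDeriv_inner (uniqueDiffWithinAt_of_mem_target hx) hd hd,
    real_inner_comm, ← two_mul] at h1
  rw [real_inner_comm]
  exact (mul_eq_zero.1 h1).resolve_left two_ne_zero

/-- The third fundamental form. Since `∂_i ν` is tangent, it is recovered from its inner products
`h_ij` with the frame. -/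
theorem pairing_normal_normal (h : IsHypersurface k X ν) (hk : 1 ≤ k) {q : M}
    {x : EuclideanSpace ℝ (Fin n)} (hx : x ∈ (extChartAt (𝓡∂ n) q).target) :
    pairing ν ν q x = pairing X ν q x * (gram X q x)⁻¹ * pairing X ν q x := by
  ext i j
  have h1 := frame_expansion (h.linearIndependent q x hx) (h.norm_rep q x) (h.normal q x hx)
    (frame ν q x i)
  rw [h.inner_frame_normal_normal hk hx, zero_smul, add_zero] at h1
  have hB : ∀ m, inner ℝ (frame ν q x i) (frame X q x m) = pairing X ν q x i m := fun m => by
    rw [← h.pairing_symm hk hx, real_inner_comm]; rfl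
  have hG : ∀ l m, (gram X q x)⁻¹ l m = (gram X q x)⁻¹ m l := fun l m => by
    conv_lhs => rw [← gram_transpose X q x, ← Matrix.transpose_nonsing_inv]
    rfl
  simp only [Matrix.mul_apply]
  rw [pairing, Matrix.of_apply, h1, inner_raise_left]
  refine Finset.sum_congr rfl fun l _ => ?_
  rw [Finset.sum_mul]
  refine Finset.sum_congr rfl fun m _ => ?_
  rw [hB, ← gram_eq_gram_frame, hG l m, mul_comm ((gram X q x)⁻¹ m l)]
  rfl

theorem inner_normal_pd_frame (h : IsHypersurface k X ν) (hk : 1 ≤ k) {q : M}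
    {x : EuclideanSpace ℝ (Fin n)} (hx : x ∈ (extChartAt (𝓡∂ n) q).target) (i j : Fin n) :
    inner ℝ (rep q ν x) (pd j (fun y => frame X q y i) x) = -pairing X ν q x i j := by
  rw [← h.secondForm_eq hk hx]
  simp only [secondForm, Matrix.of_apply, neg_neg]
  exact real_inner_comm _ _

theorem matrixDiff_pairing (h : IsHypersurface k X ν) (hk : 2 ≤ k) {q : M}
    {x : EuclideanSpace ℝ (Fin n)} (hx : x ∈ (extChartAt (𝓡∂ n) q).target) :
    MatrixDiff (range (𝓡∂ n)) x (pairing X ν q) := fun i j =>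
  differentiableWithinAt_range (h.matrixContDiffOn_pairing (one_add_one_eq_two.trans_le hk) q i j)
    one_ne_zero hx

end IsHypersurface

end FrameCurvature

/-! ### Time derivatives of the metric, the normal and the second fundamental form -/

section FirstVariation

variable {n : ℕ} [NeZero n] {M : Type*} [TopologicalSpace M] [ChartedSpace (EuclideanHalfSpace n) M]
  {X ν : M → EuclideanSpace ℝ (Fin (n + 1))} {ε : ℝ}
  {F N : ℝ → M → EuclideanSpace ℝ (Fin (n + 1))}
  {V : M → EuclideanSpace ℝ (Fin (n + 1))} {Φ : M → ℝ}

/-- The hypotheses on a variation with variational field `V + Φ ν`, in a form adapted to charts. -/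
structure VariationData (X ν : M → EuclideanSpace ℝ (Fin (n + 1))) (ε : ℝ)
    (F N : ℝ → M → EuclideanSpace ℝ (Fin (n + 1))) (V : M → EuclideanSpace ℝ (Fin (n + 1)))
    (Φ : M → ℝ) : Prop where
  variation : IsVariation X ν ε F N
  hypersurface : IsHypersurface 3 X ν
  smooth_tangent : ChartSmooth n 2 V
  smooth_normal : ChartSmooth n 2 Φ
  tangent : ∀ p, inner ℝ (V p) (ν p) = 0
  hasDerivAt : ∀ p, HasDerivAt (fun t => F t p) (V p + Φ p • ν p) 0

theorem variationData [IsManifold (𝓡∂ n) ∞ M]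
    (hX : ContMDiff (𝓡∂ n) 𝓘(ℝ, EuclideanSpace ℝ (Fin (n + 1))) 4 X)
    (hF : IsVariation X ν ε F N) (hV : IsTangent X V)
    (hW : ∀ p, HasDerivAt (fun t => F t p) (V p + Φ p • ν p) 0) :
    VariationData X ν ε F N V Φ := by
  have h0 := hF.zero_mem
  have hXi : HasInjectiveDifferential X := hF.zero ▸ hF.immersion 0 h0
  have hXn : IsUnitNormal X ν := by
    have := hF.unitNormal 0 h0
    rwa [hF.zero, hF.normal_zero] at this
  have hc : Continuous ν := by
    have := hF.continuousOn_normal.comp (f := fun p : M => ((0 : ℝ), p)) (s := univ)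
      (by fun_prop) (fun p _ => ⟨h0, trivial⟩)
    rw [continuousOn_univ] at this
    rw [← hF.normal_zero]
    exact this
  have hh : IsHypersurface 3 X ν := isHypersurface_of_contMDiff (k := 3) (by norm_cast)
    (by simpa [show (3 : ℕ∞ω) + 1 = 4 by norm_num] using hX) hXi hXn hc
  have htan : ∀ p, inner ℝ (V p) (ν p) = 0 := fun p => by
    obtain ⟨v, hv⟩ := hV p
    rw [real_inner_comm, ← hv]
    exact (hXn p).2 v
  -- The field is the time derivative of a `C³` family, hence `C²`. Then `Φ` is its inner product
  -- with the `C³` normal, and `V` is the difference.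
  have hWs : ChartSmooth n 2 fun p => V p + Φ p • ν p := fun q => by
    have h1 := contDiffOn_slice (f := fun s y => deriv (fun s => rep q (F s) y) s)
      (contDiffOn_deriv_slice (f := fun s => rep q (F s)) (hF.contDiffOn_rep q)
        two_add_one_eq_three.le) h0
    exact h1.congr fun x _ => ((hW _).deriv).symm
  have hΦ : ∀ p, Φ p = inner ℝ (V p + Φ p • ν p) (ν p) := fun p => by
    rw [inner_add_left, htan, real_inner_smul_left, real_inner_self_eq_norm_sq, hh.norm_normal]
    ring
  have hΦs : ChartSmooth n 2 Φ := fun q =>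
    ((hWs q).inner ℝ ((hh.smooth_normal.of_le (by norm_num)) q)).congr fun x _ => hΦ _
  have hVs : ChartSmooth n 2 V := fun q =>
    ((hWs q).sub ((hΦs q).smul ((hh.smooth_normal.of_le (by norm_num)) q))).congr
      fun x _ => (add_sub_cancel_right _ _).symm
  exact ⟨hF, hh, hVs, hΦs, htan, hW⟩

namespace VariationData

variable {q : M} {x : EuclideanSpace ℝ (Fin n)}

theorem smooth_field (h : VariationData X ν ε F N V Φ) :
    ChartSmooth n 2 fun p => V p + Φ p • ν p :=
  h.smooth_tangent.add (h.smooth_normal.smul (h.hypersurface.smooth_normal.of_le (by norm_num)))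

theorem eventually_mem (h : VariationData X ν ε F N V Φ) : ∀ᶠ t in 𝓝 (0 : ℝ), t ∈ Ioo (-ε) ε :=
  isOpen_Ioo.mem_nhds h.variation.zero_mem

theorem frame_field (h : VariationData X ν ε F N V Φ) (hx : x ∈ (extChartAt (𝓡∂ n) q).target)
    (i : Fin n) :
    frame (fun p => V p + Φ p • ν p) q x i =
      ∑ j, compsDeriv X V q x j i • frame X q x j +
      ∑ j, comps X V q j x • pd j (fun y => frame X q y i) x +
      (pd i (rep q Φ) x • rep q ν x + rep q Φ x • frame ν q x i) := by
  have hV1 := h.smooth_tangent.of_le one_le_two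
  have hΦ1 := h.smooth_normal.of_le one_le_two
  have hν1 : ChartSmooth n 1 ν := h.hypersurface.smooth_normal.of_le (by norm_num)
  rw [frame_add hV1 (hΦ1.smul hν1) hx, frame_smul hΦ1 hν1 hx,
    h.hypersurface.frame_tangent (by norm_num) hV1 h.tangent hx]

/-- Half of the time derivative of the metric, before symmetrization: frame change by `∂_i V^k`,
transport along `V`, and `Φ` times the second fundamental form. -/
theorem pairing_field_left (h : VariationData X ν ε F N V Φ)
    (hx : x ∈ (extChartAt (𝓡∂ n) q).target) :
    pairing (fun p => V p + Φ p • ν p) X q x = (compsDeriv X V q x).transpose * gram X q x +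
      ∑ l, comps X V q l x • christoffel X q x l + rep q Φ x • pairing X ν q x := by
  have hh := h.hypersurface
  rw [← hh.pairing_symm (by norm_num) hx, pairing_transpose]
  ext i j
  simp only [pairing, Matrix.of_apply, Matrix.add_apply, Matrix.mul_apply, Matrix.transpose_apply,
    Matrix.sum_apply, Matrix.smul_apply, christoffel, smul_eq_mul]
  rw [h.frame_field hx]
  simp only [inner_add_left, sum_inner, real_inner_smul_left, hh.normal q x hx]
  simp [gram, frame]

theorem pairing_field_normal (h : VariationData X ν ε F N V Φ)
    (hx : x ∈ (extChartAt (𝓡∂ n) q).target) :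
    pairing (fun p => V p + Φ p • ν p) ν q x = (compsDeriv X V q x).transpose * pairing X ν q x +
      ∑ l, comps X V q l x • (Matrix.of fun i j =>
        inner ℝ (pd l (fun y => frame X q y i) x) (frame ν q x j)) +
      rep q Φ x • (pairing X ν q x * (gram X q x)⁻¹ * pairing X ν q x) := by
  have hh := h.hypersurface
  have h0 : ∀ j, inner ℝ (rep q ν x) (frame ν q x j) = 0 := fun j => by
    rw [real_inner_comm]; exact hh.inner_frame_normal_normal (by norm_num) hx j
  rw [← hh.pairing_normal_normal (by norm_num) hx]
  ext i j
  simp only [pairing, Matrix.of_apply, Matrix.add_apply, Matrix.mul_apply, Matrix.transpose_apply,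
    Matrix.sum_apply, Matrix.smul_apply, smul_eq_mul]
  rw [h.frame_field hx]
  simp only [inner_add_left, sum_inner, real_inner_smul_left, h0]
  simp

/-- The two summands arise separately in the time derivative of `B`: one from the variation of `X`,
the other from that of the normal. Together they are the transport term `V^l ∂_l B`. -/
theorem matrixDeriv_pairing (h : VariationData X ν ε F N V Φ)
    (hx : x ∈ (extChartAt (𝓡∂ n) q).target) (l : Fin n) :
    matrixDeriv (range (𝓡∂ n)) (EuclideanSpace.single l 1) (pairing X ν q) x =
      (Matrix.of fun i j => inner ℝ (pd l (fun y => frame X q y i) x) (frame ν q x j)) +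
      Matrix.of fun i j => inner ℝ (frame X q x i) (pd l (fun y => frame ν q y j) x) := by
  have hh := h.hypersurface
  ext i j
  exact dirDeriv_inner (uniqueDiffWithinAt_of_mem_target hx)
    (hh.differentiableWithinAt_frame (by norm_num) hx i)
    (differentiableWithinAt_range (k := 2) (contDiffOn_pd (hh.smooth_normal q)
      two_add_one_eq_three.le j) two_ne_zero hx)

variable [IsManifold (𝓡∂ n) ∞ M]

theorem hasDerivAt_frame (h : VariationData X ν ε F N V Φ)
    (hx : x ∈ (extChartAt (𝓡∂ n) q).target) (i : Fin n) :
    HasDerivAt (fun t => frame (F t) q x i) (frame (fun p => V p + Φ p • ν p) q x i) 0 := by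
  have h1 := hasDerivAt_pd (f := fun s => rep q (F s)) (h.variation.contDiffOn_rep q)
    (by norm_num) h.variation.zero_mem hx i
  have h2 : frame (fun p => V p + Φ p • ν p) q x i =
      pd i (fun y => deriv (fun s => rep q (F s) y) 0) x :=
    pd_congr (q := q) (fun y _ => ((h.hasDerivAt _).deriv).symm) hx i
  rw [h2]
  exact h1

/-- The derivative of the unit normal field. -/
def normalDeriv (N : ℝ → M → EuclideanSpace ℝ (Fin (n + 1))) (p : M) :
    EuclideanSpace ℝ (Fin (n + 1)) := deriv (fun t => N t p) 0

theorem hasDerivAt_normal (h : VariationData X ν ε F N V Φ)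
    (hx : x ∈ (extChartAt (𝓡∂ n) q).target) :
    HasDerivAt (fun t => rep q (N t) x) (rep q (normalDeriv N) x) 0 :=
  (hasDerivAt_slice (f := fun s => rep q (N s)) (h.variation.contDiffOn_rep_normal q)
    two_ne_zero h.variation.zero_mem hx).differentiableAt.hasDerivAt

theorem hasDerivAt_frame_normal (h : VariationData X ν ε F N V Φ)
    (hx : x ∈ (extChartAt (𝓡∂ n) q).target) (i : Fin n) :
    HasDerivAt (fun t => frame (N t) q x i) (frame (normalDeriv N) q x i) 0 :=
  hasDerivAt_pd (f := fun s => rep q (N s)) (h.variation.contDiffOn_rep_normal q)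
    le_rfl h.variation.zero_mem hx i

/-- The derivatives in time of `⟨N, ∂_i F⟩ = 0` and `|N|² = 1` determine the tangential and the
normal component of the derivative of `N`. The former is `-⟨ν, ∂_i (V + Φν)⟩ = V^j h_ij - ∂_i Φ`;
the latter is `0`. -/
theorem rep_normalDeriv (h : VariationData X ν ε F N V Φ)
    (hx : x ∈ (extChartAt (𝓡∂ n) q).target) :
    rep q (normalDeriv N) x =
      ∑ j, comps X V q j x • frame ν q x j - rep q (sgrad X Φ) x := by
  have hh := h.hypersurface
  have h3 : (1 : ℕ∞ω) ≤ 3 := by norm_num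
  have hN := h.hasDerivAt_normal hx
  have hF0 : ∀ i, frame (F 0) q x i = frame X q x i := by rw [h.variation.zero]; simp
  have hN0 : rep q (N 0) x = rep q ν x := by rw [h.variation.normal_zero]
  refine eq_of_inner_frame (hh.linearIndependent q x hx) (hh.norm_rep q x) (hh.normal q x hx)
    (fun i => ?_) ?_
  · have hνν : inner ℝ (rep q ν x) (frame ν q x i) = 0 := by
      rw [real_inner_comm]; exact hh.inner_frame_normal_normal h3 hx i
    have h1 := (hN.inner ℝ (h.hasDerivAt_frame hx i)).unique
      ((hasDerivAt_const (0 : ℝ) (0 : ℝ)).congr_of_eventuallyEq (by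
        filter_upwards [h.eventually_mem] with t ht
        exact (h.variation.isHypersurface ht).normal q x hx i))
    simp only [hF0, hN0] at h1
    rw [h.frame_field hx] at h1
    simp only [inner_add_right, inner_sum, real_inner_smul_right, hh.normal q x hx,
      hh.inner_normal_pd_frame h3 hx, real_inner_self_eq_norm_sq, hh.norm_rep, hνν] at h1
    rw [inner_sub_left, sum_inner, hh.rep_sgrad (h.smooth_normal.of_le one_le_two) hx,
      inner_raise (hh.linearIndependent q x hx)]
    have h2 : ∀ j, inner ℝ (comps X V q j x • frame ν q x j) (frame X q x i) =
        comps X V q j x * pairing X ν q x i j := fun j => by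
      rw [real_inner_smul_left, real_inner_comm]; rfl
    simp only [h2]
    simp only [mul_neg, Finset.sum_neg_distrib, mul_zero, Finset.sum_const_zero] at h1
    linarith
  · have h1 := (hN.inner ℝ hN).unique
      ((hasDerivAt_const (0 : ℝ) (1 : ℝ)).congr_of_eventuallyEq (by
        filter_upwards [h.eventually_mem] with t ht
        rw [real_inner_self_eq_norm_sq, (h.variation.isHypersurface ht).norm_rep]; norm_num))
    rw [hN0, real_inner_comm, ← two_mul] at h1
    rw [inner_sub_left, sum_inner, show inner ℝ (rep q (sgrad X Φ) x) (rep q ν x) = 0 from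
      hh.inner_sgrad_normal Φ _]
    simp only [real_inner_smul_left, hh.inner_frame_normal_normal h3 hx]
    simpa using h1

theorem frame_normalDeriv (h : VariationData X ν ε F N V Φ)
    (hx : x ∈ (extChartAt (𝓡∂ n) q).target) (j : Fin n) :
    frame (normalDeriv N) q x j = ∑ l, compsDeriv X V q x l j • frame ν q x l +
      ∑ l, comps X V q l x • pd l (fun y => frame ν q y j) x - frame (sgrad X Φ) q x j := by
  have hh := h.hypersurface
  have hu := uniqueDiffWithinAt_of_mem_target hx
  have hV1 := h.smooth_tangent.of_le one_le_two
  have hc := hh.differentiableWithinAt_comps (by norm_num) hV1 hx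
  have hf : ∀ l, DifferentiableWithinAt ℝ (fun y => frame ν q y l) (range (𝓡∂ n)) x := fun l =>
    differentiableWithinAt_range (k := 2) (contDiffOn_pd (hh.smooth_normal q)
      two_add_one_eq_three.le l) two_ne_zero hx
  have hg : DifferentiableWithinAt ℝ (rep q (sgrad X Φ)) (range (𝓡∂ n)) x :=
    (hh.chartSmooth_sgrad (l := 1) h.smooth_normal one_add_one_eq_two.le
      (by norm_num)).differentiableWithinAt one_ne_zero hx
  rw [frame, pd_congr (q := q) (fun y hy => h.rep_normalDeriv hy) hx, pd_eq_dirDeriv,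
    dirDeriv_sub hu (DifferentiableWithinAt.fun_sum fun l _ => (hc l).fun_smul (hf l)) hg,
    dirDeriv_sum hu fun l _ => (hc l).fun_smul (hf l), ← Finset.sum_add_distrib]
  congr 1
  refine Finset.sum_congr rfl fun l _ => ?_
  rw [dirDeriv_smul hu (hc l) (hf l)]
  congr 2
  -- `∂_j ∂_l ν` is rewritten as `∂_l ∂_j ν`, the transport along `V`, to match the second summand
  -- of `matrixDeriv_pairing`.
  exact pd_comm (hh.smooth_normal q) (by norm_num) hx j l

theorem pairing_normalDeriv (h : VariationData X ν ε F N V Φ)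
    (hx : x ∈ (extChartAt (𝓡∂ n) q).target) :
    pairing X (normalDeriv N) q x = pairing X ν q x * compsDeriv X V q x +
      ∑ l, comps X V q l x • (Matrix.of fun i j =>
        inner ℝ (frame X q x i) (pd l (fun y => frame ν q y j) x)) -
      pairing X (sgrad X Φ) q x := by
  ext i j
  simp only [pairing, Matrix.of_apply, Matrix.add_apply, Matrix.sub_apply, Matrix.mul_apply,
    Matrix.sum_apply, Matrix.smul_apply, smul_eq_mul]
  rw [h.frame_normalDeriv hx]
  simp only [inner_add_right, inner_sub_right, inner_sum, real_inner_smul_right]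
  simp [mul_comm]

theorem matrixDiff_gram_time (h : VariationData X ν ε F N V Φ)
    (hx : x ∈ (extChartAt (𝓡∂ n) q).target) :
    MatrixDiff univ (0 : ℝ) fun t => gram (F t) q x := fun i j =>
  ((h.hasDerivAt_frame hx i).inner ℝ (h.hasDerivAt_frame hx j)).differentiableAt.differentiableWithinAt

theorem matrixDiff_pairing_time (h : VariationData X ν ε F N V Φ)
    (hx : x ∈ (extChartAt (𝓡∂ n) q).target) :
    MatrixDiff univ (0 : ℝ) fun t => pairing (F t) (N t) q x := fun i j =>
  ((h.hasDerivAt_frame hx i).inner ℝ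
    (h.hasDerivAt_frame_normal hx j)).differentiableAt.differentiableWithinAt

theorem matrixDeriv_gram_time (h : VariationData X ν ε F N V Φ)
    (hx : x ∈ (extChartAt (𝓡∂ n) q).target) :
    matrixDeriv univ 1 (fun t => gram (F t) q x) 0 =
      pairing (fun p => V p + Φ p • ν p) X q x +
        (pairing (fun p => V p + Φ p • ν p) X q x).transpose := by
  ext i j
  rw [pairing_transpose, matrixDeriv, Matrix.of_apply, ← deriv_eq_dirDeriv]
  refine ((h.hasDerivAt_frame hx i).inner ℝ (h.hasDerivAt_frame hx j)).deriv.trans ?_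
  rw [h.variation.zero, add_comm]
  rfl

theorem matrixDeriv_pairing_time (h : VariationData X ν ε F N V Φ)
    (hx : x ∈ (extChartAt (𝓡∂ n) q).target) :
    matrixDeriv univ 1 (fun t => pairing (F t) (N t) q x) 0 =
      pairing (fun p => V p + Φ p • ν p) ν q x + pairing X (normalDeriv N) q x := by
  ext i j
  rw [matrixDeriv, Matrix.of_apply, ← deriv_eq_dirDeriv]
  refine ((h.hasDerivAt_frame hx i).inner ℝ (h.hasDerivAt_frame_normal hx j)).deriv.trans ?_
  rw [h.variation.zero, h.variation.normal_zero, add_comm]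
  rfl

end VariationData

end FirstVariation

/-! ### First variation of the mean curvature and of the energy density -/

section EnergyDensity

variable {n : ℕ} [NeZero n] {M : Type*} [TopologicalSpace M] [ChartedSpace (EuclideanHalfSpace n) M]
  {X ν : M → EuclideanSpace ℝ (Fin (n + 1))} {ε : ℝ}
  {F N : ℝ → M → EuclideanSpace ℝ (Fin (n + 1))}
  {V : M → EuclideanSpace ℝ (Fin (n + 1))} {Φ : M → ℝ} {k : ℕ∞ω}

/-- The divergence of `Φν` is `Φ div ν`, since `∇Φ` is orthogonal to `ν`, and `div ν = tr(G⁻¹B) =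
nH`. -/
theorem VariationData.surfDiv_field (h : VariationData X ν ε F N V Φ) (p : M) :
    surfDiv X (fun p => V p + Φ p • ν p) p =
      surfDiv X V p + n * meanCurvature X ν p * Φ p := by
  have hh := h.hypersurface
  have h1 : (1 : ℕ∞ω) ≤ 3 := by norm_num
  have hΦ1 := h.smooth_normal.of_le one_le_two
  have hν1 : ChartSmooth n 1 ν := hh.smooth_normal.of_le h1
  have hx := mem_extChartAt_target (I := 𝓡∂ n) p
  have hn : (n : ℝ) ≠ 0 := Nat.cast_ne_zero.2 (NeZero.ne n)
  have e : surfDiv X ν p = n * meanCurvature X ν p := by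
    rw [surfDiv, meanCurvature, hh.secondForm_eq h1 hx, ← pairing_transpose,
      trace_inv_mul_transpose (gram_transpose X p _)]
    field_simp
  rw [surfDiv_add (h.smooth_tangent.of_le one_le_two) (hΦ1.smul hν1), surfDiv_smul hΦ1 hν1,
    hh.inner_sgrad_normal, e]
  ring

theorem sgrad_sq {f : M → ℝ} (hf : ChartSmooth n 1 f) (p : M) :
    sgrad X (fun p => f p ^ 2) p = (2 * f p) • sgrad X f p := by
  have hx := mem_extChartAt_target (I := 𝓡∂ n) p
  have hd := hf.differentiableWithinAt one_ne_zero hx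
  have hp : rep p f (extChartAt (𝓡∂ n) p p) = f p := by rw [rep, extChartAt_to_inv]
  rw [sgrad, sgrad, ← raise_smul]
  congr 1
  funext i
  have h1 : rep p (fun p => f p ^ 2) =
      fun y : EuclideanSpace ℝ (Fin n) => rep p f y * rep p f y := by funext y; simp only [rep, sq]
  rw [h1, pd_eq_dirDeriv, pd_eq_dirDeriv, dirDeriv_mul (uniqueDiffWithinAt_of_mem_target hx) hd hd,
    hp]
  ring

theorem sgrad_add_const {f : M → ℝ} (hf : ChartSmooth n 1 f) (c : ℝ) (p : M) :
    sgrad X (fun p => f p + c) p = sgrad X f p := by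
  have hx := mem_extChartAt_target (I := 𝓡∂ n) p
  rw [sgrad, sgrad]
  congr 1
  funext i
  exact (dirDeriv_add (uniqueDiffWithinAt_of_mem_target hx)
    (hf.differentiableWithinAt one_ne_zero hx) (differentiableWithinAt_const c)).trans
    (by rw [dirDeriv_const, add_zero]; rfl)

theorem surfDiv_const_smul {Y : M → EuclideanSpace ℝ (Fin (n + 1))} (hY : ChartSmooth n 1 Y)
    (r : ℝ) (p : M) : surfDiv X (fun p => r • Y p) p = r * surfDiv X Y p := by
  have h0 : sgrad X (fun _ => r) p = 0 := by
    have : ∀ i, pd i (rep p fun _ : M => r) (extChartAt (𝓡∂ n) p p) = 0 := fun i => dirDeriv_const r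
    simp only [sgrad, raise, this, mul_zero, Finset.sum_const_zero, zero_smul]
  rw [surfDiv_smul (chartSmooth_const r) hY, h0, inner_zero_left, add_zero]

theorem surfDiv_sub {Y Z : M → EuclideanSpace ℝ (Fin (n + 1))} (hY : ChartSmooth n 1 Y)
    (hZ : ChartSmooth n 1 Z) (p : M) :
    surfDiv X (fun p => Y p - Z p) p = surfDiv X Y p - surfDiv X Z p := by
  have h1 := surfDiv_add (X := X) (hY.sub hZ) hZ p
  simp only [sub_add_cancel] at h1
  rw [h1, add_sub_cancel_right]

/-- The tangent field whose divergence appears in the first variation. -/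
def flux (c : ℝ) (X ν V : M → EuclideanSpace ℝ (Fin (n + 1))) (Φ : M → ℝ) (p : M) :
    EuclideanSpace ℝ (Fin (n + 1)) :=
  (meanCurvature X ν p + c) ^ 2 • V p + (2 / (n : ℝ)) • (Φ p • sgrad X (meanCurvature X ν) p -
    (meanCurvature X ν p + c) • sgrad X Φ p)

variable [IsManifold (𝓡∂ n) ∞ M]

/-- The spatial derivative of `H` is put in the same form as its time derivative, so that the
transport terms in the latter can be recognized as `V^l ∂_l H`. -/
theorem IsHypersurface.pd_trace (h : IsHypersurface k X ν) (hk : 2 ≤ k) {q : M}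
    {x : EuclideanSpace ℝ (Fin n)} (hx : x ∈ (extChartAt (𝓡∂ n) q).target) (l : Fin n) :
    pd l (rep q (meanCurvature X ν)) x = (1 / (n : ℝ)) *
      (-((gram X q x)⁻¹ * matrixDeriv (range (𝓡∂ n)) (EuclideanSpace.single l 1) (gram X q) x *
        (gram X q x)⁻¹) * pairing X ν q x + (gram X q x)⁻¹ *
        matrixDeriv (range (𝓡∂ n)) (EuclideanSpace.single l 1) (pairing X ν q) x).trace := by
  have hu := uniqueDiffWithinAt_of_mem_target hx
  have hk1 : 1 ≤ k := one_le_two.trans hk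
  have hG := h.matrixDiff_gram hk1 hx
  have hB := h.matrixDiff_pairing hk hx
  have hG0 := (h.det_pos hx).ne'
  rw [pd_congr (q := q) (fun y hy => h.rep_meanCurvature hk1 hy) hx, pd_eq_dirDeriv,
    dirDeriv_mul hu (differentiableWithinAt_const _)
      (MatrixDiff.trace ((hG.inv hG0).mul hB)), dirDeriv_const, zero_mul, zero_add,
    dirDeriv_trace hu ((hG.inv hG0).mul hB), matrixDeriv_mul hu (hG.inv hG0) hB,
    matrixDeriv_inv hu hG hG0]

theorem IsHypersurface.sum_comps_pd (h : IsHypersurface k X ν)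
    (hV : ∀ p, inner ℝ (V p) (ν p) = 0) {f : M → ℝ} (hf : ChartSmooth n 1 f) {q : M}
    {x : EuclideanSpace ℝ (Fin n)} (hx : x ∈ (extChartAt (𝓡∂ n) q).target) :
    ∑ l, comps X V q l x * pd l (rep q f) x = rep q (fun p => inner ℝ (sgrad X f p) (V p)) x := by
  have h1 : rep q (fun p => inner ℝ (sgrad X f p) (V p)) x =
    inner ℝ (rep q (sgrad X f) x) (rep q V x) := rfl
  rw [h1, h.rep_eq_sum_comps hV hx, h.rep_sgrad hf hx, inner_sum]
  simp only [real_inner_smul_right, inner_raise (h.linearIndependent q x hx)]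

namespace VariationData

variable {q : M} {x : EuclideanSpace ℝ (Fin n)}

/-- The derivatives of `G` and `B` are brought to the form of `trace_variation`; the three surviving
terms are then identified as `n⟨∇H, V⟩`, `|A|²Φ` and `ΔΦ`. -/
theorem hasDerivAt_meanCurvature (h : VariationData X ν ε F N V Φ)
    (hx : x ∈ (extChartAt (𝓡∂ n) q).target) :
    HasDerivAt (fun t => rep q (meanCurvature (F t) (N t)) x)
      (rep q (fun p => inner ℝ (sgrad X (meanCurvature X ν) p) (V p) -
        1 / (n : ℝ) * (Φ p * normSqA X ν p + laplacian X Φ p)) x) 0 := by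
  have hh := h.hypersurface
  have h1 : (1 : ℕ∞ω) ≤ 3 := by norm_num
  have h2 : (2 : ℕ∞ω) ≤ 3 := by norm_num
  have hG := h.matrixDiff_gram_time hx
  have hB := h.matrixDiff_pairing_time hx
  have hG0 : (gram (F 0) q x).det ≠ 0 := by rw [h.variation.zero]; exact (hh.det_pos hx).ne'
  have hGu := hh.isUnit_det hx
  have hder : HasDerivAt (fun t => (1 / (n : ℝ)) *
      ((gram (F t) q x)⁻¹ * pairing (F t) (N t) q x).trace)
      ((1 / (n : ℝ)) * dirDeriv univ 1
        (fun t => ((gram (F t) q x)⁻¹ * pairing (F t) (N t) q x).trace) 0) 0 := by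
    rw [← deriv_eq_dirDeriv]
    refine HasDerivAt.const_mul _ (DifferentiableAt.hasDerivAt ?_)
    exact differentiableWithinAt_univ.1 (MatrixDiff.trace ((hG.inv hG0).mul hB))
  refine (hder.congr_of_eventuallyEq ?_).congr_deriv ?_
  · filter_upwards [h.eventually_mem] with t ht
    exact (h.variation.isHypersurface ht).rep_meanCurvature one_le_two hx
  have hu : UniqueDiffWithinAt ℝ univ (0 : ℝ) := uniqueDiffWithinAt_univ
  rw [dirDeriv_trace hu ((hG.inv hG0).mul hB), matrixDeriv_mul hu (hG.inv hG0) hB,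
    matrixDeriv_inv hu hG hG0, h.matrixDeriv_gram_time hx, h.matrixDeriv_pairing_time hx,
    h.variation.zero, h.variation.normal_zero, h.pairing_field_left hx, h.pairing_field_normal hx,
    h.pairing_normalDeriv hx]
  set G := gram X q x
  set B := pairing X ν q x
  set P := compsDeriv X V q x
  set E := pairing X (sgrad X Φ) q x with hE
  set v := fun l => comps X V q l x
  set DG := ∑ l, v l • matrixDeriv (range (𝓡∂ n)) (EuclideanSpace.single l 1) (gram X q) x with hDG
  set DB := ∑ l, v l • matrixDeriv (range (𝓡∂ n)) (EuclideanSpace.single l 1) (pairing X ν q) x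
    with hDB
  set C₁ := ∑ l, comps X V q l x • christoffel X q x l with hC₁
  have hGs : G.transpose = G := gram_transpose X q x
  have hBs : B.transpose = B := hh.pairing_symm h1 hx
  -- Symmetrizing turns the Christoffel sum `C₁` into the transport term `V^l ∂_l G`, and doubles `Φ
  -- B` because `B` is symmetric.
  have e1 : P.transpose * G + C₁ + rep q Φ x • B + (P.transpose * G + C₁ + rep q Φ x • B).transpose =
      P.transpose * G + G * P + DG + (2 * rep q Φ x) • B := by
    have : DG = C₁ + C₁.transpose := by
      rw [hDG, hC₁, Matrix.transpose_sum, ← Finset.sum_add_distrib]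
      refine Finset.sum_congr rfl fun l _ => ?_
      rw [hh.matrixDeriv_gram h1 hx, smul_add, Matrix.transpose_smul]
    rw [this, Matrix.transpose_add, Matrix.transpose_add, Matrix.transpose_mul, hGs,
      Matrix.transpose_transpose, Matrix.transpose_smul, hBs, two_mul, add_smul]
    abel
  have e2 : DB = (∑ l, comps X V q l x • (Matrix.of fun i j =>
        inner ℝ (pd l (fun y => frame X q y i) x) (frame ν q x j))) +
      ∑ l, comps X V q l x • (Matrix.of fun i j =>
        inner ℝ (frame X q x i) (pd l (fun y => frame ν q y j) x)) := by
    rw [hDB, ← Finset.sum_add_distrib]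
    refine Finset.sum_congr rfl fun l _ => ?_
    rw [h.matrixDeriv_pairing hx, smul_add]
  have e3 : P.transpose * B + (∑ l, comps X V q l x • (Matrix.of fun i j =>
        inner ℝ (pd l (fun y => frame X q y i) x) (frame ν q x j))) +
        rep q Φ x • (B * G⁻¹ * B) + (B * P + (∑ l, comps X V q l x • (Matrix.of fun i j =>
        inner ℝ (frame X q x i) (pd l (fun y => frame ν q y j) x))) - E) =
      P.transpose * B + B * P + DB + rep q Φ x • (B * G⁻¹ * B) - E := by
    rw [e2]; abel
  rw [e1, e3, trace_variation hGu]
  have e4 : (-(G⁻¹ * DG * G⁻¹) * B + G⁻¹ * DB).trace =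
      ∑ l, v l * (-(G⁻¹ * matrixDeriv (range (𝓡∂ n)) (EuclideanSpace.single l 1) (gram X q) x *
        G⁻¹) * B + G⁻¹ *
        matrixDeriv (range (𝓡∂ n)) (EuclideanSpace.single l 1) (pairing X ν q) x).trace := by
    rw [hDG, hDB, Matrix.mul_sum, Matrix.sum_mul, Matrix.mul_sum, ← Finset.sum_neg_distrib,
      Matrix.sum_mul, ← Finset.sum_add_distrib, Matrix.trace_sum]
    refine Finset.sum_congr rfl fun l _ => ?_
    simp only [Matrix.mul_smul, Matrix.smul_mul, Matrix.neg_mul, Matrix.trace_add,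
      Matrix.trace_neg, Matrix.trace_smul, smul_eq_mul]
    ring
  have hHs : ChartSmooth n 1 (meanCurvature X ν) := hh.chartSmooth_meanCurvature (by norm_num)
  have e5 := hh.sum_comps_pd h.tangent hHs hx
  simp only [hh.pd_trace h2 hx] at e5
  have e6 : rep q (laplacian X Φ) x = (G⁻¹ * E).trace := by
    have h3 : rep q (laplacian X Φ) x = rep q (surfDiv X (sgrad X Φ)) x :=
      hh.laplacian_eq_surfDiv h1 h.smooth_normal _
    rw [h3, hh.rep_surfDiv (hh.chartSmooth_sgrad h.smooth_normal one_add_one_eq_two.le h1) hx,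
      ← pairing_transpose, trace_inv_mul_transpose hGs]
  have e7 : rep q (normSqA X ν) x = (G⁻¹ * B * (G⁻¹ * B)).trace := hh.rep_normSqA h1 hx
  have e8 : rep q (fun p => inner ℝ (sgrad X (meanCurvature X ν) p) (V p) -
        1 / (n : ℝ) * (Φ p * normSqA X ν p + laplacian X Φ p)) x =
      rep q (fun p => inner ℝ (sgrad X (meanCurvature X ν) p) (V p)) x -
        1 / (n : ℝ) * (rep q Φ x * rep q (normSqA X ν) x + rep q (laplacian X Φ) x) := rfl
  have e9 : 1 / (n : ℝ) * (-(G⁻¹ * DG * G⁻¹) * B + G⁻¹ * DB).trace =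
      rep q (fun p => inner ℝ (sgrad X (meanCurvature X ν) p) (V p)) x := by
    rw [← e5, e4, Finset.mul_sum]
    exact Finset.sum_congr rfl fun l _ => mul_left_comm _ _ _
  rw [e8, ← e9, e7, e6]
  ring

theorem hasDerivAt_sqrt_det (h : VariationData X ν ε F N V Φ)
    (hx : x ∈ (extChartAt (𝓡∂ n) q).target) :
    HasDerivAt (fun t => √(gram (F t) q x).det) (√(gram X q x).det *
      rep q (fun p => surfDiv X V p + n * meanCurvature X ν p * Φ p) x) 0 := by
  have hh := h.hypersurface
  have hG := h.matrixDiff_gram_time hx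
  have hG0 : 0 < (gram (F 0) q x).det := by rw [h.variation.zero]; exact hh.det_pos hx
  have hd : DifferentiableAt ℝ (fun t => √(gram (F t) q x).det) 0 :=
    (differentiableWithinAt_univ.1 hG.det).sqrt hG0.ne'
  refine hd.hasDerivAt.congr_deriv ?_
  rw [deriv_eq_dirDeriv, dirDeriv_sqrt_det uniqueDiffWithinAt_univ hG hG0,
    h.matrixDeriv_gram_time hx, h.variation.zero, Matrix.mul_add, Matrix.trace_add,
    trace_inv_mul_transpose (gram_transpose X q x),
    ← hh.rep_surfDiv (h.smooth_field.of_le one_le_two) hx]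
  simp only [rep, h.surfDiv_field]
  ring

theorem smooth_meanCurvature (h : VariationData X ν ε F N V Φ) :
    ChartSmooth n 2 (meanCurvature X ν) :=
  h.hypersurface.chartSmooth_meanCurvature two_add_one_eq_three.le

theorem smooth_sgrad (h : VariationData X ν ε F N V Φ) {f : M → ℝ} (hf : ChartSmooth n 2 f) :
    ChartSmooth n 1 (sgrad X f) :=
  h.hypersurface.chartSmooth_sgrad hf one_add_one_eq_two.le (by norm_num)

theorem smooth_flux (h : VariationData X ν ε F N V Φ) (c : ℝ) :
    ChartSmooth n 1 (flux c X ν V Φ) := by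
  have hH := h.smooth_meanCurvature
  have hHc := (hH.of_le one_le_two).add (chartSmooth_const c)
  have hsq : ChartSmooth n 1 fun p => (meanCurvature X ν p + c) ^ 2 := by
    simp only [sq]; exact hHc.mul hHc
  exact (hsq.smul (h.smooth_tangent.of_le one_le_two)).add ((chartSmooth_const _).smul
    (((h.smooth_normal.of_le one_le_two).smul (h.smooth_sgrad hH)).sub
      (hHc.smul (h.smooth_sgrad h.smooth_normal))))

/-- In the divergence of `Φ∇H - (H + c)∇Φ` the two terms `⟨∇Φ, ∇H⟩` cancel. -/
theorem surfDiv_flux (h : VariationData X ν ε F N V Φ) (c : ℝ) (p : M) :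
    surfDiv X (flux c X ν V Φ) p = (meanCurvature X ν p + c) ^ 2 * surfDiv X V p +
      2 * (meanCurvature X ν p + c) * inner ℝ (sgrad X (meanCurvature X ν) p) (V p) +
      2 / (n : ℝ) * (Φ p * laplacian X (meanCurvature X ν) p -
        (meanCurvature X ν p + c) * laplacian X Φ p) := by
  have hh := h.hypersurface
  have hH := h.smooth_meanCurvature
  have hH1 := hH.of_le one_le_two
  have hΦ1 := h.smooth_normal.of_le one_le_two
  have hV1 := h.smooth_tangent.of_le one_le_two
  have hHc : ChartSmooth n 1 fun p => meanCurvature X ν p + c := hH1.add (chartSmooth_const c)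
  have hsq : ChartSmooth n 1 fun p => (meanCurvature X ν p + c) ^ 2 := by
    simp only [sq]; exact hHc.mul hHc
  have g1 := hΦ1.smul (h.smooth_sgrad hH)
  have g2 := hHc.smul (h.smooth_sgrad h.smooth_normal)
  unfold flux
  rw [surfDiv_add (hsq.smul hV1) ((chartSmooth_const _).smul (g1.sub g2)), surfDiv_smul hsq hV1,
    surfDiv_const_smul (g1.sub g2), surfDiv_sub g1 g2, surfDiv_smul hΦ1 (h.smooth_sgrad hH),
    surfDiv_smul hHc (h.smooth_sgrad h.smooth_normal), sgrad_sq hHc, sgrad_add_const hH1,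
    hh.laplacian_eq_surfDiv (by norm_num) hH, hh.laplacian_eq_surfDiv (by norm_num) h.smooth_normal,
    real_inner_smul_left, real_inner_comm (sgrad X Φ p)]
  ring

/-- The first variation of the energy density. -/
theorem hasDerivAt_energyDensity (h : VariationData X ν ε F N V Φ) (c : ℝ)
    (hx : x ∈ (extChartAt (𝓡∂ n) q).target) :
    HasDerivAt (fun t => (rep q (meanCurvature (F t) (N t)) x + c) ^ 2 * √(gram (F t) q x).det)
      (rep q (fun p => -(2 / (n : ℝ)) * interiorIntegrand c X ν Φ p +
        surfDiv X (flux c X ν V Φ) p) x * √(gram X q x).det) 0 := by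
  have hn : (n : ℝ) ≠ 0 := Nat.cast_ne_zero.2 (NeZero.ne n)
  have h1 := (((h.hasDerivAt_meanCurvature hx).add_const c).fun_pow 2).fun_mul
    (h.hasDerivAt_sqrt_det hx)
  refine h1.congr_deriv ?_
  simp only [h.variation.zero, h.variation.normal_zero, rep, h.surfDiv_flux, interiorIntegrand]
  push_cast
  field_simp
  ring

end VariationData

end EnergyDensity

/-! ### Measures given by parametrizations with a density -/

section PushForward

/-- Integration with respect to a measure with a continuous density on a parameter domain, pushed
forward by the parametrization. -/
theorem integral_parametrization {Z M : Type*} [TopologicalSpace Z] [T2Space Z]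
    [MeasurableSpace Z] [BorelSpace Z] [TopologicalSpace M] [MeasurableSpace M] [BorelSpace M]
    (μ : Measure Z) [IsFiniteMeasureOnCompacts μ] {T C : Set Z} (hT : MeasurableSet T)
    (hC : IsCompact C) (hCT : C ⊆ T) {g : Z → M} (hg : ContinuousOn g T) {w : Z → ℝ}
    (hw : ContinuousOn w T) (hw0 : ∀ z ∈ T, 0 ≤ w z) {f : M → ℝ}
    (hf : AEStronglyMeasurable f
      (((μ.restrict T).withDensity fun z => ENNReal.ofReal (w z)).map g))
    (hfc : ContinuousOn (fun z => f (g z)) C) (hz : ∀ z ∈ T, z ∉ C → w z * f (g z) = 0) :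
    Integrable f (((μ.restrict T).withDensity fun z => ENNReal.ofReal (w z)).map g) ∧
      ∫ p, f p ∂(((μ.restrict T).withDensity fun z => ENNReal.ofReal (w z)).map g) =
        ∫ z in C, w z * f (g z) ∂μ := by
  have hgm : AEMeasurable g ((μ.restrict T).withDensity fun z => ENNReal.ofReal (w z)) :=
    (hg.aemeasurable hT).mono_ac (withDensity_absolutelyContinuous _ _)
  have hwm : AEMeasurable (fun z => ENNReal.ofReal (w z)) (μ.restrict T) :=
    (hw.aemeasurable hT).ennreal_ofReal
  have htop : ∀ᵐ z ∂(μ.restrict T), ENNReal.ofReal (w z) < ⊤ := by simp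
  -- Off `C` the weighted integrand vanishes on `T`, so it may be replaced by its indicator on the
  -- compact `C`, where it is continuous and hence integrable.
  have hae : (fun z => (ENNReal.ofReal (w z)).toReal • f (g z)) =ᵐ[μ.restrict T]
      C.indicator fun z => w z * f (g z) := by
    filter_upwards [ae_restrict_mem hT] with z hzT
    rw [ENNReal.toReal_ofReal (hw0 z hzT), smul_eq_mul]
    by_cases hzC : z ∈ C
    · rw [indicator_of_mem hzC]
    · rw [indicator_of_notMem hzC, hz z hzT hzC]
  have hI : IntegrableOn (fun z => w z * f (g z)) C μ :=
    ((hw.mono hCT).mul hfc).integrableOn_compact hC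
  refine ⟨?_, ?_⟩
  · rw [integrable_map_measure hf hgm, integrable_withDensity_iff_integrable_smul₀' hwm htop]
    refine Integrable.congr ?_ hae.symm
    rw [integrable_indicator_iff hC.measurableSet]
    exact hI.mono_measure Measure.restrict_le_self
  · rw [integral_map hgm hf, integral_withDensity_eq_integral_toReal_smul₀ hwm htop,
      integral_congr_ae hae, integral_indicator hC.measurableSet,
      Measure.restrict_restrict hC.measurableSet, inter_eq_self_of_subset_left hCT]

theorem parametrization_apply_eq_zero {Z M : Type*} [TopologicalSpace Z]
    [MeasurableSpace Z] [BorelSpace Z] [TopologicalSpace M] [MeasurableSpace M] [BorelSpace M]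
    (μ : Measure Z) {T : Set Z} (hT : MeasurableSet T) {g : Z → M} (hg : ContinuousOn g T)
    {w : Z → ℝ} (hw : ContinuousOn w T) {K : Set M} (hK : MeasurableSet K)
    (hz : ∀ z ∈ T, g z ∈ K → w z = 0) :
    (((μ.restrict T).withDensity fun z => ENNReal.ofReal (w z)).map g) K = 0 := by
  have hgm : AEMeasurable g ((μ.restrict T).withDensity fun z => ENNReal.ofReal (w z)) :=
    (hg.aemeasurable hT).mono_ac (withDensity_absolutelyContinuous _ _)
  have hwm : AEMeasurable (fun z => ENNReal.ofReal (w z)) (μ.restrict T) :=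
    (hw.aemeasurable hT).ennreal_ofReal
  rw [Measure.map_apply_of_aemeasurable hgm hK, withDensity_apply_eq_zero' hwm]
  refine measure_mono_null (t := Tᶜ) (fun z hzs hzT => hzs.1 ?_) ?_
  · rw [hz z hzT hzs.2, ENNReal.ofReal_zero]
  · rw [Measure.restrict_apply hT.compl, compl_inter_self, measure_empty]

/-- The volume measure is a sum over all points of `M`, possibly uncountably many. On a compact set
only finitely many terms survive, which makes integrals finite sums. -/
theorem restrict_sum_eq_finset_sum {ι M : Type*} [MeasurableSpace M] (μ : ι → Measure M)
    {K : Set M} (hK : MeasurableSet K) (Q : Finset ι) (hQ : ∀ q ∉ Q, μ q K = 0) :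
    (Measure.sum μ).restrict K = ∑ q ∈ Q, (μ q).restrict K := by
  rw [Measure.restrict_sum _ hK]
  ext s hs
  rw [Measure.sum_apply _ hs, Measure.finsetSum_apply, tsum_eq_sum]
  intro q hq
  rw [Measure.restrict_eq_zero.2 (hQ q hq)]
  rfl

theorem integral_sum_of_support {ι M : Type*} [MeasurableSpace M] (μ : ι → Measure M)
    {K : Set M} (hK : MeasurableSet K) (Q : Finset ι) (hQ : ∀ q ∉ Q, μ q K = 0) {f : M → ℝ}
    (hf : ∀ p ∉ K, f p = 0) (hi : ∀ q ∈ Q, Integrable f (μ q)) :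
    Integrable f (Measure.sum μ) ∧ ∫ p, f p ∂(Measure.sum μ) = ∑ q ∈ Q, ∫ p, f p ∂(μ q) := by
  have hi' : ∀ q ∈ Q, Integrable f ((μ q).restrict K) := fun q hq => (hi q hq).restrict
  have hs : Function.support f ⊆ K := fun p hp => by
    by_contra h; exact hp (hf p h)
  constructor
  · rw [← integrableOn_iff_integrable_of_support_subset hs, IntegrableOn,
      restrict_sum_eq_finset_sum μ hK Q hQ]
    exact integrable_finsetSum_measure.2 hi'
  · rw [← setIntegral_eq_integral_of_forall_compl_eq_zero hf, restrict_sum_eq_finset_sum μ hK Q hQ,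
      integral_finsetSum_measure hi']
    exact Finset.sum_congr rfl fun q _ => setIntegral_eq_integral_of_forall_compl_eq_zero hf

end PushForward

/-! ### Integration over compact sets with respect to the volume measure -/

section Volume

variable {n : ℕ} [NeZero n] {M : Type*} [TopologicalSpace M] [ChartedSpace (EuclideanHalfSpace n) M]

theorem measurableSet_target (q : M) : MeasurableSet (extChartAt (𝓡∂ n) q).target := by
  rw [extChartAt_target]
  exact (((chartAt (EuclideanHalfSpace n) q).open_target.preimage
    (𝓡∂ n).continuous_symm).measurableSet).inter (𝓡∂ n).isClosed_range.measurableSet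

theorem ChartSmooth.continuous {F : Type*} [NormedAddCommGroup F] [NormedSpace ℝ F] {k : ℕ∞ω}
    {f : M → F} (hf : ChartSmooth n k f) : Continuous f := by
  rw [continuous_iff_continuousAt]
  intro p
  have h1 : ContinuousOn (fun r => rep p f (extChartAt (𝓡∂ n) p r)) (extChartAt (𝓡∂ n) p).source :=
    (hf p).continuousOn.comp (continuousOn_extChartAt p) (extChartAt (𝓡∂ n) p).mapsTo
  have h2 := h1.continuousAt (extChartAt_source_mem_nhds p)
  refine h2.congr ?_
  filter_upwards [extChartAt_source_mem_nhds (I := 𝓡∂ n) p] with r hr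
  rw [rep, (extChartAt (𝓡∂ n) p).left_inv hr]

variable [IsManifold (𝓡∂ n) ∞ M] [T2Space M] [SigmaCompactSpace M]

theorem chartSmooth_chartPartition (q : M) : ChartSmooth n ∞ (chartPartition n M q) :=
  chartSmooth_of_contMDiff le_rfl (chartPartition n M q).contMDiff

theorem tsupport_chartPartition_subset (q : M) :
    tsupport (chartPartition n M q) ⊆ (extChartAt (𝓡∂ n) q).source := by
  rw [extChartAt_source]
  exact chartPartition_isSubordinate n M q

/-- The part of the compact set `K` that is charged by the chart around `q`, in coordinates. -/
def chartPart (n : ℕ) [NeZero n] {M : Type*} [TopologicalSpace M]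
    [ChartedSpace (EuclideanHalfSpace n) M] [IsManifold (𝓡∂ n) ∞ M] [T2Space M]
    [SigmaCompactSpace M] (K : Set M) (q : M) : Set (EuclideanSpace ℝ (Fin n)) :=
  extChartAt (𝓡∂ n) q '' (K ∩ tsupport (chartPartition n M q))

theorem isCompact_chartPart {K : Set M} (hK : IsCompact K) (q : M) : IsCompact (chartPart n K q) :=
  (hK.inter_right (isClosed_tsupport _)).image_of_continuousOn
    ((continuousOn_extChartAt q).mono (inter_subset_right.trans (tsupport_chartPartition_subset q)))

theorem chartPart_subset (K : Set M) (q : M) : chartPart n K q ⊆ (extChartAt (𝓡∂ n) q).target := by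
  rintro _ ⟨p, hp, rfl⟩
  exact (extChartAt (𝓡∂ n) q).map_source (tsupport_chartPartition_subset q hp.2)

theorem symm_mem_of_mem_chartPart {K : Set M} {q : M} {x : EuclideanSpace ℝ (Fin n)}
    (hx : x ∈ chartPart n K q) : (extChartAt (𝓡∂ n) q).symm x ∈ K := by
  obtain ⟨p, hp, rfl⟩ := hx
  rw [(extChartAt (𝓡∂ n) q).left_inv (tsupport_chartPartition_subset q hp.2)]
  exact hp.1

theorem rep_chartPartition_eq_zero {K : Set M} {q : M} {x : EuclideanSpace ℝ (Fin n)}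
    (hx : x ∈ (extChartAt (𝓡∂ n) q).target) (hK : (extChartAt (𝓡∂ n) q).symm x ∈ K)
    (h : x ∉ chartPart n K q) : rep q (chartPartition n M q) x = 0 := by
  by_contra hne
  exact h ⟨_, ⟨hK, subset_tsupport _ hne⟩, (extChartAt (𝓡∂ n) q).right_inv hx⟩

/-- The closed supports of the partition of unity are again locally finite, so a compact set meets
finitely many of them. -/
theorem finite_chartPartition {K : Set M} (hK : IsCompact K) :
    {q : M | (tsupport (chartPartition n M q) ∩ K).Nonempty}.Finite :=
  (chartPartition n M).locallyFinite.closure.finite_nonempty_inter_compact hK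

/-- The finitely many charts that charge the compact set `K`. -/
def chartsOn (n : ℕ) [NeZero n] {M : Type*} [TopologicalSpace M]
    [ChartedSpace (EuclideanHalfSpace n) M] [IsManifold (𝓡∂ n) ∞ M] [T2Space M]
    [SigmaCompactSpace M] {K : Set M} (hK : IsCompact K) : Finset M :=
  (finite_chartPartition (n := n) hK).toFinset

theorem chartPartition_eq_zero {K : Set M} (hK : IsCompact K) {q : M}
    (hq : q ∉ chartsOn n hK) {p : M} (hp : p ∈ K) : chartPartition n M q p = 0 := by
  by_contra hne
  refine hq ?_
  rw [chartsOn, Set.Finite.mem_toFinset]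
  exact ⟨p, subset_tsupport _ hne, hp⟩

theorem sum_chartPartition {K : Set M} (hK : IsCompact K) {p : M} (hp : p ∈ K) :
    ∑ q ∈ chartsOn n hK, chartPartition n M q p = 1 := by
  rw [← (chartPartition n M).sum_eq_one (mem_univ p), finsum_eq_sum_of_support_subset]
  intro q hq
  by_contra h
  exact hq (chartPartition_eq_zero hK h hp)

theorem IsHypersurface.continuousOn_density
    {X ν : M → EuclideanSpace ℝ (Fin (n + 1))} {k : ℕ∞ω}
    (h : IsHypersurface k X ν) (q : M) :
    ContinuousOn (fun x => rep q (chartPartition n M q) x * √(gram X q x).det)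
      (extChartAt (𝓡∂ n) q).target :=
  (chartSmooth_chartPartition q q).continuousOn.mul (h.contDiffOn_sqrt_det q).continuousOn

theorem density_nonneg (X : M → EuclideanSpace ℝ (Fin (n + 1))) (q : M)
    (x : EuclideanSpace ℝ (Fin n)) :
    0 ≤ rep q (chartPartition n M q) x * √(gram X q x).det :=
  mul_nonneg ((chartPartition n M).nonneg q _) (Real.sqrt_nonneg _)

variable [MeasurableSpace M]

/-- The contribution of the chart around `q` to the volume measure. -/
def chartMeasure (X : M → EuclideanSpace ℝ (Fin (n + 1))) (q : M) : Measure M :=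
  ((volume.restrict (extChartAt (𝓡∂ n) q).target).withDensity fun x =>
    ENNReal.ofReal (rep q (chartPartition n M q) x * √(gram X q x).det)).map
  (extChartAt (𝓡∂ n) q).symm

theorem volMeasure_eq_sum (X : M → EuclideanSpace ℝ (Fin (n + 1))) :
    volMeasure X = Measure.sum (chartMeasure X) := rfl

variable [BorelSpace M] {X ν : M → EuclideanSpace ℝ (Fin (n + 1))} {k : ℕ∞ω}

theorem chartMeasure_apply_eq_zero (h : IsHypersurface k X ν) {K : Set M} (hK : IsCompact K) {q : M}
    (hq : q ∉ chartsOn n hK) : chartMeasure X q K = 0 :=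
  parametrization_apply_eq_zero volume (measurableSet_target q) (continuousOn_extChartAt_symm q)
    (h.continuousOn_density q) hK.measurableSet fun x _ hxK => by
      rw [rep, chartPartition_eq_zero hK hq hxK, zero_mul]

/-- The indicator of `K` need not be continuous, but its argument stays in `K` on `chartPart`, where
the integrand is therefore just `f`. -/
theorem integral_chartMeasure (h : IsHypersurface k X ν) {K : Set M} (hK : IsCompact K)
    {f : M → ℝ} (hf : Continuous f) (q : M) :
    Integrable (K.indicator f) (chartMeasure X q) ∧ ∫ p, K.indicator f p ∂(chartMeasure X q) =
      ∫ x in chartPart n K q,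
        rep q (chartPartition n M q) x * (rep q f x * √(gram X q x).det) := by
  have hcs := chartPart_subset (n := n) K q
  have hC := isCompact_chartPart (n := n) hK q
  have hind : ∀ x ∈ chartPart n K q, K.indicator f ((extChartAt (𝓡∂ n) q).symm x) = rep q f x :=
    fun x hx => indicator_of_mem (symm_mem_of_mem_chartPart hx) f
  have h1 := integral_parametrization (f := K.indicator f) volume (measurableSet_target q)
    hC hcs (continuousOn_extChartAt_symm q)
    (h.continuousOn_density q) (fun x _ => density_nonneg X q x)
    (hf.measurable.indicator hK.measurableSet).aestronglyMeasurable
    ((hf.comp_continuousOn ((continuousOn_extChartAt_symm q).mono hcs)).congr hind)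
    (fun x hxT hxC => by
      by_cases hxK : (extChartAt (𝓡∂ n) q).symm x ∈ K
      · rw [rep_chartPartition_eq_zero hxT hxK hxC, zero_mul, zero_mul]
      · rw [indicator_of_notMem hxK, mul_zero])
  refine ⟨h1.1, h1.2.trans (setIntegral_congr_fun hC.measurableSet fun x hx => ?_)⟩
  rw [hind x hx]
  ring

/-- Integration over a compact set in charts. -/
theorem integral_volMeasure (h : IsHypersurface k X ν) {K : Set M} (hK : IsCompact K)
    {f : M → ℝ} (hf : Continuous f) :
    IntegrableOn f K (volMeasure X) ∧ ∫ p in K, f p ∂(volMeasure X) =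
      ∑ q ∈ chartsOn n hK, ∫ x in chartPart n K q,
        rep q (chartPartition n M q) x * (rep q f x * √(gram X q x).det) := by
  have h1 := integral_sum_of_support (chartMeasure X) hK.measurableSet (chartsOn n hK)
    (fun q hq => chartMeasure_apply_eq_zero h hK hq) (f := K.indicator f)
    (fun p hp => indicator_of_notMem hp f) (fun q _ => (integral_chartMeasure h hK hf q).1)
  rw [volMeasure_eq_sum, ← integrable_indicator_iff hK.measurableSet,
    ← integral_indicator hK.measurableSet]
  exact ⟨h1.1, h1.2.trans (Finset.sum_congr rfl fun q _ => (integral_chartMeasure h hK hf q).2)⟩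

theorem integrable_volMeasure (h : IsHypersurface k X ν) {K : Set M} (hK : IsCompact K)
    {f : M → ℝ} (hf : Continuous f) (hs : ∀ p ∉ K, f p = 0) : Integrable f (volMeasure X) := by
  rw [← integrableOn_iff_integrable_of_support_subset (s := K) fun p hp => by
    by_contra hpK; exact hp (hs p hpK)]
  exact (integral_volMeasure h hK hf).1

end Volume

/-! ### Differentiation of the energy under the integral sign -/

section EnergyDerivative

variable {n : ℕ} [NeZero n] {M : Type*} [TopologicalSpace M] [ChartedSpace (EuclideanHalfSpace n) M]
  {X ν : M → EuclideanSpace ℝ (Fin (n + 1))} {ε : ℝ}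
  {F N : ℝ → M → EuclideanSpace ℝ (Fin (n + 1))}
  {V : M → EuclideanSpace ℝ (Fin (n + 1))} {Φ : M → ℝ}

/-- The energy density of the variation in the chart around `q`. -/
def energyDensity (c : ℝ) (F N : ℝ → M → EuclideanSpace ℝ (Fin (n + 1))) (q : M) (t : ℝ)
    (x : EuclideanSpace ℝ (Fin n)) : ℝ :=
  (rep q (meanCurvature (F t) (N t)) x + c) ^ 2 * √(gram (F t) q x).det

/-- The time derivative is continuous on the cylinder, hence bounded on the compact set `[-ε/2, ε/2]
× C`. The constant bound is integrable over `C`, and dominated differentiation applies. -/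
theorem hasDerivAt_integral_of_contDiffOn_cylinder {f : ℝ → EuclideanSpace ℝ (Fin n) → ℝ} {q : M}
    (hε : 0 < ε) (hf : ContDiffOn ℝ 1 (fun z => f z.1 z.2) (cylinder n ε q))
    {C : Set (EuclideanSpace ℝ (Fin n))} (hC : IsCompact C)
    (hCT : C ⊆ (extChartAt (𝓡∂ n) q).target) {w : EuclideanSpace ℝ (Fin n) → ℝ}
    (hw : ContinuousOn w C) :
    HasDerivAt (fun t => ∫ x in C, w x * f t x) (∫ x in C, w x * deriv (fun t => f t x) 0) 0 := by
  have hd : ContinuousOn (fun z : ℝ × EuclideanSpace ℝ (Fin n) => deriv (fun s => f s z.2) z.1)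
      (cylinder n ε q) := (contDiffOn_deriv_slice (k := 0) hf (by simp)).continuousOn
  have h0 : (0 : ℝ) ∈ Ioo (-ε) ε := by simp [hε]
  have hsub : Icc (-(ε / 2)) (ε / 2) ⊆ Ioo (-ε) ε := fun t ht =>
    ⟨by linarith [ht.1], by linarith [ht.2]⟩
  have hsl : ∀ t ∈ Ioo (-ε) ε, ContinuousOn (f t) C := fun t ht =>
    (contDiffOn_slice hf ht).continuousOn.mono hCT
  obtain ⟨b, hb⟩ := (isCompact_Icc (a := -(ε / 2)) (b := ε / 2)).prod hC |>.exists_bound_of_continuousOn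
    (hd.mono (prod_mono hsub hCT))
  obtain ⟨b', hb'⟩ := hC.exists_bound_of_continuousOn hw
  refine (hasDerivAt_integral_of_dominated_loc_of_deriv_le (μ := volume.restrict C)
    (F := fun t x => w x * f t x) (F' := fun t x => w x * deriv (fun s => f s x) t)
    (s := Icc (-(ε / 2)) (ε / 2)) (bound := fun _ => b' * b)
    (Icc_mem_nhds (by linarith) (by linarith)) ?_ ?_ ?_ ?_ ?_ ?_).2
  · filter_upwards [isOpen_Ioo.mem_nhds h0] with t ht
    exact (hw.mul (hsl t ht)).aestronglyMeasurable hC.measurableSet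
  · exact (hw.mul (hsl 0 h0)).integrableOn_compact hC
  · refine (hw.mul ?_).aestronglyMeasurable hC.measurableSet
    exact hd.comp (f := fun x : EuclideanSpace ℝ (Fin n) => ((0 : ℝ), x)) (by fun_prop)
      fun x hx => ⟨h0, hCT hx⟩
  · filter_upwards [ae_restrict_mem hC.measurableSet] with x hx t ht
    rw [norm_mul]
    exact mul_le_mul (hb' x hx) (hb (t, x) ⟨ht, hx⟩) (norm_nonneg _)
      ((norm_nonneg _).trans (hb' x hx))
  · exact continuousOn_const.integrableOn_compact hC
  · filter_upwards [ae_restrict_mem hC.measurableSet] with x hx t ht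
    exact ((hasDerivAt_slice hf one_ne_zero (hsub ht)
      (hCT hx)).differentiableAt.hasDerivAt).const_mul _

variable [IsManifold (𝓡∂ n) ∞ M]

/-- Written with `⟨∂_i F, ∂_j N⟩`, the mean curvature takes one derivative of the `C³` family and
one of its `C²` normal, so it is jointly `C¹`. -/
theorem IsVariation.contDiffOn_energyDensity (h : IsVariation X ν ε F N) (c : ℝ) (q : M) :
    ContDiffOn ℝ 1 (fun z => energyDensity c F N q z.1 z.2) (cylinder n ε q) := by
  have h1 : ∀ z ∈ cylinder n ε q, IsHypersurface 2 (F z.1) (N z.1) :=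
    fun z hz => h.isHypersurface hz.1
  have hF : ∀ i, ContDiffOn ℝ 1 (fun z : ℝ × EuclideanSpace ℝ (Fin n) => frame (F z.1) q z.2 i)
      (cylinder n ε q) := fun i =>
    contDiffOn_pd_slice (f := fun s => rep q (F s)) (h.contDiffOn_rep q) (by norm_num) i
  have hN : ∀ i, ContDiffOn ℝ 1 (fun z : ℝ × EuclideanSpace ℝ (Fin n) => frame (N z.1) q z.2 i)
      (cylinder n ε q) := fun i =>
    contDiffOn_pd_slice (f := fun s => rep q (N s)) (h.contDiffOn_rep_normal q)
      one_add_one_eq_two.le i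
  have hG : MatrixContDiffOn 1 (cylinder n ε q)
      fun z : ℝ × EuclideanSpace ℝ (Fin n) => gram (F z.1) q z.2 :=
    fun i j => (hF i).inner ℝ (hF j)
  have hB : MatrixContDiffOn 1 (cylinder n ε q)
      fun z : ℝ × EuclideanSpace ℝ (Fin n) => pairing (F z.1) (N z.1) q z.2 :=
    fun i j => (hF i).inner ℝ (hN j)
  have hG0 : ∀ z ∈ cylinder n ε q, (gram (F z.1) q z.2).det ≠ 0 :=
    fun z hz => ((h1 z hz).det_pos hz.2).ne'
  refine ContDiffOn.congr (f := fun z => (1 / (n : ℝ) *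
    ((gram (F z.1) q z.2)⁻¹ * pairing (F z.1) (N z.1) q z.2).trace + c) ^ 2 *
      √(gram (F z.1) q z.2).det) ?_ fun z hz => ?_
  · exact (((contDiffOn_const.mul ((hG.inv hG0).mul hB).trace).add contDiffOn_const).pow 2).mul
      (hG.det.sqrt hG0)
  · simp only [energyDensity, (h1 z hz).rep_meanCurvature one_le_two hz.2]

theorem IsVariation.continuous_energyIntegrand (h : IsVariation X ν ε F N) (c : ℝ) {t : ℝ}
    (ht : t ∈ Ioo (-ε) ε) : Continuous fun p => (meanCurvature (F t) (N t) p + c) ^ 2 :=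
  ((((h.isHypersurface ht).chartSmooth_meanCurvature (l := 1)
    one_add_one_eq_two.le).continuous).add continuous_const).pow 2

theorem VariationData.continuous_interiorIntegrand (h : VariationData X ν ε F N V Φ) (c : ℝ) :
    Continuous (interiorIntegrand c X ν Φ) := by
  have hh := h.hypersurface
  have hH := h.smooth_meanCurvature.continuous
  have hL : Continuous (laplacian X (meanCurvature X ν)) :=
    (hh.chartSmooth_laplacian (l := 0) (by norm_num)
      (h.smooth_meanCurvature.of_le (by norm_num))).continuous
  have hA : Continuous (normSqA X ν) := (hh.chartSmooth_normSqA (l := 0) (by norm_num)).continuous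
  have hΦ := h.smooth_normal.continuous
  unfold interiorIntegrand
  fun_prop

theorem VariationData.continuous_surfDiv_flux (h : VariationData X ν ε F N V Φ) (c : ℝ) :
    Continuous (surfDiv X (flux c X ν V Φ)) :=
  (h.hypersurface.chartSmooth_surfDiv (l := 0) (by norm_num)
    ((h.smooth_flux c).of_le (by norm_num))).continuous

variable [T2Space M] [SigmaCompactSpace M] [MeasurableSpace M] [BorelSpace M]

/-- The derivative of the energy of a compact part of the hypersurface. -/
theorem VariationData.hasDerivAt_energyOn (h : VariationData X ν ε F N V Φ) (c : ℝ) {K : Set M}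
    (hK : IsCompact K) :
    HasDerivAt (fun t => energyOn c (F t) (N t) K)
      (∫ p in K, (-(2 / (n : ℝ)) * interiorIntegrand c X ν Φ p +
        surfDiv X (flux c X ν V Φ) p) ∂(volMeasure X)) 0 := by
  have hcont : Continuous fun p => -(2 / (n : ℝ)) * interiorIntegrand c X ν Φ p +
      surfDiv X (flux c X ν V Φ) p :=
    (continuous_const.mul (h.continuous_interiorIntegrand c)).add (h.continuous_surfDiv_flux c)
  rw [(integral_volMeasure h.hypersurface hK hcont).2]
  have h1 : (fun t => energyOn c (F t) (N t) K) =ᶠ[𝓝 0] fun t => ∑ q ∈ chartsOn n hK,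
      ∫ x in chartPart n K q, rep q (chartPartition n M q) x * energyDensity c F N q t x := by
    filter_upwards [h.eventually_mem] with t ht
    exact (integral_volMeasure (h.variation.isHypersurface ht) hK
      (h.variation.continuous_energyIntegrand c ht)).2
  refine HasDerivAt.congr_of_eventuallyEq ?_ h1
  refine HasDerivAt.fun_sum fun q _ => ?_
  have hCT := chartPart_subset (n := n) K q
  refine (hasDerivAt_integral_of_contDiffOn_cylinder h.variation.pos
    (h.variation.contDiffOn_energyDensity c q) (isCompact_chartPart hK q)
    hCT ((chartSmooth_chartPartition q q).continuousOn.mono hCT)).congr_deriv ?_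
  refine setIntegral_congr_fun (isCompact_chartPart hK q).measurableSet fun x hx => ?_
  exact congrArg _ (h.hasDerivAt_energyDensity c (hCT hx)).deriv

end EnergyDerivative

/-! ### Independence of the volume integral from the chart -/

section Localization

variable {n : ℕ} [NeZero n] {M : Type*} [TopologicalSpace M] [ChartedSpace (EuclideanHalfSpace n) M]
  {X ν : M → EuclideanSpace ℝ (Fin (n + 1))} {k : ℕ∞ω}

theorem injOn_coordChange (q r : M) : InjOn (coordChange q r) (overlap (n := n) q r) :=
  fun x hx y hy h => by
    rw [← coordChange_coordChange hx, h, coordChange_coordChange hy]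

variable [IsManifold (𝓡∂ n) ∞ M]

/-- Change of variables: `|det J|` is precisely the factor by which `√(det g)` changes. -/
theorem integral_coordChange (h : IsHypersurface k X ν) {q r : M}
    {A : Set (EuclideanSpace ℝ (Fin n))} (hA : IsCompact A) (hAo : A ⊆ overlap q r) (f : M → ℝ) :
    ∫ x in coordChange q r '' A, rep r f x * √(gram X r x).det =
      ∫ x in A, rep q f x * √(gram X q x).det := by
  rw [integral_image_eq_integral_abs_det_fderiv_smul volume hA.measurableSet
    (f' := fun x => fderivWithin ℝ (coordChange q r) (range (𝓡∂ n)) x)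
    (fun x hx => (differentiableWithinAt_coordChange (hAo hx)).hasFDerivWithinAt.mono
      fun y hy => extChartAt_target_subset_range q (hAo hy).1) ((injOn_coordChange q r).mono hAo)]
  refine setIntegral_congr_fun hA.measurableSet fun x hx => ?_
  rw [det_fderivWithin_coordChange, rep_coordChange (hAo hx),
    sqrt_det_gram_change (h.smooth.of_le le_add_self) (hAo hx), smul_eq_mul]
  ring

variable [T2Space M] [SigmaCompactSpace M] [MeasurableSpace M] [BorelSpace M]

/-- The integral of a function supported in the domain of a single chart. -/
theorem integral_volMeasure_of_subset_source (h : IsHypersurface k X ν) {q : M} {K : Set M}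
    (hK : IsCompact K) (hKq : K ⊆ (extChartAt (𝓡∂ n) q).source) {f : M → ℝ} (hf : Continuous f)
    (hs : ∀ p ∉ K, f p = 0) :
    ∫ p, f p ∂(volMeasure X) =
      ∫ x in extChartAt (𝓡∂ n) q '' K, rep q f x * √(gram X q x).det := by
  have hD : IsCompact (extChartAt (𝓡∂ n) q '' K) :=
    hK.image_of_continuousOn ((continuousOn_extChartAt q).mono hKq)
  have hDT : extChartAt (𝓡∂ n) q '' K ⊆ (extChartAt (𝓡∂ n) q).target := by
    rintro _ ⟨p, hp, rfl⟩
    exact (extChartAt (𝓡∂ n) q).map_source (hKq hp)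
  have hsymm : ∀ x ∈ extChartAt (𝓡∂ n) q '' K, (extChartAt (𝓡∂ n) q).symm x ∈ K := by
    rintro _ ⟨p, hp, rfl⟩
    rwa [(extChartAt (𝓡∂ n) q).left_inv (hKq hp)]
  rw [← setIntegral_eq_integral_of_forall_compl_eq_zero hs, (integral_volMeasure h hK hf).2]
  -- Each summand, computed in the chart around `r`, is carried to the chart around `q`. The
  -- intersection with the support of the weight keeps it inside the overlap; outside that support
  -- the weight is zero, so the domain can be enlarged to all of `K`. The weights then add up to
  -- `1`.
  have key : ∀ r, ∫ x in chartPart n K r, rep r (chartPartition n M r) x *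
      (rep r f x * √(gram X r x).det) = ∫ x in extChartAt (𝓡∂ n) q '' K,
        rep q (chartPartition n M r) x * (rep q f x * √(gram X q x).det) := by
    intro r
    set A := extChartAt (𝓡∂ n) q '' (K ∩ tsupport (chartPartition n M r)) with hA
    have hAc : IsCompact A := (hK.inter_right (isClosed_tsupport _)).image_of_continuousOn
      ((continuousOn_extChartAt q).mono (inter_subset_left.trans hKq))
    have hAo : A ⊆ overlap q r := by
      rintro _ ⟨p, hp, rfl⟩
      refine ⟨(extChartAt (𝓡∂ n) q).map_source (hKq hp.1), ?_⟩
      rw [mem_preimage, (extChartAt (𝓡∂ n) q).left_inv (hKq hp.1)]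
      exact tsupport_chartPartition_subset r hp.2
    have hAC : coordChange q r '' A = chartPart n K r := by
      rw [hA, image_image, chartPart]
      refine image_congr fun p hp => ?_
      rw [coordChange, (extChartAt (𝓡∂ n) q).left_inv (hKq hp.1)]
    have h1 := integral_coordChange h hAc hAo fun p => chartPartition n M r p * f p
    rw [hAC] at h1
    have h2 : ∫ x in A, rep q (chartPartition n M r) x * (rep q f x * √(gram X q x).det) =
        ∫ x in extChartAt (𝓡∂ n) q '' K,
          rep q (chartPartition n M r) x * (rep q f x * √(gram X q x).det) := by
      refine (setIntegral_eq_of_subset_of_forall_sdiff_eq_zero hD.measurableSet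
        (image_mono inter_subset_left) fun x hx => ?_).symm
      have : rep q (chartPartition n M r) x = 0 := by
        by_contra hne
        exact hx.2 ⟨_, ⟨hsymm x hx.1, subset_tsupport _ hne⟩,
          (extChartAt (𝓡∂ n) q).right_inv (hDT hx.1)⟩
      rw [this, zero_mul]
    rw [← h2]
    simp only [← mul_assoc]
    exact h1
  rw [Finset.sum_congr rfl fun r _ => key r, ← integral_finsetSum]
  · refine setIntegral_congr_fun hD.measurableSet fun x hx => ?_
    rw [← Finset.sum_mul]
    have : ∑ r ∈ chartsOn n hK, rep q (chartPartition n M r) x = 1 :=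
      sum_chartPartition hK (hsymm x hx)
    rw [this, one_mul]
  · intro r _
    refine ContinuousOn.integrableOn_compact hD ?_
    exact ((chartSmooth_chartPartition r q).continuousOn.mono hDT).mul
      ((hf.comp_continuousOn ((continuousOn_extChartAt_symm q).mono hDT)).mul
        ((h.contDiffOn_sqrt_det q).continuousOn.mono hDT))

end Localization

/-! ### The divergence theorem in the half-space -/

section HalfSpaceDivergence

variable {m : ℕ}

theorem face_apply_zero (y : EuclideanSpace ℝ (Fin m)) : face y 0 = 0 := rfl

theorem integral_comp_toLp {d : ℕ} (g : EuclideanSpace ℝ (Fin d) → ℝ) :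
    ∫ y : Fin d → ℝ, g (WithLp.toLp 2 y) = ∫ x, g x :=
  (PiLp.volume_preserving_toLp (Fin d)).integral_comp
    (MeasurableEquiv.toLp 2 (Fin d → ℝ)).measurableEmbedding g

/-- The divergence theorem on the half-space for compactly supported fields. -/
theorem integral_divergence_halfSpace {u : Fin (m + 1) → EuclideanSpace ℝ (Fin (m + 1)) → ℝ}
    {u' : Fin (m + 1) → EuclideanSpace ℝ (Fin (m + 1)) →
      EuclideanSpace ℝ (Fin (m + 1)) →L[ℝ] ℝ}
    {C : Set (EuclideanSpace ℝ (Fin (m + 1)))} (hC : IsCompact C)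
    (hCR : ∀ x ∈ C, 0 ≤ x 0) (hu : ∀ i, ContinuousOn (u i) {x | 0 ≤ x 0})
    (hd : ∀ i x, 0 < x 0 → HasFDerivAt (u i) (u' i x) x)
    (h0 : ∀ i, ∀ x ∉ C, u i x = 0) (h0' : ∀ x ∉ C, ∑ i, u' i x (EuclideanSpace.single i 1) = 0)
    (hi : IntegrableOn (fun x => ∑ i, u' i x (EuclideanSpace.single i 1)) C) :
    ∫ x in C, ∑ i, u' i x (EuclideanSpace.single i 1) =
      -∫ y : EuclideanSpace ℝ (Fin m), u 0 (face y) := by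
  set D : EuclideanSpace ℝ (Fin (m + 1)) → ℝ :=
    fun x => ∑ i, u' i x (EuclideanSpace.single i 1) with hD
  obtain ⟨L, hL0, hL⟩ : ∃ L : ℝ, 0 < L ∧ ∀ x ∈ C, ∀ i, |x i| < L := by
    obtain ⟨R, hR⟩ := hC.isBounded.exists_norm_le
    refine ⟨|R| + 1, by positivity, fun x hx i => ?_⟩
    have h1 : ‖x i‖ ≤ ‖x‖ := PiLp.norm_apply_le x i
    have h2 := hR x hx
    rw [Real.norm_eq_abs] at h1
    linarith [le_abs_self R]
  -- The box `[0, L] × [-L, L]^m` contains `C`, and `L` strictly exceeds every coordinate on `C`.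
  -- Thus the field vanishes on all faces except `x 0 = 0`, which enters with a minus sign as the
  -- lower face.
  let a : Fin (m + 1) → ℝ := Fin.cons 0 fun _ => -L
  let b : Fin (m + 1) → ℝ := fun _ => L
  have hab : a ≤ b := by
    intro i
    refine Fin.cases ?_ (fun j => ?_) i
    · exact hL0.le
    · change -L ≤ L; linarith
  have hmem : ∀ y : Fin (m + 1) → ℝ, WithLp.toLp 2 y ∈ C → y ∈ Icc a b := by
    intro y hy
    have h1 := hL _ hy
    refine ⟨fun i => ?_, fun i => (abs_lt.1 (h1 i)).2.le⟩
    refine Fin.cases ?_ (fun j => ?_) i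
    · exact hCR _ hy
    · exact (abs_lt.1 (h1 j.succ)).1.le
  have hDint : Integrable D := by
    rw [← integrableOn_iff_integrable_of_support_subset (s := C) fun x hx => by
      by_contra hxC; exact hx (h0' x hxC)]
    exact hi
  have hDint' : Integrable fun y : Fin (m + 1) → ℝ => D (WithLp.toLp 2 y) :=
    (PiLp.volume_preserving_toLp (Fin (m + 1))).integrable_comp_of_integrable hDint
  have key := integral_divergence_of_hasFDerivAt_off_countable' a b hab
    (fun i y => u i (WithLp.toLp 2 y))
    (fun i y => (u' i (WithLp.toLp 2 y)).comp
      (PiLp.continuousLinearEquiv 2 ℝ (fun _ : Fin (m + 1) => ℝ)).symm.toContinuousLinearMap)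
    ∅ countable_empty
    (fun i => (hu i).comp (PiLp.continuous_toLp 2 _).continuousOn fun y hy => by
      exact hy.1 0)
    (fun y hy i => by
      refine HasFDerivAt.comp y (hd i _ ?_)
        (PiLp.continuousLinearEquiv 2 ℝ (fun _ : Fin (m + 1) => ℝ)).symm.hasFDerivAt
      exact (hy.1 0 (mem_univ _)).1)
    hDint'.integrableOn
  have hzero : ∀ i (y : Fin (m + 1) → ℝ), L ≤ |y i| → ∀ j, u j (WithLp.toLp 2 y) = 0 :=
    fun i y hy j => h0 j _ fun hyC => absurd (hL _ hyC i) (not_lt.2 hy)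
  have hlhs : ∫ y in Icc a b, D (WithLp.toLp 2 y) = ∫ x in C, D x := by
    rw [setIntegral_eq_integral_of_forall_compl_eq_zero
      (fun y hy => h0' _ fun hyC => hy (hmem y hyC)), setIntegral_eq_integral_of_forall_compl_eq_zero h0']
    exact integral_comp_toLp D
  rw [← hlhs]
  refine key.trans ?_
  have hfront : ∀ i : Fin (m + 1), ∫ y in Icc (a ∘ i.succAbove) (b ∘ i.succAbove),
      u i (WithLp.toLp 2 (i.insertNth (b i) y)) = 0 := fun i => by
    refine integral_eq_zero_of_ae (Eventually.of_forall fun y => ?_)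
    refine hzero i _ ?_ i
    rw [Fin.insertNth_apply_same]
    exact le_abs_self _
  have hback : ∀ j : Fin m, ∫ y in Icc (a ∘ j.succ.succAbove) (b ∘ j.succ.succAbove),
      u j.succ (WithLp.toLp 2 (j.succ.insertNth (a j.succ) y)) = 0 := fun j => by
    refine integral_eq_zero_of_ae (Eventually.of_forall fun y => ?_)
    refine hzero j.succ _ ?_ _
    rw [Fin.insertNth_apply_same]
    exact le_of_eq (by change L = |(-L)|; rw [abs_neg, abs_of_pos hL0])
  rw [Fin.sum_univ_succ, hfront 0, Finset.sum_eq_zero fun j _ => by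
    rw [hfront j.succ, hback j, sub_zero], add_zero, zero_sub]
  congr 1
  rw [setIntegral_eq_integral_of_forall_compl_eq_zero, ← integral_comp_toLp]
  · refine integral_congr_ae (Eventually.of_forall fun y => ?_)
    change u 0 _ = u 0 _
    rw [Fin.insertNth_zero']
    rfl
  · intro y hy
    refine h0 0 _ fun hyC => hy ?_
    have h1 := hmem _ hyC
    refine ⟨fun i => ?_, fun i => ?_⟩
    · simpa using h1.1 i.succ
    · simpa using h1.2 i.succ

end HalfSpaceDivergence

/-! ### Coordinate changes at boundary points -/

section Boundary

variable {n : ℕ} [NeZero n]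

theorem mem_range_halfSpace {x : EuclideanSpace ℝ (Fin n)} : x ∈ range (𝓡∂ n) ↔ 0 ≤ x 0 := by
  rw [range_modelWithCornersEuclideanHalfSpace]
  rfl

theorem range_mem_nhds {x : EuclideanSpace ℝ (Fin n)} (hx : 0 < x 0) : range (𝓡∂ n) ∈ 𝓝 x := by
  rw [← mem_interior_iff_mem_nhds, interior_range_modelWithCornersEuclideanHalfSpace]
  exact hx

theorem mem_posTangentConeAt_halfSpace {x v : EuclideanSpace ℝ (Fin n)} (hx : 0 ≤ x 0)
    (hv : 0 ≤ v 0) : v ∈ posTangentConeAt (range (𝓡∂ n)) x :=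
  mem_posTangentConeAt_of_segment_subset ((𝓡∂ n).convex_range.segment_subset
    (mem_range_halfSpace.2 hx) (mem_range_halfSpace.2 (add_nonneg hx hv)))

variable {M : Type*} [TopologicalSpace M] [ChartedSpace (EuclideanHalfSpace n) M]

theorem extChartAt_zero_nonneg {q : M} {x : EuclideanSpace ℝ (Fin n)}
    (hx : x ∈ (extChartAt (𝓡∂ n) q).target) : 0 ≤ x 0 :=
  mem_range_halfSpace.1 (extChartAt_target_subset_range q hx)

theorem coordChange_zero_nonneg (q r : M) (x : EuclideanSpace ℝ (Fin n)) :
    0 ≤ coordChange q r x 0 :=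
  mem_range_halfSpace.1 (coordChange_mem_range q r x)

variable [IsManifold (𝓡∂ n) ∞ M]

theorem hasFDerivWithinAt_coordChange_apply {q r : M} {x : EuclideanSpace ℝ (Fin n)}
    (hx : x ∈ overlap q r) (i : Fin n) :
    HasFDerivWithinAt (fun y => coordChange q r y i)
      ((EuclideanSpace.proj i : EuclideanSpace ℝ (Fin n) →L[ℝ] ℝ).comp
        (fderivWithin ℝ (coordChange q r) (range (𝓡∂ n)) x)) (range (𝓡∂ n)) x :=
  (EuclideanSpace.proj i : EuclideanSpace ℝ (Fin n) →L[ℝ] ℝ).hasFDerivAt.comp_hasFDerivWithinAt x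
    (differentiableWithinAt_coordChange hx).hasFDerivWithinAt

theorem exists_jacobian_ne_zero {q r : M} {x : EuclideanSpace ℝ (Fin n)} (hx : x ∈ overlap q r)
    (i : Fin n) : ∃ j, jacobian q r x i j ≠ 0 := by
  by_contra! h
  exact (isUnit_det_jacobian hx).ne_zero (Matrix.det_eq_zero_of_row_eq_zero i h)

/-- Coordinate changes map boundary points to boundary points. -/
theorem coordChange_zero_eq_zero {q r : M} {x : EuclideanSpace ℝ (Fin n)} (hx : x ∈ overlap q r)
    (h0 : x 0 = 0) : coordChange q r x 0 = 0 := by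
  by_contra hne
  have hpos : 0 < coordChange q r x 0 := lt_of_le_of_ne (coordChange_zero_nonneg q r x) (Ne.symm hne)
  have hy := coordChange_mem_overlap hx
  obtain ⟨j, hj⟩ := exists_jacobian_ne_zero hy 0
  have hd := (hasFDerivWithinAt_coordChange_apply hy 0).hasFDerivAt (range_mem_nhds hpos)
  -- If the image were interior, coordinate `0` of the inverse change would attain its minimum `0`
  -- at an interior point. Row `0` of the inverse Jacobian would vanish there, contradicting
  -- invertibility.
  have hmin : IsLocalMin (fun y => coordChange r q y 0) (coordChange q r x) :=
    Eventually.of_forall fun y => by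
      change coordChange r q (coordChange q r x) 0 ≤ _
      rw [coordChange_coordChange hx, h0]
      exact coordChange_zero_nonneg r q y
  exact hj (DFunLike.congr_fun (hmin.hasFDerivAt_eq_zero hd) (EuclideanSpace.single j 1))

theorem isLocalMinOn_coordChange {q r : M} {x : EuclideanSpace ℝ (Fin n)} (hx : x ∈ overlap q r)
    (h0 : x 0 = 0) : IsLocalMinOn (fun y => coordChange q r y 0) (range (𝓡∂ n)) x :=
  Eventually.of_forall fun y => by
    change coordChange q r x 0 ≤ _
    rw [coordChange_zero_eq_zero hx h0]
    exact coordChange_zero_nonneg q r y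

/-- At a boundary point coordinate `0` of the change has a minimum over the half-space. For `i ≠ 0`
both `e_i` and `-e_i` are admissible directions, so its derivative along `e_i` is zero. -/
theorem jacobian_zero_of_ne {q r : M} {x : EuclideanSpace ℝ (Fin n)} (hx : x ∈ overlap q r)
    (h0 : x 0 = 0) {i : Fin n} (hi : i ≠ 0) : jacobian q r x 0 i = 0 := by
  have hs : (EuclideanSpace.single i (1 : ℝ) : EuclideanSpace ℝ (Fin n)) 0 = 0 := by
    simp [hi.symm]
  exact (isLocalMinOn_coordChange hx h0).hasFDerivWithinAt_eq_zero
    (hasFDerivWithinAt_coordChange_apply hx 0)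
    (mem_posTangentConeAt_halfSpace h0.ge hs.ge)
    (mem_posTangentConeAt_halfSpace h0.ge (by rw [PiLp.neg_apply, hs, neg_zero]))

/-- The minimum gives a nonnegative derivative along `e_0`. It cannot be zero, as the rest of the
row vanishes and the Jacobian is invertible. -/
theorem jacobian_zero_zero_pos {q r : M} {x : EuclideanSpace ℝ (Fin n)} (hx : x ∈ overlap q r)
    (h0 : x 0 = 0) : 0 < jacobian q r x 0 0 := by
  have h1 : 0 ≤ jacobian q r x 0 0 := (isLocalMinOn_coordChange hx h0).hasFDerivWithinAt_nonneg
    (hasFDerivWithinAt_coordChange_apply hx 0)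
    (mem_posTangentConeAt_halfSpace h0.ge (by simp))
  refine lt_of_le_of_ne h1 fun h => ?_
  obtain ⟨j, hj⟩ := exists_jacobian_ne_zero hx 0
  by_cases hj0 : j = 0
  · rw [hj0] at hj
    exact hj h.symm
  · exact hj (jacobian_zero_of_ne hx h0 hj0)

end Boundary

/-! ### The outward unit conormal -/

section Conormal

variable {n : ℕ} [NeZero n] {M : Type*} [TopologicalSpace M] [ChartedSpace (EuclideanHalfSpace n) M]
  {X ν : M → EuclideanSpace ℝ (Fin (n + 1))} {k : ℕ∞ω}

theorem ChartSmooth.mdifferentiableAt {F : Type*} [NormedAddCommGroup F] [NormedSpace ℝ F]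
    {f : M → F} (hf : ChartSmooth n 1 f) (p : M) : MDifferentiableAt (𝓡∂ n) 𝓘(ℝ, F) f p := by
  rw [mdifferentiableAt_iff]
  exact ⟨hf.continuous.continuousAt,
    hf.differentiableWithinAt one_ne_zero (mem_extChartAt_target p)⟩

/-- The gradient of the coordinate `x 0` of the chart around `q`. -/
def inwardGrad (X : M → EuclideanSpace ℝ (Fin (n + 1))) (q : M) (x : EuclideanSpace ℝ (Fin n)) :
    EuclideanSpace ℝ (Fin (n + 1)) :=
  raise (frame X q x) (Pi.single 0 1)

theorem inwardGrad_eq_sum (X : M → EuclideanSpace ℝ (Fin (n + 1))) (q : M)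
    (x : EuclideanSpace ℝ (Fin n)) :
    inwardGrad X q x = ∑ i, (gram X q x)⁻¹ i 0 • frame X q x i := by
  rw [inwardGrad, raise, ← gram_eq_gram_frame]
  simp [Pi.single_apply]

theorem inv_gram_comm (X : M → EuclideanSpace ℝ (Fin (n + 1))) (q : M)
    (x : EuclideanSpace ℝ (Fin n)) (i j : Fin n) : (gram X q x)⁻¹ i j = (gram X q x)⁻¹ j i := by
  conv_lhs => rw [← gram_transpose X q x, ← Matrix.transpose_nonsing_inv]
  rfl

theorem comps_zero_eq_inner (X Y : M → EuclideanSpace ℝ (Fin (n + 1))) (q : M)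
    (x : EuclideanSpace ℝ (Fin n)) :
    comps X Y q 0 x = inner ℝ (rep q Y x) (inwardGrad X q x) := by
  rw [inwardGrad_eq_sum, inner_sum, comps]
  exact Finset.sum_congr rfl fun j _ => by rw [inner_smul_right, inv_gram_comm]

namespace IsHypersurface

theorem conormalVec_eq_sum (h : IsHypersurface k X ν) (p : M) :
    conormalVec X p = ∑ i, (-(gram X p (extChartAt (𝓡∂ n) p p))⁻¹ 0 i /
      √((gram X p (extChartAt (𝓡∂ n) p p))⁻¹ 0 0)) • frame X p (extChartAt (𝓡∂ n) p p) i :=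
  mfderiv_eq_sum ((h.smooth.of_le le_add_self).mdifferentiableAt p) (conormal X p)

theorem conormalVec_eq (h : IsHypersurface k X ν) (p : M) :
    conormalVec X p = -(√((gram X p (extChartAt (𝓡∂ n) p p))⁻¹ 0 0))⁻¹ •
      inwardGrad X p (extChartAt (𝓡∂ n) p p) := by
  rw [h.conormalVec_eq_sum, inwardGrad_eq_sum, Finset.smul_sum]
  refine Finset.sum_congr rfl fun i _ => ?_
  rw [smul_smul, inv_gram_comm]
  congr 1
  rw [neg_div, div_eq_inv_mul, neg_mul]

theorem conormalDeriv_eq (h : IsHypersurface k X ν) {f : M → ℝ} (hf : ChartSmooth n 1 f) (p : M) :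
    conormalDeriv X f p = inner ℝ (sgrad X f p) (conormalVec X p) := by
  rw [h.conormalVec_eq_sum, inner_sum]
  refine (mfderiv_eq_sum (hf.mdifferentiableAt p) (conormal X p)).trans
    (Finset.sum_congr rfl fun i _ => ?_)
  rw [inner_smul_right, sgrad, inner_raise (h.linearIndependent p _ (mem_extChartAt_target p))]
  rfl

theorem inner_inwardGrad (h : IsHypersurface k X ν) {q : M} {x : EuclideanSpace ℝ (Fin n)}
    (hx : x ∈ (extChartAt (𝓡∂ n) q).target) (i : Fin n) :
    inner ℝ (inwardGrad X q x) (frame X q x i) = (Pi.single 0 1 : Fin n → ℝ) i :=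
  inner_raise (h.linearIndependent q x hx) _ i

/-- The squared length `|∇x⁰|² = g^{00}`, which is the normalization in the definition of the
conormal. -/
theorem inner_inwardGrad_self (h : IsHypersurface k X ν) {q : M} {x : EuclideanSpace ℝ (Fin n)}
    (hx : x ∈ (extChartAt (𝓡∂ n) q).target) :
    inner ℝ (inwardGrad X q x) (inwardGrad X q x) = (gram X q x)⁻¹ 0 0 := by
  conv_lhs => enter [3]; rw [inwardGrad_eq_sum]
  simp only [inner_sum, inner_smul_right, h.inner_inwardGrad hx]
  simp [Pi.single_apply]

theorem inv_gram_zero_zero_pos (h : IsHypersurface k X ν) {q : M} {x : EuclideanSpace ℝ (Fin n)}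
    (hx : x ∈ (extChartAt (𝓡∂ n) q).target) : 0 < (gram X q x)⁻¹ 0 0 := by
  rw [← h.inner_inwardGrad_self hx]
  refine lt_of_le_of_ne real_inner_self_nonneg fun h0 => ?_
  have h1 := h.inner_inwardGrad hx 0
  rw [inner_self_eq_zero.1 h0.symm, inner_zero_left, Pi.single_eq_same] at h1
  exact zero_ne_one h1

variable [IsManifold (𝓡∂ n) ∞ M]

/-- Along the boundary the coordinates `x⁰` of two charts have proportional differentials, because
row `0` of the Jacobian has only its first entry; so their gradients are proportional. -/
theorem inwardGrad_change (h : IsHypersurface k X ν) {q r : M} {x : EuclideanSpace ℝ (Fin n)}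
    (hx : x ∈ overlap q r) (h0 : x 0 = 0) :
    inwardGrad X r (coordChange q r x) = jacobian q r x 0 0 • inwardGrad X q x := by
  have hr := (coordChange_mem_overlap hx).1
  refine eq_of_inner_frame (h.linearIndependent q x hx.1) (h.norm_rep q x) (h.normal q x hx.1)
    (fun i => ?_) ?_
  · have h1 : frame X q x i = ∑ j, jacobian q r x j i • frame X r (coordChange q r x) j :=
      pd_rep_change hx (h.smooth.differentiableWithinAt (by simp) hr) i
    rw [real_inner_smul_left, h.inner_inwardGrad hx.1, h1, inner_sum]
    simp only [inner_smul_right, h.inner_inwardGrad hr]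
    simp only [Pi.single_apply, mul_ite, mul_one, mul_zero, Finset.sum_ite_eq', Finset.mem_univ,
      if_true]
    split_ifs with hi
    · rw [hi]
    · exact jacobian_zero_of_ne hx h0 hi
  · rw [real_inner_smul_left, inwardGrad, inwardGrad, inner_raise_normal (h.normal q x hx.1),
      mul_zero, ← rep_coordChange hx, inner_raise_normal (h.normal r _ hr)]

/-- The outward unit conormal in an arbitrary chart. -/
theorem rep_conormalVec (h : IsHypersurface k X ν) {q : M} {x : EuclideanSpace ℝ (Fin n)}
    (hx : x ∈ (extChartAt (𝓡∂ n) q).target) (h0 : x 0 = 0) :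
    rep q (conormalVec X) x = -(√((gram X q x)⁻¹ 0 0))⁻¹ • inwardGrad X q x := by
  set p := (extChartAt (𝓡∂ n) q).symm x with hp
  have ho : x ∈ overlap q p := mem_overlap_symm hx
  have hc := h.inwardGrad_change ho h0
  have hj := jacobian_zero_zero_pos ho h0
  -- The proportionality factor between the two inward gradients is positive, so it cancels on
  -- normalization without changing the sign.
  have hpx : extChartAt (𝓡∂ n) p p = coordChange q p x := rfl
  rw [rep, ← hp, h.conormalVec_eq, hpx, ← h.inner_inwardGrad_self (coordChange_mem_overlap ho).1,
    hc, real_inner_smul_left, real_inner_smul_right, h.inner_inwardGrad_self hx, ← mul_assoc,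
    ← sq, Real.sqrt_mul (sq_nonneg _), Real.sqrt_sq hj.le, smul_smul, mul_inv, neg_mul,
    mul_right_comm, inv_mul_cancel₀ hj.ne', one_mul]

end IsHypersurface

end Conormal

/-! ### The boundary density and the flux through the boundary -/

section BoundaryDensity

/-- Cramer's rule for the entry `(0, 0)` of the inverse; it relates the boundary metric to `det g`
and `g^{00}`. -/
theorem det_submatrix_succ {m : ℕ} {G : Matrix (Fin (m + 1)) (Fin (m + 1)) ℝ} (hG : G.det ≠ 0) :
    (G.submatrix Fin.succ Fin.succ).det = G.det * G⁻¹ 0 0 := by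
  have h := Matrix.adjugate_fin_succ_eq_det_submatrix G 0 0
  simp only [Fin.val_zero, add_zero, pow_zero, one_mul, Fin.succAbove_zero] at h
  rw [← h, Matrix.inv_def, Matrix.smul_apply, Ring.inverse_eq_inv', smul_eq_mul,
    mul_inv_cancel_left₀ hG]

variable {m : ℕ} {M : Type*} [TopologicalSpace M] [ChartedSpace (EuclideanHalfSpace (m + 1)) M]
  [IsManifold (𝓡∂ (m + 1)) ∞ M] {X ν : M → EuclideanSpace ℝ (Fin (m + 1 + 1))} {k : ℕ∞ω}

/-- Here `Y⁰ = ⟨Y, ∇x⁰⟩ = -√g^{00} ⟨Y, 𝔫⟩`, and `√(det g) √g^{00}` is the boundary density. This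
matches the boundary term of the half-space theorem with the integral over `∂M`. -/
theorem IsHypersurface.sqrt_det_mul_comps_zero (h : IsHypersurface k X ν)
    (Y : M → EuclideanSpace ℝ (Fin (m + 1 + 1))) {q : M} {x : EuclideanSpace ℝ (Fin (m + 1))}
    (hx : x ∈ (extChartAt (𝓡∂ (m + 1)) q).target) (h0 : x 0 = 0) :
    √(gram X q x).det * comps X Y q 0 x =
      -(√((gram X q x).submatrix Fin.succ Fin.succ).det *
        rep q (fun p => inner ℝ (Y p) (conormalVec X p)) x) := by
  have hp := Real.sqrt_pos.2 (h.inv_gram_zero_zero_pos hx)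
  have h1 : rep q (fun p => inner ℝ (Y p) (conormalVec X p)) x =
    inner ℝ (rep q Y x) (rep q (conormalVec X) x) := rfl
  rw [h1, h.rep_conormalVec hx h0, comps_zero_eq_inner, inner_smul_right,
    det_submatrix_succ (h.det_pos hx).ne', Real.sqrt_mul (h.det_pos hx).le]
  field_simp

end BoundaryDensity

theorem continuous_face {m : ℕ} : Continuous (face (m := m)) := by
  unfold face
  fun_prop

/-! ### Divergence and gradient are local -/

section Vanishing

variable {n : ℕ} [NeZero n] {M : Type*} [TopologicalSpace M] [ChartedSpace (EuclideanHalfSpace n) M]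

theorem pd_rep_eq_zero {F : Type*} [NormedAddCommGroup F] [NormedSpace ℝ F] {f : M → F} {p : M}
    (hf : ∀ᶠ r in 𝓝 p, f r = 0) (i : Fin n) : pd i (rep p f) (extChartAt (𝓡∂ n) p p) = 0 := by
  have hx := mem_extChartAt_target (I := 𝓡∂ n) p
  have h1 : rep p f =ᶠ[𝓝[range (𝓡∂ n)] (extChartAt (𝓡∂ n) p p)] fun _ => 0 := by
    rw [← nhdsWithin_extChartAt_target_eq_of_mem hx]
    refine (continuousOn_extChartAt_symm p _ hx).eventually (p := fun r => f r = 0) ?_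
    rwa [extChartAt_to_inv]
  have h2 : rep p f (extChartAt (𝓡∂ n) p p) = 0 := by
    rw [rep, extChartAt_to_inv]; exact hf.self_of_nhds
  rw [pd, h1.fderivWithin_eq h2, fderivWithin_const_apply]
  rfl

theorem surfDiv_eq_zero {X Y : M → EuclideanSpace ℝ (Fin (n + 1))} {p : M}
    (hY : ∀ᶠ r in 𝓝 p, Y r = 0) : surfDiv X Y p = 0 := by
  have h : pairing Y X p (extChartAt (𝓡∂ n) p p) = 0 := by
    ext i j
    simp only [pairing, frame, Matrix.of_apply, pd_rep_eq_zero hY, inner_zero_left,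
      Matrix.zero_apply]
  rw [surfDiv, h, Matrix.mul_zero, Matrix.trace_zero]

theorem sgrad_eq_zero {X : M → EuclideanSpace ℝ (Fin (n + 1))} {f : M → ℝ} {p : M}
    (hf : ∀ᶠ r in 𝓝 p, f r = 0) : sgrad X f p = 0 := by
  simp only [sgrad, raise, pd_rep_eq_zero hf, mul_zero, Finset.sum_const_zero, zero_smul]

theorem surfDiv_sum {ι : Type*} (s : Finset ι) {X : M → EuclideanSpace ℝ (Fin (n + 1))}
    {Y : ι → M → EuclideanSpace ℝ (Fin (n + 1))} (hY : ∀ i, ChartSmooth n 1 (Y i)) (p : M) :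
    surfDiv X (fun p => ∑ i ∈ s, Y i p) p = ∑ i ∈ s, surfDiv X (Y i) p := by
  classical
  have hs : ∀ s : Finset ι, ChartSmooth n 1 fun p => ∑ i ∈ s, Y i p := fun s q =>
    ContDiffOn.sum fun i _ => hY i q
  induction s using Finset.induction_on with
  | empty => simpa using surfDiv_eq_zero (X := X) (p := p) (Y := fun _ => 0) (by simp)
  | insert a s ha ih =>
    simp only [Finset.sum_insert ha]
    rw [surfDiv_add (hY a) (hs s), ih]

end Vanishing

/-! ### The divergence theorem in a chart -/

section ChartDivergence

variable {m : ℕ} {M : Type*} [TopologicalSpace M] [ChartedSpace (EuclideanHalfSpace (m + 1)) M]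

/-- The divergence theorem in a chart, for fields that vanish off a compact part of it. -/
theorem integral_divergence_chart {q : M}
    {u : Fin (m + 1) → EuclideanSpace ℝ (Fin (m + 1)) → ℝ}
    (hu : ∀ i, ContDiffOn ℝ 1 (u i) (extChartAt (𝓡∂ (m + 1)) q).target)
    {C : Set (EuclideanSpace ℝ (Fin (m + 1)))} (hC : IsCompact C)
    (hCT : C ⊆ (extChartAt (𝓡∂ (m + 1)) q).target)
    (h0 : ∀ i, ∀ x ∈ (extChartAt (𝓡∂ (m + 1)) q).target, x ∉ C → u i x = 0) :
    ∫ x in C, ∑ i, pd i (u i) x = -∫ y in {y | face y ∈ C}, u 0 (face y) := by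
  classical
  set T := (extChartAt (𝓡∂ (m + 1)) q).target with hT
  -- Extension of the field by zero off `C`. At points of `C` it agrees with `u` on the relatively
  -- open target, and off the closed set `C` it vanishes locally, so regularity is inherited
  -- everywhere in the half-space, also at the edge of `C`.
  let v : Fin (m + 1) → EuclideanSpace ℝ (Fin (m + 1)) → ℝ := fun i => C.indicator (u i)
  have hvu : ∀ i, EqOn (v i) (u i) T := fun i x hx => by
    by_cases hxC : x ∈ C
    · exact indicator_of_mem hxC _
    · exact (indicator_of_notMem hxC _).trans (h0 i x hx hxC).symm
  have hv0 : ∀ i x, x ∉ C → v i =ᶠ[𝓝 x] fun _ => 0 := fun i x hx => by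
    filter_upwards [hC.isClosed.isOpen_compl.mem_nhds hx] with z hz
    exact indicator_of_notMem hz _
  let v' : Fin (m + 1) → EuclideanSpace ℝ (Fin (m + 1)) → EuclideanSpace ℝ (Fin (m + 1)) →L[ℝ] ℝ :=
    fun i x => if x ∈ C then fderivWithin ℝ (u i) (range (𝓡∂ (m + 1))) x else 0
  have hint : ∀ x ∈ C, ∑ i, v' i x (EuclideanSpace.single i 1) = ∑ i, pd i (u i) x := fun x hx =>
    Finset.sum_congr rfl fun i _ => by simp only [v', if_pos hx]; rfl
  have hbd : ∫ y in {y | face y ∈ C}, u 0 (face y) =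
      ∫ y : EuclideanSpace ℝ (Fin m), v 0 (face y) := by
    have hm : MeasurableSet {y : EuclideanSpace ℝ (Fin m) | face y ∈ C} :=
      (hC.isClosed.preimage continuous_face).measurableSet
    rw [← integral_indicator hm]
    rfl
  rw [hbd, ← setIntegral_congr_fun hC.measurableSet hint]
  refine integral_divergence_halfSpace (u := v) (u' := v') hC
    (fun x hx => extChartAt_zero_nonneg (hCT hx)) (fun i x hx => ?_) (fun i x hx => ?_)
    (fun i x hx => indicator_of_notMem hx _) (fun x hx => ?_) ?_
  · by_cases hxC : x ∈ C
    · have h1 : ContinuousWithinAt (v i) T x :=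
        ((hu i).continuousOn x (hCT hxC)).congr (hvu i) (hvu i (hCT hxC))
      have h2 := h1.mono_of_mem_nhdsWithin (extChartAt_target_mem_nhdsWithin_of_mem (hCT hxC))
      rwa [range_modelWithCornersEuclideanHalfSpace] at h2
    · exact (continuousAt_const.congr (hv0 i x hxC).symm).continuousWithinAt
  · by_cases hxC : x ∈ C
    · have h1 := (differentiableWithinAt_range (hu i) one_ne_zero
        (hCT hxC)).hasFDerivWithinAt.hasFDerivAt (range_mem_nhds hx)
      simp only [v', if_pos hxC]
      refine h1.congr_of_eventuallyEq ?_
      have hTx : T ∈ 𝓝 x := by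
        have := extChartAt_target_mem_nhdsWithin_of_mem (hCT hxC)
        rwa [nhdsWithin_eq_nhds.2 (range_mem_nhds hx)] at this
      filter_upwards [hTx] with z hz using hvu i hz
    · simp only [v', if_neg hxC]
      exact (hasFDerivAt_const (0 : ℝ) x).congr_of_eventuallyEq (hv0 i x hxC)
  · simp only [v', if_neg hx, zero_apply, Finset.sum_const_zero]
  · refine IntegrableOn.congr_fun ?_ (fun x hx => (hint x hx).symm) hC.measurableSet
    refine ContinuousOn.integrableOn_compact hC ?_
    exact continuousOn_finsetSum _ fun i _ =>
      ((contDiffOn_pd (k := 0) (hu i) (by simp) i).continuousOn).mono hCT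

end ChartDivergence

/-! ### The divergence theorem for fields supported in one chart -/

section Stokes

variable {m : ℕ} {M : Type*} [TopologicalSpace M] [ChartedSpace (EuclideanHalfSpace (m + 1)) M]
  [IsManifold (𝓡∂ (m + 1)) ∞ M]
  {X ν Y : M → EuclideanSpace ℝ (Fin (m + 1 + 1))} {k : ℕ∞ω}

theorem IsHypersurface.continuous_surfDiv (h : IsHypersurface k X ν) (hk : 1 ≤ k)
    (hY : ChartSmooth (m + 1) 1 Y) : Continuous (surfDiv X Y) :=
  (h.chartSmooth_surfDiv (l := 0) (by simpa using hk) (by simpa using hY)).continuous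

variable [T2Space M] [SigmaCompactSpace M] [MeasurableSpace M] [BorelSpace M]

/-- In coordinates the integrand is `∂_i (√(det g) Y^i)`, and the half-space theorem leaves `-√(det
g) Y⁰` on the face. -/
theorem IsHypersurface.integral_surfDiv_chart (h : IsHypersurface k X ν) (hk : 1 ≤ k)
    (hY : ChartSmooth (m + 1) 1 Y) (hYν : ∀ p, inner ℝ (Y p) (ν p) = 0) {q : M} {K : Set M}
    (hK : IsCompact K) (hKq : K ⊆ (extChartAt (𝓡∂ (m + 1)) q).source) (hs : ∀ p ∉ K, Y p = 0) :
    ∫ p, surfDiv X Y p ∂(volMeasure X) =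
      ∫ y in {y | face y ∈ extChartAt (𝓡∂ (m + 1)) q '' K},
        √((gram X q (face y)).submatrix Fin.succ Fin.succ).det *
          rep q (fun p => inner ℝ (Y p) (conormalVec X p)) (face y) := by
  have hD : IsCompact (extChartAt (𝓡∂ (m + 1)) q '' K) :=
    hK.image_of_continuousOn ((continuousOn_extChartAt q).mono hKq)
  have hDT : extChartAt (𝓡∂ (m + 1)) q '' K ⊆ (extChartAt (𝓡∂ (m + 1)) q).target := by
    rintro _ ⟨p, hp, rfl⟩
    exact (extChartAt (𝓡∂ (m + 1)) q).map_source (hKq hp)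
  have h0 : ∀ p ∉ K, surfDiv X Y p = 0 := fun p hp => surfDiv_eq_zero (by
    filter_upwards [hK.isClosed.isOpen_compl.mem_nhds hp] with r hr using hs r hr)
  have hdiv := integral_divergence_chart (q := q)
    (u := fun i x => √(gram X q x).det * comps X Y q i x)
    (fun i => ((h.contDiffOn_sqrt_det q).of_le hk).mul (h.contDiffOn_comps hk hY q i)) hD hDT
    (fun i x hx hxC => by
      have : rep q Y x = 0 := hs _ fun hK' => hxC ⟨_, hK', (extChartAt (𝓡∂ (m + 1)) q).right_inv hx⟩
      simp only [comps, this, inner_zero_left, mul_zero, Finset.sum_const_zero])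
  rw [integral_volMeasure_of_subset_source h hK hKq (h.continuous_surfDiv hk hY) h0]
  have h1 : ∫ x in extChartAt (𝓡∂ (m + 1)) q '' K, rep q (surfDiv X Y) x * √(gram X q x).det =
      ∫ x in extChartAt (𝓡∂ (m + 1)) q '' K,
        ∑ i, pd i (fun x => √(gram X q x).det * comps X Y q i x) x :=
    setIntegral_congr_fun hD.measurableSet fun x hx => by
      rw [h.sum_pd_comps hk hY hYν (hDT hx), h.rep_surfDiv hY (hDT hx), mul_comm]
  rw [h1, hdiv, ← integral_neg]
  refine setIntegral_congr_fun (hD.isClosed.preimage continuous_face).measurableSet fun y hy => ?_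
  rw [h.sqrt_det_mul_comps_zero Y (hDT hy) (face_apply_zero y), neg_neg]

end Stokes

/-! ### Integration over the boundary and the global divergence theorem -/

section BoundaryMeasure

variable {m : ℕ} {M : Type*} [TopologicalSpace M] [ChartedSpace (EuclideanHalfSpace (m + 1)) M]

/-- The function `f` is continuous along the boundary, in the preferred charts. -/
def BoundaryContinuous (m : ℕ) {M : Type*} [TopologicalSpace M]
    [ChartedSpace (EuclideanHalfSpace (m + 1)) M] (f : M → ℝ) : Prop :=
  ∀ q, ContinuousOn (fun y => rep q f (face y)) {y | face y ∈ (extChartAt (𝓡∂ (m + 1)) q).target}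

theorem measurableSet_boundaryTarget (q : M) :
    MeasurableSet {y : EuclideanSpace ℝ (Fin m) | face y ∈ (extChartAt (𝓡∂ (m + 1)) q).target} :=
  continuous_face.measurable (measurableSet_target q)

theorem continuousOn_symm_face (q : M) :
    ContinuousOn (fun y => (extChartAt (𝓡∂ (m + 1)) q).symm (face y))
      {y : EuclideanSpace ℝ (Fin m) | face y ∈ (extChartAt (𝓡∂ (m + 1)) q).target} :=
  (continuousOn_extChartAt_symm q).comp continuous_face.continuousOn fun _ hy => hy

/-- The projection of `ℝ^(m+1)` onto the last `m` coordinates. -/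
def dropZero (x : EuclideanSpace ℝ (Fin (m + 1))) : EuclideanSpace ℝ (Fin m) :=
  WithLp.toLp 2 fun i => x i.succ

theorem continuous_dropZero : Continuous (dropZero (m := m)) := by
  unfold dropZero
  fun_prop

theorem dropZero_face (y : EuclideanSpace ℝ (Fin m)) : dropZero (face y) = y := rfl

theorem face_dropZero {x : EuclideanSpace ℝ (Fin (m + 1))} (hx : x 0 = 0) :
    face (dropZero x) = x := by
  ext i
  refine Fin.cases ?_ (fun j => ?_) i
  · exact hx.symm
  · rfl

theorem isCompact_preimage_face {C : Set (EuclideanSpace ℝ (Fin (m + 1)))} (hC : IsCompact C) :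
    IsCompact {y : EuclideanSpace ℝ (Fin m) | face y ∈ C} :=
  (hC.image continuous_dropZero).of_isClosed_subset (hC.isClosed.preimage continuous_face)
    fun y hy => ⟨face y, hy, dropZero_face y⟩

theorem IsHypersurface.continuousOn_sqrt_det_face {X ν : M → EuclideanSpace ℝ (Fin (m + 1 + 1))}
    {k : ℕ∞ω} (h : IsHypersurface k X ν) (q : M) :
    ContinuousOn (fun y => √((gram X q (face y)).submatrix Fin.succ Fin.succ).det)
      {y : EuclideanSpace ℝ (Fin m) | face y ∈ (extChartAt (𝓡∂ (m + 1)) q).target} := by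
  have h1 : ContinuousOn (fun x => √((gram X q x).submatrix Fin.succ Fin.succ).det)
      (extChartAt (𝓡∂ (m + 1)) q).target :=
    Real.continuous_sqrt.comp_continuousOn (MatrixContDiffOn.det (k := k)
      fun i j => h.matrixContDiffOn_gram q i.succ j.succ).continuousOn
  exact h1.comp continuous_face.continuousOn fun _ hy => hy

/-- The boundary points in the domain of the chart around `q`. -/
def chartBoundary (m : ℕ) {M : Type*} [TopologicalSpace M]
    [ChartedSpace (EuclideanHalfSpace (m + 1)) M] (q : M) : Set M :=
  (extChartAt (𝓡∂ (m + 1)) q).source ∩ extChartAt (𝓡∂ (m + 1)) q ⁻¹' {x | x 0 = 0}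

theorem symm_face_mem_chartBoundary {q : M} {y : EuclideanSpace ℝ (Fin m)}
    (hy : face y ∈ (extChartAt (𝓡∂ (m + 1)) q).target) :
    (extChartAt (𝓡∂ (m + 1)) q).symm (face y) ∈ chartBoundary m q := by
  refine ⟨(extChartAt (𝓡∂ (m + 1)) q).map_target hy, ?_⟩
  rw [mem_preimage, (extChartAt (𝓡∂ (m + 1)) q).right_inv hy]
  rfl

theorem BoundaryContinuous.continuousOn {f : M → ℝ} (hf : BoundaryContinuous m f) (q : M) :
    ContinuousOn f (chartBoundary m q) := by
  have hfd : ∀ p ∈ chartBoundary m q,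
      face (dropZero (extChartAt (𝓡∂ (m + 1)) q p)) = extChartAt (𝓡∂ (m + 1)) q p :=
    fun p hp => face_dropZero hp.2
  have h1 := (hf q).comp (s := chartBoundary m q)
    (f := fun p => dropZero (extChartAt (𝓡∂ (m + 1)) q p))
    (continuous_dropZero.comp_continuousOn ((continuousOn_extChartAt q).mono inter_subset_left))
    (fun p hp => by
      rw [mem_ofPred_eq, hfd p hp]
      exact (extChartAt (𝓡∂ (m + 1)) q).map_source hp.1)
  refine h1.congr fun p hp => ?_
  simp only [Function.comp, rep]
  rw [hfd p hp, (extChartAt (𝓡∂ (m + 1)) q).left_inv hp.1]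

theorem measurableSet_chartBoundary [MeasurableSpace M] [BorelSpace M] (q : M) : MeasurableSet (chartBoundary m q) := by
  obtain ⟨u, hu, hu'⟩ := continuousOn_iff_isClosed.1 (continuousOn_extChartAt (I := 𝓡∂ (m + 1)) q)
    {x | x 0 = 0} (isClosed_eq (by fun_prop) continuous_const)
  rw [chartBoundary, inter_comm, hu']
  exact hu.measurableSet.inter (isOpen_extChartAt_source q).measurableSet

variable {X ν Y : M → EuclideanSpace ℝ (Fin (m + 1 + 1))} {k : ℕ∞ω} [IsManifold (𝓡∂ (m + 1)) ∞ M]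

/-- Off the boundary `conormalVec` is tied to the preferred chart of each point, and no continuity
is claimed there. On the boundary `rep_conormalVec` gives one continuous formula throughout a chart,
and this is all that integration over `∂M` requires. -/
theorem IsHypersurface.boundaryContinuous_inner_conormalVec (h : IsHypersurface k X ν)
    (hY : Continuous Y) : BoundaryContinuous m fun p => inner ℝ (Y p) (conormalVec X p) := by
  intro q
  have h1 : ContinuousOn (fun x => inner ℝ (rep q Y x)
      (-(√((gram X q x)⁻¹ 0 0))⁻¹ • inwardGrad X q x)) (extChartAt (𝓡∂ (m + 1)) q).target := by
    have hG := fun i j => (h.matrixContDiffOn_inv_gram q i j).continuousOn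
    refine (hY.comp_continuousOn (continuousOn_extChartAt_symm q)).inner ?_
    refine ContinuousOn.smul ((Real.continuous_sqrt.comp_continuousOn (hG 0 0)).inv₀
      fun x hx => (Real.sqrt_pos.2 (h.inv_gram_zero_zero_pos hx)).ne').neg ?_
    simp only [funext fun x => inwardGrad_eq_sum X q x]
    exact continuousOn_finsetSum _ fun i _ =>
      (hG i 0).smul (h.contDiffOn_frame q i).continuousOn
  refine (h1.comp continuous_face.continuousOn fun _ hy => hy).congr fun y hy => ?_
  simp only [Function.comp]
  rw [← h.rep_conormalVec hy (face_apply_zero y)]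
  rfl

variable [T2Space M] [SigmaCompactSpace M]

theorem IsHypersurface.continuousOn_boundaryDensity (h : IsHypersurface k X ν) (q : M) :
    ContinuousOn (fun y => rep q (chartPartition (m + 1) M q) (face y) *
      √((gram X q (face y)).submatrix Fin.succ Fin.succ).det)
      {y : EuclideanSpace ℝ (Fin m) | face y ∈ (extChartAt (𝓡∂ (m + 1)) q).target} :=
  ((chartSmooth_chartPartition q q).continuousOn.comp continuous_face.continuousOn
    fun _ hy => hy).mul (h.continuousOn_sqrt_det_face q)

variable [MeasurableSpace M]

/-- The contribution of the chart around `q` to the volume measure of the boundary. -/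
def boundaryChartMeasure (X : M → EuclideanSpace ℝ (Fin (m + 1 + 1))) (q : M) : Measure M :=
  ((volume.restrict {y : EuclideanSpace ℝ (Fin m) |
      face y ∈ (extChartAt (𝓡∂ (m + 1)) q).target}).withDensity fun y =>
    ENNReal.ofReal (rep q (chartPartition (m + 1) M q) (face y) *
      √((gram X q (face y)).submatrix Fin.succ Fin.succ).det)).map
  fun y => (extChartAt (𝓡∂ (m + 1)) q).symm (face y)

theorem boundaryMeasure_eq_sum (X : M → EuclideanSpace ℝ (Fin (m + 1 + 1))) :
    boundaryMeasure X = Measure.sum (boundaryChartMeasure X) := rfl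

variable [BorelSpace M]

/-- The measure is carried by the boundary points of the chart, a measurable set on which `f` is
continuous. -/
theorem BoundaryContinuous.aestronglyMeasurable {f : M → ℝ} (hf : BoundaryContinuous m f)
    (h : IsHypersurface k X ν) (q : M) : AEStronglyMeasurable f (boundaryChartMeasure X q) := by
  have h0 : boundaryChartMeasure X q (chartBoundary m q)ᶜ = 0 :=
    parametrization_apply_eq_zero volume (measurableSet_boundaryTarget q)
      (continuousOn_symm_face q) (h.continuousOn_boundaryDensity q)
      (measurableSet_chartBoundary q).compl
      fun y hy hyS => absurd (symm_face_mem_chartBoundary hy) hyS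
  rw [← Measure.restrict_eq_self_of_ae_mem (s := chartBoundary m q) (mem_ae_iff.2 h0)]
  exact (hf.continuousOn q).aestronglyMeasurable (measurableSet_chartBoundary q)

/-- Integration over the boundary in charts. -/
theorem integral_boundaryMeasure (h : IsHypersurface k X ν) {K : Set M} (hK : IsCompact K)
    {f : M → ℝ} (hf : BoundaryContinuous m f) (hs : ∀ p ∉ K, f p = 0) :
    Integrable f (boundaryMeasure X) ∧ ∫ p, f p ∂(boundaryMeasure X) =
      ∑ q ∈ chartsOn (m + 1) hK, ∫ y in {y | face y ∈ chartPart (m + 1) K q},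
        rep q (chartPartition (m + 1) M q) (face y) *
          √((gram X q (face y)).submatrix Fin.succ Fin.succ).det * rep q f (face y) := by
  have h1 : ∀ q, Integrable f (boundaryChartMeasure X q) ∧ ∫ p, f p ∂(boundaryChartMeasure X q) =
      ∫ y in {y | face y ∈ chartPart (m + 1) K q},
        rep q (chartPartition (m + 1) M q) (face y) *
          √((gram X q (face y)).submatrix Fin.succ Fin.succ).det * rep q f (face y) := fun q =>
    integral_parametrization volume (measurableSet_boundaryTarget q)
      (isCompact_preimage_face (isCompact_chartPart hK q)) (fun y hy => chartPart_subset K q hy)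
      (continuousOn_symm_face q) (h.continuousOn_boundaryDensity q)
      (fun y _ => mul_nonneg ((chartPartition (m + 1) M).nonneg q _) (Real.sqrt_nonneg _))
      (hf.aestronglyMeasurable h q) ((hf q).mono fun y hy => chartPart_subset K q hy)
      (fun y hyT hyC => by
        by_cases hyK : (extChartAt (𝓡∂ (m + 1)) q).symm (face y) ∈ K
        · rw [rep_chartPartition_eq_zero hyT hyK hyC, zero_mul, zero_mul]
        · rw [hs _ hyK, mul_zero])
  have h2 := integral_sum_of_support (boundaryChartMeasure X) hK.measurableSet
    (chartsOn (m + 1) hK)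
    (fun q hq => parametrization_apply_eq_zero volume (measurableSet_boundaryTarget q)
      (continuousOn_symm_face q) (h.continuousOn_boundaryDensity q) hK.measurableSet
      fun y _ hyK => by rw [rep, chartPartition_eq_zero hK hq hyK, zero_mul])
    hs fun q _ => (h1 q).1
  rw [boundaryMeasure_eq_sum]
  exact ⟨h2.1, h2.2.trans (Finset.sum_congr rfl fun q _ => (h1 q).2)⟩

/-- The divergence theorem on a hypersurface with boundary. -/
theorem IsHypersurface.integral_surfDiv (h : IsHypersurface k X ν) (hk : 1 ≤ k)
    (hY : ChartSmooth (m + 1) 1 Y) (hYν : ∀ p, inner ℝ (Y p) (ν p) = 0) {K : Set M}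
    (hK : IsCompact K) (hs : ∀ p ∉ K, Y p = 0) :
    ∫ p, surfDiv X Y p ∂(volMeasure X) =
      ∫ p, inner ℝ (Y p) (conormalVec X p) ∂(boundaryMeasure X) := by
  let Z : M → M → EuclideanSpace ℝ (Fin (m + 1 + 1)) :=
    fun q p => chartPartition (m + 1) M q p • Y p
  have hZ : ∀ q, ChartSmooth (m + 1) 1 (Z q) := fun q =>
    ((chartSmooth_chartPartition q).of_le (by norm_cast)).smul hY
  have hZs : ∀ q, ∀ p ∉ K ∩ tsupport (chartPartition (m + 1) M q), Z q p = 0 := fun q p hp => by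
    by_cases hpK : p ∈ K
    · rw [show Z q p = chartPartition (m + 1) M q p • Y p from rfl,
        image_eq_zero_of_notMem_tsupport fun h => hp ⟨hpK, h⟩, zero_smul]
    · rw [show Z q p = chartPartition (m + 1) M q p • Y p from rfl, hs p hpK, smul_zero]
  have hKc : ∀ q, IsCompact (K ∩ tsupport (chartPartition (m + 1) M q)) := fun q =>
    hK.inter_right (isClosed_tsupport _)
  -- The field is cut into finitely many pieces, each supported in one chart. The sum of the weights
  -- is `1` on `K`, and `Y` vanishes elsewhere.
  have hYZ : Y = fun p => ∑ q ∈ chartsOn (m + 1) hK, Z q p := by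
    funext p
    simp only [Z, ← Finset.sum_smul]
    by_cases hp : p ∈ K
    · rw [sum_chartPartition hK hp, one_smul]
    · rw [hs p hp, smul_zero]
  have h1 : ∀ p, surfDiv X Y p = ∑ q ∈ chartsOn (m + 1) hK, surfDiv X (Z q) p := fun p => by
    conv_lhs => rw [hYZ]
    exact surfDiv_sum _ hZ p
  have h0 : ∀ q, ∀ p ∉ K ∩ tsupport (chartPartition (m + 1) M q), surfDiv X (Z q) p = 0 :=
    fun q p hp => surfDiv_eq_zero (by
      filter_upwards [(hKc q).isClosed.isOpen_compl.mem_nhds hp] with r hr using hZs q r hr)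
  rw [integral_congr_ae (Eventually.of_forall h1), integral_finsetSum _ fun q _ =>
      integrable_volMeasure h (hKc q) (h.continuous_surfDiv hk (hZ q)) (h0 q),
    (integral_boundaryMeasure h hK (h.boundaryContinuous_inner_conormalVec hY.continuous)
      fun p hp => by rw [hs p hp, inner_zero_left]).2]
  refine Finset.sum_congr rfl fun q _ => ?_
  rw [h.integral_surfDiv_chart hk (hZ q) (fun p => by
      rw [show Z q p = chartPartition (m + 1) M q p • Y p from rfl, real_inner_smul_left, hYν,
        mul_zero]) (hKc q) (inter_subset_right.trans (tsupport_chartPartition_subset q)) (hZs q)]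
  refine setIntegral_congr_fun
    (isCompact_preimage_face (isCompact_chartPart hK q)).measurableSet fun y _ => ?_
  simp only [rep, Z, real_inner_smul_left]
  ring

end BoundaryMeasure

/-! ### Curvature and volume depend only on the immersion nearby -/

section Locality

variable {n : ℕ} [NeZero n] {M : Type*} [TopologicalSpace M] [ChartedSpace (EuclideanHalfSpace n) M]

theorem pd_rep_congr {F : Type*} [NormedAddCommGroup F] [NormedSpace ℝ F] {f g : M → F} {q : M}
    {x : EuclideanSpace ℝ (Fin n)} (hx : x ∈ (extChartAt (𝓡∂ n) q).target)
    (h : f =ᶠ[𝓝 ((extChartAt (𝓡∂ n) q).symm x)] g) (i : Fin n) :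
    pd i (rep q f) x = pd i (rep q g) x := by
  have h1 : rep q f =ᶠ[𝓝[range (𝓡∂ n)] x] rep q g := by
    rw [← nhdsWithin_extChartAt_target_eq_of_mem hx]
    exact (continuousOn_extChartAt_symm q _ hx).eventually (p := fun r => f r = g r) h
  rw [pd, pd, h1.fderivWithin_eq h.self_of_nhds]

variable {X₁ X₂ ν₁ ν₂ : M → EuclideanSpace ℝ (Fin (n + 1))} {k : ℕ∞ω} {U : Set M}

theorem frame_congr (hU : IsOpen U) (hX : EqOn X₁ X₂ U) {q : M} {x : EuclideanSpace ℝ (Fin n)}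
    (hx : x ∈ (extChartAt (𝓡∂ n) q).target) (hxU : (extChartAt (𝓡∂ n) q).symm x ∈ U) :
    frame X₁ q x = frame X₂ q x :=
  funext fun i => pd_rep_congr hx (hX.eventuallyEq_of_mem (hU.mem_nhds hxU)) i

theorem gram_congr (hU : IsOpen U) (hX : EqOn X₁ X₂ U) {q : M} {x : EuclideanSpace ℝ (Fin n)}
    (hx : x ∈ (extChartAt (𝓡∂ n) q).target) (hxU : (extChartAt (𝓡∂ n) q).symm x ∈ U) :
    gram X₁ q x = gram X₂ q x := by
  rw [gram_eq_gram_frame, gram_eq_gram_frame, frame_congr hU hX hx hxU]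

theorem meanCurvature_congr {l : ℕ∞ω} (h₁ : IsHypersurface k X₁ ν₁) (h₂ : IsHypersurface l X₂ ν₂)
    (hk : 1 ≤ k) (hl : 1 ≤ l) (hU : IsOpen U) (hX : EqOn X₁ X₂ U) (hν : EqOn ν₁ ν₂ U) :
    EqOn (meanCurvature X₁ ν₁) (meanCurvature X₂ ν₂) U := by
  intro p hp
  have hx := mem_extChartAt_target (I := 𝓡∂ n) p
  have hxU : (extChartAt (𝓡∂ n) p).symm (extChartAt (𝓡∂ n) p p) ∈ U := by
    rwa [extChartAt_to_inv]
  rw [meanCurvature, meanCurvature, h₁.secondForm_eq hk hx, h₂.secondForm_eq hl hx,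
    gram_congr hU hX hx hxU]
  simp only [pairing, frame_congr hU hX hx hxU, frame_congr hU hν hx hxU]

/-- The volume measure on an open set only depends on the immersion there. -/
theorem volMeasure_restrict_congr [IsManifold (𝓡∂ n) ∞ M] [T2Space M] [SigmaCompactSpace M]
    [MeasurableSpace M] [BorelSpace M] (hU : IsOpen U) (hX : EqOn X₁ X₂ U) :
    (volMeasure X₁).restrict U = (volMeasure X₂).restrict U := by
  rw [volMeasure_eq_sum, volMeasure_eq_sum, Measure.restrict_sum _ hU.measurableSet,
    Measure.restrict_sum _ hU.measurableSet]
  congr 1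
  funext q
  have hT := measurableSet_target (n := n) q
  have hg := continuousOn_extChartAt_symm (I := 𝓡∂ n) q
  have hgm : ∀ w : EuclideanSpace ℝ (Fin n) → ENNReal, AEMeasurable (extChartAt (𝓡∂ n) q).symm
      ((volume.restrict (extChartAt (𝓡∂ n) q).target).withDensity w) := fun w =>
    (hg.aemeasurable hT).mono_ac (withDensity_absolutelyContinuous _ _)
  have hA : MeasurableSet ((extChartAt (𝓡∂ n) q).symm ⁻¹' U ∩ (extChartAt (𝓡∂ n) q).target) := by
    obtain ⟨u, hu, hu'⟩ := continuousOn_iff'.1 hg U hU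
    rw [hu']
    exact hu.measurableSet.inter hT
  rw [chartMeasure, chartMeasure, Measure.restrict_map_of_aemeasurable (hgm _) hU.measurableSet,
    Measure.restrict_map_of_aemeasurable (hgm _) hU.measurableSet, restrict_withDensity',
    restrict_withDensity', Measure.restrict_restrict' hT]
  congr 1
  refine withDensity_congr_ae ?_
  filter_upwards [ae_restrict_mem hA] with x hx
  rw [gram_congr hU hX hx.2 hx.1]

end Locality

/-! ### Behaviour off the support and splitting of the energy -/

section Variation

variable {n : ℕ} [NeZero n] {M : Type*} [TopologicalSpace M] [ChartedSpace (EuclideanHalfSpace n) M]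
  {X ν : M → EuclideanSpace ℝ (Fin (n + 1))} {ε : ℝ}
  {F N : ℝ → M → EuclideanSpace ℝ (Fin (n + 1))}
  {V : M → EuclideanSpace ℝ (Fin (n + 1))} {Φ : M → ℝ} {U : Set M}

/-- Where a variation is constant, so is its unit normal field. -/
theorem IsVariation.normal_eq [IsManifold (𝓡∂ n) ∞ M] (h : IsVariation X ν ε F N) {δ : ℝ}
    (hδ : δ ≤ ε) (hU : IsOpen U) (hF : ∀ t ∈ Ioo (-δ) δ, EqOn (F t) X U) {t : ℝ}
    (ht : t ∈ Ioo (-δ) δ) : EqOn (N t) ν U := by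
  intro p hp
  have hsub : Ioo (-δ) δ ⊆ Ioo (-ε) ε := Ioo_subset_Ioo (neg_le_neg hδ) hδ
  have h0 : (0 : ℝ) ∈ Ioo (-δ) δ := by
    have := ht.1.trans ht.2
    constructor <;> linarith
  have hx := mem_extChartAt_target (I := 𝓡∂ n) p
  have hxp : (extChartAt (𝓡∂ n) p).symm (extChartAt (𝓡∂ n) p p) = p := extChartAt_to_inv p
  have hX := h.isHypersurface h.zero_mem
  rw [h.zero, h.normal_zero] at hX
  have hν1 : inner ℝ (ν p) (ν p) = (1 : ℝ) := by
    rw [real_inner_self_eq_norm_sq, hX.norm_normal]; norm_num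
  -- The frames of `F s` and `X` coincide at `p`, so `N s p` is a multiple of `ν p`, with
  -- coefficient of square `1`. The coefficient is continuous on a connected interval and equals `1`
  -- at time `0`, so it is `1` throughout.
  have key : ∀ s ∈ Ioo (-δ) δ, N s p = inner ℝ (N s p) (ν p) • ν p := fun s hs => by
    have hs' := h.isHypersurface (hsub hs)
    have h1 := frame_expansion (hX.linearIndependent p _ hx) (hX.norm_rep p _) (hX.normal p _ hx)
      (N s p)
    have h2 : ∀ i, inner ℝ (N s p) (frame X p (extChartAt (𝓡∂ n) p p) i) = 0 := fun i => by
      have h3 := hs'.normal p _ hx i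
      rwa [rep, hxp, frame_congr hU (hF s hs) hx (by rwa [hxp])] at h3
    simp only [h2] at h1
    rw [rep, hxp] at h1
    simpa [raise] using h1
  have hsq : EqOn ((fun s => (inner ℝ (N s p) (ν p) : ℝ)) ^ 2) ((fun _ => (1 : ℝ)) ^ 2)
      (Ioo (-δ) δ) := fun s hs => by
    have h1 : ‖N s p‖ = 1 := (h.isHypersurface (hsub hs)).norm_normal p
    rw [key s hs, norm_smul, hX.norm_normal, mul_one, Real.norm_eq_abs] at h1
    simp only [Pi.pow_apply, one_pow]
    rw [← sq_abs, h1, one_pow]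
  have hc : ContinuousOn (fun s => (inner ℝ (N s p) (ν p) : ℝ)) (Ioo (-δ) δ) := by
    have h1 : ContinuousOn (fun s => N s p) (Ioo (-δ) δ) :=
      h.continuousOn_normal.comp (f := fun s : ℝ => (s, p)) (by fun_prop)
        fun s hs => ⟨hsub hs, trivial⟩
    exact h1.inner continuousOn_const
  have h1 := isPreconnected_Ioo.eq_of_sq_eq hc continuousOn_const hsq (fun _ => one_ne_zero) h0
    (by rw [h.normal_zero, hν1]) ht
  rw [key t ht, show (inner ℝ (N t p) (ν p) : ℝ) = 1 from h1, one_smul]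

namespace VariationData

theorem field_eq_zero (h : VariationData X ν ε F N V Φ) {p : M}
    (hp : p ∉ tsupport fun p => V p + Φ p • ν p) : V p = 0 ∧ Φ p = 0 := by
  replace hp : V p + Φ p • ν p = 0 :=
    image_eq_zero_of_notMem_tsupport (f := fun p => V p + Φ p • ν p) hp
  have hΦ : Φ p = 0 := by
    have h1 : inner ℝ (V p + Φ p • ν p) (ν p) = Φ p := by
      rw [inner_add_left, h.tangent, real_inner_smul_left, real_inner_self_eq_norm_sq,
        h.hypersurface.norm_normal]
      ring
    rw [← h1, hp, inner_zero_left]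
  rw [hΦ, zero_smul, add_zero] at hp
  exact ⟨hp, hΦ⟩

/-- At points off `K` the variation is constant for small times, so the field vanishes there; `K` is
closed. -/
theorem tsupport_subset [T2Space M] (h : VariationData X ν ε F N V Φ) {K : Set M} (hK : IsCompact K)
    (hF : ∀ᶠ t in 𝓝 (0 : ℝ), ∀ p ∉ K, F t p = X p) :
    (tsupport fun p => V p + Φ p • ν p) ⊆ K := by
  refine closure_minimal (fun p hp => ?_) hK.isClosed
  by_contra hpK
  refine hp ((h.hasDerivAt p).unique ((hasDerivAt_const 0 (X p)).congr_of_eventuallyEq ?_))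
  filter_upwards [hF] with t ht using ht p hpK

theorem interiorIntegrand_eq_zero (h : VariationData X ν ε F N V Φ) (c : ℝ) {p : M}
    (hp : p ∉ tsupport fun p => V p + Φ p • ν p) : interiorIntegrand c X ν Φ p = 0 := by
  rw [interiorIntegrand, (h.field_eq_zero hp).2, mul_zero]

theorem flux_eq_zero (h : VariationData X ν ε F N V Φ) (c : ℝ) {p : M}
    (hp : p ∉ tsupport fun p => V p + Φ p • ν p) : flux c X ν V Φ p = 0 := by
  have h1 := h.field_eq_zero hp
  have h2 : sgrad X Φ p = 0 := sgrad_eq_zero (by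
    filter_upwards [(isClosed_tsupport _).isOpen_compl.mem_nhds hp] with r hr
    exact (h.field_eq_zero hr).2)
  simp only [flux, h1.1, h1.2, h2, smul_zero, zero_smul, sub_zero, add_zero]

theorem surfDiv_flux_eq_zero (h : VariationData X ν ε F N V Φ) (c : ℝ) {p : M}
    (hp : p ∉ tsupport fun p => V p + Φ p • ν p) : surfDiv X (flux c X ν V Φ) p = 0 :=
  surfDiv_eq_zero (by
    filter_upwards [(isClosed_tsupport _).isOpen_compl.mem_nhds hp] with r hr
    exact h.flux_eq_zero c hr)

theorem inner_flux_normal (h : VariationData X ν ε F N V Φ) (c : ℝ) (p : M) :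
    inner ℝ (flux c X ν V Φ p) (ν p) = 0 := by
  simp only [flux, inner_add_left, inner_sub_left, real_inner_smul_left, h.tangent,
    h.hypersurface.inner_sgrad_normal, mul_zero, sub_zero, add_zero]

variable [IsManifold (𝓡∂ n) ∞ M]

/-- Each conormal derivative is the inner product of a gradient with `𝔫`; this identifies the flux
through the boundary. -/
theorem boundaryIntegrand_eq (h : VariationData X ν ε F N V Φ) (c : ℝ) (p : M) :
    boundaryIntegrand c X ν V Φ p = inner ℝ (flux c X ν V Φ p) (conormalVec X p) := by
  rw [boundaryIntegrand, h.hypersurface.conormalDeriv_eq (h.smooth_meanCurvature.of_le one_le_two),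
    h.hypersurface.conormalDeriv_eq (h.smooth_normal.of_le one_le_two)]
  simp only [flux, inner_add_left, inner_sub_left, real_inner_smul_left]

variable [T2Space M] [SigmaCompactSpace M] [MeasurableSpace M] [BorelSpace M]

theorem integrable_interiorIntegrand (h : VariationData X ν ε F N V Φ) (c : ℝ)
    (hsupp : HasCompactSupport fun p => V p + Φ p • ν p) :
    Integrable (interiorIntegrand c X ν Φ) (volMeasure X) :=
  integrable_volMeasure h.hypersurface hsupp (h.continuous_interiorIntegrand c)
    fun _ hp => h.interiorIntegrand_eq_zero c hp

theorem integrableOn_energyIntegrand (h : VariationData X ν ε F N V Φ) (c : ℝ) {K : Set M}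
    (hK : IsCompact K) {t : ℝ} (ht : t ∈ Ioo (-ε) ε) :
    IntegrableOn (fun p => (meanCurvature (F t) (N t) p + c) ^ 2) K (volMeasure (F t)) :=
  (integral_volMeasure (h.variation.isHypersurface ht) hK
    (h.variation.continuous_energyIntegrand c ht)).1

/-- The energy is the sum of the energy of a compact set and that of its complement, which does
not change if the variation is constant there. -/
theorem energy_eq_add (h : VariationData X ν ε F N V Φ) (c : ℝ) {K : Set M}
    (hK : IsCompact K) {t : ℝ} (ht : t ∈ Ioo (-ε) ε) (hF : EqOn (F t) X Kᶜ) (hN : EqOn (N t) ν Kᶜ)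
    (hi : Integrable (fun p => (meanCurvature X ν p + c) ^ 2) (volMeasure X)) :
    energy c (F t) (N t) = energyOn c (F t) (N t) K + energyOn c X ν Kᶜ := by
  have hU := hK.isClosed.isOpen_compl
  have hH := meanCurvature_congr (h.variation.isHypersurface ht) h.hypersurface one_le_two
    (by norm_num) hU hF hN
  have heq : EqOn (fun p => (meanCurvature (F t) (N t) p + c) ^ 2)
      (fun p => (meanCurvature X ν p + c) ^ 2) Kᶜ := fun p hp => by
    simp only [hH hp]
  have hvol := volMeasure_restrict_congr hU hF
  have hc : IntegrableOn (fun p => (meanCurvature (F t) (N t) p + c) ^ 2) Kᶜ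
      (volMeasure (F t)) := by
    refine IntegrableOn.congr_fun ?_ heq.symm hU.measurableSet
    rw [IntegrableOn, hvol]
    exact hi.integrableOn
  have hint := (h.integrableOn_energyIntegrand c hK ht).union hc
  rw [union_compl_self, integrableOn_univ] at hint
  rw [energy, energyOn, energyOn, ← integral_add_compl hK.measurableSet hint,
    setIntegral_congr_fun hU.measurableSet heq, hvol]

theorem eventually_energy_eq (h : VariationData X ν ε F N V Φ) (c : ℝ) {K : Set M}
    (hK : IsCompact K) (hF : ∀ᶠ t in 𝓝 (0 : ℝ), ∀ p ∉ K, F t p = X p)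
    (hi : Integrable (fun p => (meanCurvature X ν p + c) ^ 2) (volMeasure X)) :
    ∀ᶠ t in 𝓝 0,
      energy c (F t) (N t) = energyOn c (F t) (N t) K + energyOn c X ν Kᶜ := by
  obtain ⟨δ, hδ, hball⟩ := Metric.eventually_nhds_iff.1 hF
  have hpos := h.variation.pos
  -- The normals must be followed along a whole interval of times on which the variation both is
  -- defined and is fixed off `K`.
  obtain ⟨η, hη, hηδ, hηε⟩ : ∃ η : ℝ, 0 < η ∧ η ≤ δ ∧ η ≤ ε :=
    ⟨min δ ε, lt_min hδ hpos, min_le_left _ _, min_le_right _ _⟩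
  have hFt : ∀ t ∈ Ioo (-η) η, EqOn (F t) X Kᶜ := fun t ht p hp => by
    refine hball ?_ p hp
    rw [Real.dist_eq, sub_zero]
    exact (abs_lt.2 ht).trans_le hηδ
  have hmem : Ioo (-η) η ∈ 𝓝 (0 : ℝ) := Ioo_mem_nhds (neg_lt_zero.2 hη) hη
  filter_upwards [hmem] with t ht
  exact h.energy_eq_add c hK (Ioo_subset_Ioo (neg_le_neg hηε) hηε ht) (hFt t ht)
    (h.variation.normal_eq hηε hK.isClosed.isOpen_compl hFt ht) hi

end VariationData

end Variation

/-! ### The first variation formula -/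

section Conclusion

variable {m : ℕ} {M : Type*} [TopologicalSpace M] [ChartedSpace (EuclideanHalfSpace (m + 1)) M]
  [IsManifold (𝓡∂ (m + 1)) ∞ M] [T2Space M] [SigmaCompactSpace M] [MeasurableSpace M] [BorelSpace M]
  {X ν : M → EuclideanSpace ℝ (Fin (m + 1 + 1))} {ε : ℝ}
  {F N : ℝ → M → EuclideanSpace ℝ (Fin (m + 1 + 1))}
  {V : M → EuclideanSpace ℝ (Fin (m + 1 + 1))} {Φ : M → ℝ}

namespace VariationData

theorem integrable_boundaryIntegrand (h : VariationData X ν ε F N V Φ) (c : ℝ)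
    (hsupp : HasCompactSupport fun p => V p + Φ p • ν p) :
    Integrable (boundaryIntegrand c X ν V Φ) (boundaryMeasure X) := by
  rw [funext (h.boundaryIntegrand_eq c)]
  exact (integral_boundaryMeasure h.hypersurface hsupp
    (h.hypersurface.boundaryContinuous_inner_conormalVec (h.smooth_flux c).continuous)
    fun p hp => by rw [h.flux_eq_zero c hp, inner_zero_left]).1

/-- No regularity of the edge of `K` matters: interior integrand and divergence vanish off the
support of the field, so the integral over `K` is one over all of `M`, and the divergence theorem is
applied with that support. -/
theorem hasDerivAt_energyOn_firstVariation (h : VariationData X ν ε F N V Φ) (c : ℝ)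
    (hsupp : HasCompactSupport fun p => V p + Φ p • ν p) {K : Set M} (hK : IsCompact K)
    (hsK : (tsupport fun p => V p + Φ p • ν p) ⊆ K) :
    HasDerivAt (fun t => energyOn c (F t) (N t) K) (firstVariation c X ν V Φ) 0 := by
  refine (h.hasDerivAt_energyOn c hK).congr_deriv ?_
  rw [setIntegral_eq_integral_of_forall_compl_eq_zero fun p hp => by
      rw [h.interiorIntegrand_eq_zero c fun hp' => hp (hsK hp'),
        h.surfDiv_flux_eq_zero c fun hp' => hp (hsK hp'), mul_zero, add_zero],
    integral_add ((h.integrable_interiorIntegrand c hsupp).const_mul _)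
      (integrable_volMeasure h.hypersurface hsupp (h.continuous_surfDiv_flux c)
        fun p hp => h.surfDiv_flux_eq_zero c hp),
    integral_const_mul, h.hypersurface.integral_surfDiv (by norm_num) (h.smooth_flux c)
      (h.inner_flux_normal c) hsupp fun p hp => h.flux_eq_zero c hp, firstVariation]
  simp only [h.boundaryIntegrand_eq c]

end VariationData

end Conclusion

end Helfrich

end

/-- First variation of the Helfrich energy of an immersed hypersurface `X : M → ℝ^(n+1)` with
boundary, where `n = m + 1 ≥ 2`. -/
theorem mainTheorem11 (m : ℕ) (hm : 1 ≤ m)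
    {M : Type*} [TopologicalSpace M] [T2Space M] [SigmaCompactSpace M]
    [ChartedSpace (EuclideanHalfSpace (m + 1)) M] [IsManifold (𝓡∂ (m + 1)) ∞ M]
    [MeasurableSpace M] [BorelSpace M]
    (c : ℝ) (X ν : M → EuclideanSpace ℝ (Fin (m + 1 + 1)))
    (hX : ContMDiff (𝓡∂ (m + 1)) 𝓘(ℝ, EuclideanSpace ℝ (Fin (m + 1 + 1))) 4 X)
    (ε : ℝ) (F N : ℝ → M → EuclideanSpace ℝ (Fin (m + 1 + 1)))
    (hF : Helfrich.IsVariation X ν ε F N)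
    (V : M → EuclideanSpace ℝ (Fin (m + 1 + 1))) (Φ : M → ℝ)
    (hV : Helfrich.IsTangent X V)
    (hW : ∀ p, HasDerivAt (fun t => F t p) (V p + Φ p • ν p) 0)
    (hsupp : HasCompactSupport fun p => V p + Φ p • ν p) :
    -- the integrals on the right-hand side converge
    Integrable (Helfrich.interiorIntegrand c X ν Φ) (Helfrich.volMeasure X) ∧
    Integrable (Helfrich.boundaryIntegrand c X ν V Φ) (Helfrich.boundaryMeasure X) ∧
    -- the energy of any compact part of the hypersurface that contains the support of the
    -- variational field is finite and has the stated derivative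
    (∀ K : Set M, IsCompact K → (tsupport fun p => V p + Φ p • ν p) ⊆ K →
      (∀ t ∈ Ioo (-ε) ε, IntegrableOn (fun p => (Helfrich.meanCurvature (F t) (N t) p + c) ^ 2) K
        (Helfrich.volMeasure (F t))) ∧
      HasDerivAt (fun t => Helfrich.energyOn c (F t) (N t) K)
        (Helfrich.firstVariation c X ν V Φ) 0) ∧
    -- if the variation is constant off a compact set and the energy of `X` is finite (both hold
    -- when `M` is compact), the whole energy has the stated derivative
    ((∃ K : Set M, IsCompact K ∧ ∀ᶠ t in 𝓝 (0 : ℝ), ∀ p ∉ K, F t p = X p) →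
      Integrable (fun p => (Helfrich.meanCurvature X ν p + c) ^ 2) (Helfrich.volMeasure X) →
      HasDerivAt (fun t => Helfrich.energy c (F t) (N t))
        (Helfrich.firstVariation c X ν V Φ) 0) := by
  have h := Helfrich.variationData hX hF hV hW
  refine ⟨h.integrable_interiorIntegrand c hsupp, h.integrable_boundaryIntegrand c hsupp,
    fun K hK hsK => ⟨fun t ht => h.integrableOn_energyIntegrand c hK ht,
      h.hasDerivAt_energyOn_firstVariation c hsupp hK hsK⟩, ?_⟩
  rintro ⟨K, hK, hFK⟩ hi
  -- For small `t` the whole energy is the energy of `K` plus that of its complement, which is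
  -- independent of `t`.
  exact ((h.hasDerivAt_energyOn_firstVariation c hsupp hK (h.tsupport_subset hK hFK)).add_const
    _).congr_of_eventuallyEq (h.eventually_energy_eq c hK hFK hi)
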